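/- Let $n\ge 3$ be odd and let $f(x,y)=f_0x^n+f_1x^{n-1}y+\cdots+f_ny^n$ be a binary $n$-ic form with integer coefficients that is primitive, nondegenerate (nonzero discriminant) and irreducible over $\mathbb Q$. Let $K=\mathbb Q[\theta]/(f(\theta,1))$, put $\zeta_0=1$ and $\zeta_k=f_0\theta^k+\cdots+f_{k-1}\theta$ for $k>0$, and let $\mathcal O=R_f=\langle 1,\zeta_1,\dots,\zeta_{n-1}\rangle_{\mathbb Z}$, an order in $K$, with the (invertible) fractional ideal $I_f=\langle 1,\theta,\zeta_2,\dots,\zeta_{n-1}\rangle_{\mathbb Z}$. (No hypothesis on the Galois group is needed; in particular $\mathcal O$ may be any $S_n$-order of this form.) Let $(r_1,r_2)$ be the signature of $K$. For a fractional ideal $I$ put $N(I)=[\mathcal O:I]$ (generalised index), and for $\delta\in K$ let $N(\delta)=N_{K/\mathbb Q}(\delta)$. Let $\mathrm H(\mathcal O)$ be the group, under $(I,\delta)\circ(I',\delta')=(II',\delta\delta')$, of equivalence classes of pairs $(I,\delta)$ with $I$ an invertible fractional ideal of $\mathcal O$, $\delta\in K^\times$, $I^2=(\delta)$ and $N(I)^2=N(\delta)$,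 where $(I,\delta)\sim(\kappa I,\kappa^2\delta)$ for $\kappa\in K^\times$. Let $\mathrm{Cl}_2(\mathcal O)$ be the $2$-torsion subgroup of the ideal class group of $\mathcal O$ and $\mathcal I_2(\mathcal O)$ the group of invertible fractional ideals $J$ of $\mathcal O$ with $J^2=\mathcal O$. The group $\mathrm{SL}_n(\mathbb Z)$ acts by $\gamma(A,B)=(\gamma A\gamma^t,\gamma B\gamma^t)$ on the pairs $(A,B)$ of symmetric integral $n\times n$ matrices with $\det(Ax-By)=f(x,y)$. Say that such a pair corresponds to $(I,\delta)$, where $I$ is a fractional ideal of $\mathcal O$ and $\delta\in K^\times$, if $I^2\subseteq\delta I_f^{n-3}$, $N(I)^2=N(\delta)N(I_f^{n-3})$, and $I$ has a $\mathbb Z$-basis $\alpha_1,\dots,\alpha_n$ with the same orientation as $\zeta_0,\dots,\zeta_{n-1}$ such that for all $i,j$ there are integers $c_{ij}^{(k)}$ with $$\frac{\alpha_i\alpha_j}{\delta}=c_{ij}^{(0)}+c_{ij}^{(1)}\theta+\cdots+c_{ij}^{(n-3)}\theta^{n-3}+(-1)^{(n-1)/2}\bigl(b_{ij}\zeta_{n-2}+a_{ij}\zeta_{n-1}\bigr).$$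 Call $(A,B)$, and its orbit, projective if it corresponds to some $(I,\delta)$ with $I$ invertible, and reducible if the quadrics $A$ and $B$ contain a common rational linear subspace of $\mathbb P^{n-1}(\mathbb Q)$ of dimension $(n-3)/2$. Then: 1. There is a bijection from $\mathrm H(\mathcal O)$ to the set of projective $\mathrm{SL}_n(\mathbb Z)$-orbits of pairs with invariant $f$, under which the class of $(I,\delta)$ is sent to the orbit of $(A,B)$ if and only if $(A,B)$ corresponds to $(I\cdot I_f^{(n-3)/2},\delta)$. 2. The number of these projective orbits is finite and equal to $2^{r_1+r_2-1}\,|\mathrm{Cl}_2(\mathcal O)|$. 3. There is a bijection from the set of reducible projective orbits to $\mathcal I_2(\mathcal O)$, under which the orbit of $(A,B)$ is sent to $J$ if and only if $(A,B)$ corresponds to $(\kappa J\cdot I_f^{(n-3)/2},\kappa^2)$ for some $\kappa\in K^\times$. -/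

import Mathlib

open scoped nonZeroDivisors

namespace BinaryFormOrder

/-- The generalised index `[M : N] = [M : M ∩ N] / [N : M ∩ N]` of two lattices
(`N.relIndex M` is the index of `M ∩ N` in `M`). -/
noncomputable def latticeIndex {G : Type*} [AddGroup G] (M N : AddSubgroup G) : ℚ :=
  (N.relIndex M : ℚ) / (M.relIndex N : ℚ)

section Lattice

variable {G : Type*} [AddGroup G]

/-- Two lattices are commensurable if their intersection has finite index in both. -/
def Commens (M N : AddSubgroup G) : Prop := N.relIndex M ≠ 0 ∧ M.relIndex N ≠ 0

theorem Commens.symm {M N : AddSubgroup G} (h : Commens M N) : Commens N M := ⟨h.2, h.1⟩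

theorem Commens.trans {M N P : AddSubgroup G} (h : Commens M N) (h' : Commens N P) :
    Commens M P :=
  ⟨AddSubgroup.relIndex_ne_zero_trans h'.1 h.1, AddSubgroup.relIndex_ne_zero_trans h.2 h'.2⟩

theorem latticeIndex_eq_of_le {M N Q : AddSubgroup G} (hM : Q ≤ M) (hN : Q ≤ N)
    (h : Q.relIndex M ≠ 0) : latticeIndex M N = (Q.relIndex M : ℚ) / (Q.relIndex N : ℚ) := by
  have e1 := AddSubgroup.relIndex_mul_relIndex Q (M ⊓ N) M (le_inf hM hN) inf_le_left
  have e2 := AddSubgroup.relIndex_mul_relIndex Q (M ⊓ N) N (le_inf hM hN) inf_le_right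
  rw [AddSubgroup.inf_relIndex_left] at e1
  rw [AddSubgroup.inf_relIndex_right] at e2
  have h0 : (Q.relIndex (M ⊓ N) : ℚ) ≠ 0 := by
    intro h0
    rw [Nat.cast_eq_zero] at h0
    rw [h0, zero_mul] at e1
    exact h e1.symm
  rw [← e1, ← e2, latticeIndex]
  push_cast
  rw [mul_div_mul_left _ _ h0]

theorem latticeIndex_mul {M N P : AddSubgroup G} (h : Commens M N) (h' : Commens N P) :
    latticeIndex M N * latticeIndex N P = latticeIndex M P := by
  have hMP := h.trans h'
  set Q := M ⊓ (N ⊓ P) with hQ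
  have k1 : Q.relIndex M ≠ 0 := by
    rw [hQ, AddSubgroup.inf_relIndex_left]
    exact AddSubgroup.relIndex_inf_ne_zero h.1 hMP.1
  have k2 : Q.relIndex N ≠ 0 :=
    AddSubgroup.relIndex_inf_ne_zero h.2
      (AddSubgroup.relIndex_inf_ne_zero (by simp) h'.1)
  have qM : Q ≤ M := inf_le_left
  have qN : Q ≤ N := inf_le_right.trans inf_le_left
  have qP : Q ≤ P := inf_le_right.trans inf_le_right
  rw [latticeIndex_eq_of_le qM qN k1, latticeIndex_eq_of_le qN qP k2,
    latticeIndex_eq_of_le qM qP k1]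
  have k2' : (Q.relIndex N : ℚ) ≠ 0 := by exact_mod_cast k2
  rw [div_mul_div_cancel₀ k2']

end Lattice

section Order

variable {O K : Type*} [CommRing O] [Field K] [Algebra O K]

/-- The lattice underlying a fractional ideal. -/
def toLattice (I : FractionalIdeal O⁰ K) : AddSubgroup K :=
  (I : Submodule O K).toAddSubgroup

/-- The norm `N(I) = [O : I]` of a fractional ideal: the absolute value of the determinant of a
`ℤ`-basis of `I` with respect to a `ℤ`-basis of `O`. -/
noncomputable def latticeNorm (I : FractionalIdeal O⁰ K) : ℚ :=
  latticeIndex (toLattice (1 : FractionalIdeal O⁰ K)) (toLattice I)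

theorem latticeNorm_one : latticeNorm (1 : FractionalIdeal O⁰ K) = 1 := by
  simp [latticeNorm, latticeIndex]

variable [IsDomain O] [Module.Finite ℤ O] [CharZero O] [IsFractionRing O K]

theorem relIndex_coeIdeal_mul (I : (FractionalIdeal O⁰ K)ˣ) (A : Ideal O) (hA : A ≠ ⊥) :
    (toLattice ((A : FractionalIdeal O⁰ K) * (I : FractionalIdeal O⁰ K))).relIndex (toLattice (I : FractionalIdeal O⁰ K))
      = Nat.card (O ⧸ A) := by
  have : IsAddTorsionFree O := inferInstance
  have : Module.Free ℤ O := inferInstance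
  have : Finite (O ⧸ A) := A.finiteQuotientOfFreeOfNeBot hA
  let L : (Submodule O K)ˣ := FractionalIdeal.unitsMulEquivSubmodule I
  have : Module.Invertible O (L : Submodule O K) := inferInstance
  have e2 := TensorProduct.quotTensorEquivQuotSMul (L : Submodule O K) A
  have hfree : Module.Free (O ⧸ A) (TensorProduct O (O ⧸ A) (L : Submodule O K)) := inferInstance
  obtain ⟨e1⟩ := Module.Invertible.free_iff_linearEquiv.1 hfree
  have hc : Nat.card (O ⧸ A) =
      Nat.card ((L : Submodule O K) ⧸ (A • ⊤ : Submodule O (L : Submodule O K))) :=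
    Nat.card_congr (e1.symm.toEquiv.trans e2.toEquiv)
  rw [hc]
  have hL : ((I : FractionalIdeal O⁰ K) : Submodule O K) = L := rfl
  have key : ((((A : FractionalIdeal O⁰ K) * I : FractionalIdeal O⁰ K) : Submodule O K)).comap
      (L : Submodule O K).subtype = A • ⊤ := by
    rw [FractionalIdeal.coe_mul, FractionalIdeal.coe_coeIdeal, hL]
    have : IsLocalization.coeSubmodule K A * (L : Submodule O K) = A • (L : Submodule O K) := by
      apply le_antisymm
      · rw [Submodule.mul_le]
        rintro _ ⟨a, ha, rfl⟩ x hx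
        rw [Algebra.linearMap_apply, ← Algebra.smul_def]
        exact Submodule.smul_mem_smul ha hx
      · rw [Submodule.smul_le]
        intro a ha x hx
        rw [Algebra.smul_def]
        exact Submodule.mul_mem_mul ⟨a, ha, rfl⟩ hx
    rw [this]
    apply Submodule.map_injective_of_injective (L : Submodule O K).injective_subtype
    rw [Submodule.map_smul'', Submodule.map_comap_eq, Submodule.map_top, Submodule.range_subtype]
    exact inf_eq_right.2 Submodule.smul_le_right
  rw [← key]
  rfl

theorem commens_coeIdeal_mul (I : (FractionalIdeal O⁰ K)ˣ) (A : Ideal O) (hA : A ≠ ⊥) :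
    Commens (toLattice (I : FractionalIdeal O⁰ K)) (toLattice ((A : FractionalIdeal O⁰ K) * (I : FractionalIdeal O⁰ K))) ∧
    latticeIndex (toLattice (I : FractionalIdeal O⁰ K)) (toLattice ((A : FractionalIdeal O⁰ K) * (I : FractionalIdeal O⁰ K)))
      = Nat.card (O ⧸ A) := by
  have h1 := relIndex_coeIdeal_mul I A hA
  have hle : (toLattice ((A : FractionalIdeal O⁰ K) * (I : FractionalIdeal O⁰ K))) ≤ toLattice (I : FractionalIdeal O⁰ K) := by
    have : (A : FractionalIdeal O⁰ K) * I ≤ 1 * I :=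
      mul_le_mul_left FractionalIdeal.coeIdeal_le_one _
    rw [one_mul] at this
    exact this
  have h2 := AddSubgroup.relIndex_eq_one.2 hle
  have : Module.Free ℤ O := inferInstance
  have : Finite (O ⧸ A) := A.finiteQuotientOfFreeOfNeBot hA
  have : Nat.card (O ⧸ A) ≠ 0 := Nat.card_pos.ne'
  refine ⟨⟨by rwa [h1], by rw [h2]; exact one_ne_zero⟩, ?_⟩
  rw [latticeIndex, h1, h2]; simp

/-- `[I : IJ]` does not depend on the invertible fractional ideal `I`. -/
theorem exists_latticeIndex_mul (J : (FractionalIdeal O⁰ K)ˣ) : ∃ q : ℚ,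
    ∀ I : (FractionalIdeal O⁰ K)ˣ,
      Commens (toLattice (I : FractionalIdeal O⁰ K)) (toLattice (I * J : FractionalIdeal O⁰ K)) ∧
      latticeIndex (toLattice (I : FractionalIdeal O⁰ K)) (toLattice (I * J : FractionalIdeal O⁰ K))
        = q := by
  obtain ⟨d, A, hd, hJ⟩ := FractionalIdeal.exists_eq_spanSingleton_mul (J : FractionalIdeal O⁰ K)
  have hd' : algebraMap O K d ≠ 0 := by simpa using hd
  have hA : A ≠ ⊥ := by
    rintro rfl
    have := J.ne_zero
    rw [hJ] at this
    simp at this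
  have hB : Ideal.span {d} ≠ ⊥ := by simpa using hd
  let D : (FractionalIdeal O⁰ K)ˣ := toPrincipalIdeal O K (Units.mk0 _ hd')
  have hD : (D : FractionalIdeal O⁰ K) = (Ideal.span {d} : Ideal O) := by
    simp [D, FractionalIdeal.coeIdeal_span_singleton]
  have hDi : ((D⁻¹ : (FractionalIdeal O⁰ K)ˣ) : FractionalIdeal O⁰ K)
      = FractionalIdeal.spanSingleton O⁰ (algebraMap O K d)⁻¹ := by
    simp only [D, ← map_inv, coe_toPrincipalIdeal]
    simp
  refine ⟨(Nat.card (O ⧸ Ideal.span {d}) : ℚ)⁻¹ * Nat.card (O ⧸ A), fun I => ?_⟩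
  obtain ⟨c1, i1⟩ := commens_coeIdeal_mul (D⁻¹ * I) (Ideal.span {d}) hB
  obtain ⟨c2, i2⟩ := commens_coeIdeal_mul (D⁻¹ * I) A hA
  have e1 : ((Ideal.span {d} : Ideal O) : FractionalIdeal O⁰ K) *
      ((D⁻¹ * I : (FractionalIdeal O⁰ K)ˣ) : FractionalIdeal O⁰ K) = I := by
    rw [← hD, ← Units.val_mul, mul_inv_cancel_left]
  have e2 : (A : FractionalIdeal O⁰ K) *
      ((D⁻¹ * I : (FractionalIdeal O⁰ K)ˣ) : FractionalIdeal O⁰ K) = I * J := by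
    rw [Units.val_mul, hDi, hJ]; ring
  rw [e1] at c1 i1
  rw [e2] at c2 i2
  refine ⟨c1.symm.trans c2, ?_⟩
  rw [← latticeIndex_mul c1.symm c2, i2, ← i1]
  congr 1
  simp [latticeIndex]

theorem latticeNorm_mul (I J : (FractionalIdeal O⁰ K)ˣ) :
    latticeNorm (I * J : FractionalIdeal O⁰ K) =
      latticeNorm (I : FractionalIdeal O⁰ K) * latticeNorm (J : FractionalIdeal O⁰ K) := by
  obtain ⟨q, hq⟩ := exists_latticeIndex_mul J
  obtain ⟨r, hr⟩ := exists_latticeIndex_mul I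
  have h1 := hq 1
  have h2 := hr 1
  simp only [Units.val_one, one_mul] at h1 h2
  rw [latticeNorm, latticeNorm, latticeNorm,
    ← latticeIndex_mul h2.1 (hq I).1, (hq I).2, h1.2]


end Order

section HGroup

variable (O K : Type*) [CommRing O] [IsDomain O] [Module.Finite ℤ O] [CharZero O]
  [Field K] [NumberField K] [Algebra O K] [IsFractionRing O K]

/-- The projective pairs `(I, δ)` for the order `O` in the number field `K`: `I` is an invertible
fractional ideal of `O`, `δ ∈ Kˣ`, `I² = (δ)` and `N(I)² = N(δ)`. They form a group under
`(I, δ) ∘ (I', δ') = (I I', δ δ')`. -/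
def projectivePairs : Subgroup ((FractionalIdeal O⁰ K)ˣ × Kˣ) where
  carrier := {p | (p.1 : FractionalIdeal O⁰ K) ^ 2 = FractionalIdeal.spanSingleton O⁰ (p.2 : K) ∧
    latticeNorm (p.1 : FractionalIdeal O⁰ K) ^ 2 = Algebra.norm ℚ (p.2 : K)}
  mul_mem' := by
    rintro ⟨I, a⟩ ⟨J, b⟩ ⟨h1, h2⟩ ⟨h3, h4⟩
    simp only [Set.mem_ofPred_eq, Prod.mk_mul_mk, Units.val_mul] at *
    refine ⟨?_, ?_⟩
    · rw [mul_pow, h1, h3, FractionalIdeal.spanSingleton_mul_spanSingleton]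
    · rw [latticeNorm_mul, mul_pow, h2, h4, map_mul]
  one_mem' := by
    simp [latticeNorm_one]
  inv_mem' := by
    rintro ⟨I, a⟩ ⟨h1, h2⟩
    simp only [Set.mem_ofPred_eq, Prod.inv_mk] at *
    have e1 : I ^ 2 = toPrincipalIdeal O K a := by
      apply Units.ext
      rw [Units.val_pow_eq_pow_val, h1, coe_toPrincipalIdeal]
    refine ⟨?_, ?_⟩
    · rw [← coe_toPrincipalIdeal, map_inv, ← e1, ← Units.val_pow_eq_pow_val, inv_pow]
    · have e2 := latticeNorm_mul I I⁻¹
      rw [← Units.val_mul, mul_inv_cancel, Units.val_one, latticeNorm_one] at e2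
      rw [eq_inv_of_mul_eq_one_right e2.symm, inv_pow, h2, Units.val_inv_eq_inv_val]
      exact (Algebra.norm_inv _).symm

/-- The pairs `((κ), κ²)` for `κ ∈ Kˣ`. -/
noncomputable def trivialPairs : Subgroup ((FractionalIdeal O⁰ K)ˣ × Kˣ) :=
  ((toPrincipalIdeal O K).prod (powMonoidHom 2)).range

/-- The group `H(O)` of equivalence classes of projective pairs, where `(I, δ)` and
`(κ I, κ² δ)` are equivalent for every `κ ∈ Kˣ`. -/
abbrev HGroup : Type _ :=
  projectivePairs O K ⧸ (trivialPairs O K).subgroupOf (projectivePairs O K)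

/-- The group `I₂(O)` of invertible fractional ideals `J` of `O` with `J² = O`. -/
def twoTorsionIdeals : Subgroup (FractionalIdeal O⁰ K)ˣ := (powMonoidHom 2).ker

/-- The 2-torsion subgroup `Cl₂(O)` of the ideal class group of `O`. -/
noncomputable def twoTorsionClasses (O : Type*) [CommRing O] [IsDomain O] : Subgroup (ClassGroup O) :=
  (powMonoidHom 2).ker

end HGroup

section Forms

open MvPolynomial

/-- An integral binary `n`-ic form `f₀ xⁿ + f₁ xⁿ⁻¹ y + ⋯ + fₙ yⁿ`, given by its coefficients. -/
abbrev BinaryForm (n : ℕ) : Type := Fin (n + 1) → ℤ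

namespace BinaryForm

variable {n : ℕ} (f : BinaryForm n)

/-- The coefficient `f_k`, with the convention `f_k = 0` for `k > n`. -/
def coef (k : ℕ) : ℤ := if h : k < n + 1 then f ⟨k, h⟩ else 0

/-- The form as a polynomial in `x = X 0` and `y = X 1`. -/
noncomputable def poly : MvPolynomial (Fin 2) ℤ :=
  ∑ i : Fin (n + 1), C (f i) * X 0 ^ (n - (i : ℕ)) * X 1 ^ (i : ℕ)

/-- The form is irreducible (over `ℚ`). -/
def IsIrreducible : Prop := Irreducible (MvPolynomial.map (Int.castRingHom ℚ) f.poly)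

/-- The form is primitive: its coefficients have no common prime factor. -/
def IsPrimitive : Prop := Finset.univ.gcd f = 1

/-- The form is nondegenerate: `Δ(f) ≠ 0`. The resultant of the binary `(n-1)`-ic forms
`∂f/∂x` and `∂f/∂y` is `± nⁿ⁻² Δ(f)`. -/
def IsNondegenerate : Prop :=
  Polynomial.resultant
    (MvPolynomial.aeval ![Polynomial.X, 1] (pderiv 0 f.poly) : Polynomial ℤ)
    (MvPolynomial.aeval ![Polynomial.X, 1] (pderiv 1 f.poly) : Polynomial ℤ) (n - 1) (n - 1) ≠ 0

/-- A root `θ` of `f(x, 1)` in `K`. -/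
structure Root (K : Type*) [Field K] where
  /-- the root itself -/
  val : K
  isRoot : MvPolynomial.aeval ![val, 1] f.poly = 0

end BinaryForm

namespace BinaryForm.Root

variable {n : ℕ} {f : BinaryForm n} {K : Type*} [Field K] (θ : f.Root K)

/-- `ζ₀ = 1` and `ζ_k = f₀ θᵏ + ⋯ + f_{k-1} θ` for `k > 0`. -/
def zeta (k : ℕ) : K :=
  if k = 0 then 1 else ∑ i ∈ Finset.range k, (f.coef i : K) * θ.val ^ (k - i)

theorem zeta_zero : θ.zeta 0 = 1 := by simp [zeta]

theorem zeta_of_pos {k : ℕ} (hk : 0 < k) :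
    θ.zeta k = ∑ i ∈ Finset.range k, (f.coef i : K) * θ.val ^ (k - i) := by
  simp [zeta, hk.ne']

theorem sum_succ (k : ℕ) :
    ∑ i ∈ Finset.range (k + 1), (f.coef i : K) * θ.val ^ (k + 1 - i) =
      θ.val * (∑ i ∈ Finset.range k, (f.coef i : K) * θ.val ^ (k - i)) + f.coef k * θ.val := by
  rw [Finset.sum_range_succ, Finset.mul_sum]
  congr 1
  · refine Finset.sum_congr rfl fun i hi => ?_
    have : i < k := Finset.mem_range.1 hi
    rw [show k + 1 - i = (k - i) + 1 by omega, pow_succ]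
    ring
  · simp

theorem zeta_one : θ.zeta 1 = f.coef 0 * θ.val := by simp [zeta]

theorem zeta_succ {k : ℕ} (hk : 0 < k) :
    θ.zeta (k + 1) = θ.val * θ.zeta k + f.coef k * θ.val := by
  rw [zeta_of_pos _ hk, zeta_of_pos _ k.succ_pos, sum_succ]

theorem zeta_n (hn : 0 < n) : θ.zeta n = -(f.coef n : K) := by
  have h := θ.isRoot
  rw [BinaryForm.poly, map_sum] at h
  simp only [map_mul, map_pow, aeval_X, Matrix.cons_val_zero, Matrix.cons_val_one, one_pow, mul_one,
    MvPolynomial.aeval_C] at h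
  have h2 : ∑ i ∈ Finset.range (n + 1), (f.coef i : K) * θ.val ^ (n - i) = 0 := by
    rw [← h, Finset.sum_range]
    refine Finset.sum_congr rfl fun i _ => ?_
    rw [BinaryForm.coef, dif_pos i.2]; simp
  rw [Finset.sum_range_succ] at h2
  rw [zeta_of_pos _ hn]
  simp only [Nat.sub_self, pow_zero, mul_one] at h2
  exact eq_neg_of_add_eq_zero_left h2

theorem zeta_gt {k : ℕ} (hn : 0 < n) (hk : n < k) : θ.zeta k = 0 := by
  induction k, hk using Nat.le_induction with
  | base => rw [zeta_succ _ hn, zeta_n _ hn]; ring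
  | succ m hm ih =>
    rw [zeta_succ _ (by omega), ih]
    have : ¬ m < n + 1 := by omega
    simp [BinaryForm.coef, this]

/-- The `ℤ`-module `⟨1, ζ₁, …, ζ_{n-1}⟩`. -/
def ringModule : Submodule ℤ K := Submodule.span ℤ (insert 1 (θ.zeta '' Set.Ico 1 n))

theorem one_mem_ringModule : (1 : K) ∈ θ.ringModule := Submodule.subset_span (Set.mem_insert _ _)

theorem zeta_mem_ringModule (k : ℕ) : θ.zeta k ∈ θ.ringModule := by
  rcases Nat.eq_zero_or_pos k with rfl | hk
  · rw [zeta_zero]; exact θ.one_mem_ringModule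
  rcases lt_trichotomy k n with h | h | h
  · exact Submodule.subset_span (Set.mem_insert_of_mem _ ⟨k, ⟨hk, h⟩, rfl⟩)
  · subst h
    rw [zeta_n _ hk, ← Int.cast_neg, ← zsmul_one]
    exact Submodule.smul_mem _ _ θ.one_mem_ringModule
  · rcases Nat.eq_zero_or_pos n with rfl | hn
    · have h0 : ((f.coef 0 : ℤ) : K) = 0 := by
        have h1 := θ.isRoot
        simpa [BinaryForm.poly, BinaryForm.coef] using h1
      rw [zeta_of_pos _ hk, Finset.sum_eq_zero]
      · exact zero_mem _
      · intro i _
        rcases Nat.eq_zero_or_pos i with rfl | hi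
        · rw [h0, zero_mul]
        · have : ¬ i < 0 + 1 := by omega
          simp [BinaryForm.coef, this]
    · rw [zeta_gt _ hn h]; exact zero_mem _

theorem zeta_mul_zeta (i j : ℕ) : θ.zeta i * θ.zeta j ∈ θ.ringModule := by
  induction i generalizing j with
  | zero => rw [zeta_zero, one_mul]; exact θ.zeta_mem_ringModule j
  | succ i ih =>
    rcases Nat.eq_zero_or_pos j with rfl | hj
    · rw [zeta_zero, mul_one]; exact θ.zeta_mem_ringModule _
    rcases Nat.eq_zero_or_pos i with rfl | hi
    · have : θ.zeta (0 + 1) * θ.zeta j =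
          f.coef 0 • θ.zeta (j + 1) - f.coef j • θ.zeta 1 := by
        rw [zeta_succ _ hj, zero_add, zeta_one]
        simp only [zsmul_eq_mul]
        ring
      rw [this]
      exact sub_mem (Submodule.smul_mem _ _ (θ.zeta_mem_ringModule _))
        (Submodule.smul_mem _ _ (θ.zeta_mem_ringModule _))
    · have : θ.zeta (i + 1) * θ.zeta j = θ.zeta i * θ.zeta (j + 1)
          + f.coef i • θ.zeta (j + 1) - f.coef j • θ.zeta (i + 1) := by
        rw [zeta_succ _ hj, zeta_succ _ hi]
        simp only [zsmul_eq_mul]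
        ring
      rw [this]
      exact sub_mem (add_mem (ih _) (Submodule.smul_mem _ _ (θ.zeta_mem_ringModule _)))
        (Submodule.smul_mem _ _ (θ.zeta_mem_ringModule _))

/-- The ring `R_f = ⟨1, ζ₁, …, ζ_{n-1}⟩` (as a `ℤ`-module) attached to the form `f`. -/
def ring : Subalgebra ℤ K :=
  θ.ringModule.toSubalgebra θ.one_mem_ringModule (by
    intro x y hx hy
    rw [ringModule] at hx hy
    refine Submodule.span_induction₂ (p := fun x y _ _ => x * y ∈ θ.ringModule)
      ?_ (by simp) (by simp) ?_ ?_ ?_ ?_ hx hy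
    · have gen : ∀ z ∈ insert (1 : K) (θ.zeta '' Set.Ico 1 n), ∃ k, z = θ.zeta k := by
        rintro z (rfl | ⟨k, _, rfl⟩)
        · exact ⟨0, θ.zeta_zero.symm⟩
        · exact ⟨k, rfl⟩
      intro x y hx hy
      obtain ⟨i, rfl⟩ := gen x hx
      obtain ⟨j, rfl⟩ := gen y hy
      exact θ.zeta_mul_zeta i j
    · intro x y z _ _ _ h1 h2; rw [add_mul]; exact add_mem h1 h2
    · intro x y z _ _ _ h1 h2; rw [mul_add]; exact add_mem h1 h2
    · intro r x y _ _ h; rw [smul_mul_assoc]; exact Submodule.smul_mem _ _ h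
    · intro r x y _ _ h; rw [mul_smul_comm]; exact Submodule.smul_mem _ _ h)

instance : Module.Finite ℤ θ.ring := by
  have h : θ.ringModule.FG := Submodule.fg_span (((Set.finite_Ico 1 n).image _).insert _)
  exact Module.Finite.iff_fg.2 h

/-- The `ℤ`-module `⟨1, θ, ζ₂, …, ζ_{n-1}⟩`. -/
def idealModule : Submodule ℤ K :=
  Submodule.span ℤ (insert 1 (insert θ.val (θ.zeta '' Set.Ico 2 n)))

theorem zeta_mem_idealModule (k : ℕ) : θ.zeta k ∈ θ.idealModule := by
  have hle : θ.ringModule ≤ θ.idealModule := by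
    rw [ringModule, Submodule.span_le]
    rintro z (rfl | ⟨k, hk, rfl⟩)
    · exact Submodule.subset_span (Set.mem_insert _ _)
    · rcases Nat.lt_or_ge k 2 with h | h
      · obtain rfl : k = 1 := le_antisymm (Nat.lt_succ_iff.1 h) hk.1
        rw [zeta_one, ← zsmul_eq_mul]
        exact Submodule.smul_mem _ _
          (Submodule.subset_span (Set.mem_insert_of_mem _ (Set.mem_insert _ _)))
      · exact Submodule.subset_span
          (Set.mem_insert_of_mem _ (Set.mem_insert_of_mem _ ⟨k, ⟨h, hk.2⟩, rfl⟩))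
  exact hle (θ.zeta_mem_ringModule k)

theorem zeta_mul_mem_idealModule (k : ℕ) {x : K} (hx : x ∈ θ.idealModule) :
    θ.zeta k * x ∈ θ.idealModule := by
  have hθ : θ.val ∈ θ.idealModule :=
    Submodule.subset_span (Set.mem_insert_of_mem _ (Set.mem_insert _ _))
  have hring : ∀ y ∈ θ.ringModule, y ∈ θ.idealModule := by
    intro y hy
    refine Submodule.span_le.2 ?_ hy
    rintro z (rfl | ⟨k, _, rfl⟩)
    · rw [← θ.zeta_zero]; exact θ.zeta_mem_idealModule 0
    · exact θ.zeta_mem_idealModule k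
  refine Submodule.span_induction (p := fun x _ => θ.zeta k * x ∈ θ.idealModule)
    ?_ (by simp) ?_ ?_ hx
  · rintro z (rfl | rfl | ⟨j, _, rfl⟩)
    · rw [mul_one]; exact θ.zeta_mem_idealModule k
    · rcases Nat.eq_zero_or_pos k with rfl | hk
      · rw [zeta_zero, one_mul]; exact hθ
      · have : θ.zeta k * θ.val = θ.zeta (k + 1) - f.coef k • θ.val := by
          rw [zeta_succ _ hk, zsmul_eq_mul]; ring
        rw [this]
        exact sub_mem (θ.zeta_mem_idealModule _) (Submodule.smul_mem _ _ hθ)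
    · exact hring _ (θ.zeta_mul_zeta k j)
  · intro x y _ _ h1 h2; rw [mul_add]; exact add_mem h1 h2
  · intro r x _ h; rw [mul_smul_comm]; exact Submodule.smul_mem _ _ h

/-- The distinguished ideal `I_f = ⟨1, θ, ζ₂, …, ζ_{n-1}⟩` as an `R_f`-module. -/
def idealSubmodule : Submodule θ.ring K where
  carrier := θ.idealModule
  add_mem' := add_mem
  zero_mem' := zero_mem _
  smul_mem' := by
    rintro ⟨r, hr⟩ x hx
    change r * x ∈ θ.idealModule
    refine Submodule.span_induction (p := fun r _ => r * x ∈ θ.idealModule)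
      ?_ (by simp) ?_ ?_ (show r ∈ θ.ringModule from hr)
    · rintro z (rfl | ⟨k, _, rfl⟩)
      · rwa [one_mul]
      · exact θ.zeta_mul_mem_idealModule k hx
    · intro a b _ _ h1 h2; rw [add_mul]; exact add_mem h1 h2
    · intro c a _ h; rw [smul_mul_assoc]; exact Submodule.smul_mem _ _ h

theorem idealSubmodule_fg : θ.idealSubmodule.FG := by
  have h : (θ.idealSubmodule.restrictScalars ℤ).FG :=
    Submodule.fg_span ((((Set.finite_Ico 2 n).image _).insert _).insert _)
  exact Submodule.FG.of_restrictScalars ℤ h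

/-- The distinguished fractional ideal `I_f = ⟨1, θ, ζ₂, …, ζ_{n-1}⟩` of `R_f`. -/
def ideal [IsFractionRing θ.ring K] : FractionalIdeal θ.ring⁰ K :=
  ⟨θ.idealSubmodule, FractionalIdeal.isFractional_of_fg θ.idealSubmodule_fg⟩

end BinaryForm.Root

namespace BinaryForm

variable {n : ℕ}

/-- The binary `n`-ic invariant `det (A x - B y)` of a pair of `n × n` matrices. -/
noncomputable def pairInvariant (A B : Matrix (Fin n) (Fin n) ℤ) : MvPolynomial (Fin 2) ℤ :=
  Matrix.det ((X 0 : MvPolynomial (Fin 2) ℤ) • A.map (C (σ := Fin 2)) -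
    (X 1 : MvPolynomial (Fin 2) ℤ) • B.map (C (σ := Fin 2)))

/-- The pairs `(A, B)` of symmetric integral `n × n` matrices with `det (A x - B y) = f(x, y)`. -/
@[ext]
structure FormPair (f : BinaryForm n) where
  /-- the first matrix -/
  A : Matrix (Fin n) (Fin n) ℤ
  /-- the second matrix -/
  B : Matrix (Fin n) (Fin n) ℤ
  symmA : A.IsSymm
  symmB : B.IsSymm
  invariant_eq : pairInvariant A B = f.poly

theorem pairInvariant_conj (g : Matrix.SpecialLinearGroup (Fin n) ℤ)
    (A B : Matrix (Fin n) (Fin n) ℤ) :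
    pairInvariant (g.1 * A * g.1.transpose) (g.1 * B * g.1.transpose) = pairInvariant A B := by
  have h : ∀ M : Matrix (Fin n) (Fin n) ℤ, (g.1 * M * g.1.transpose).map (C (σ := Fin 2)) =
      g.1.map C * M.map C * (g.1.map C).transpose := by
    intro M
    rw [Matrix.map_mul, Matrix.map_mul, Matrix.transpose_map]
  have hg : (g.1.map (C (σ := Fin 2))).det = 1 := by
    have := (RingHom.map_det (C (σ := Fin 2) (R := ℤ)) g.1).symm
    rw [g.2, map_one] at this
    exact this
  have key : (X 0 : MvPolynomial (Fin 2) ℤ) • (g.1 * A * g.1.transpose).map (C (σ := Fin 2)) -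
      (X 1 : MvPolynomial (Fin 2) ℤ) • (g.1 * B * g.1.transpose).map (C (σ := Fin 2)) =
      g.1.map (C (σ := Fin 2)) * ((X 0 : MvPolynomial (Fin 2) ℤ) • A.map (C (σ := Fin 2)) -
        (X 1 : MvPolynomial (Fin 2) ℤ) • B.map (C (σ := Fin 2))) *
        (g.1.map (C (σ := Fin 2))).transpose := by
    rw [h, h]
    simp only [Matrix.mul_sub, Matrix.sub_mul, Matrix.mul_smul, Matrix.smul_mul]
  rw [pairInvariant, pairInvariant, key, Matrix.det_mul, Matrix.det_mul, Matrix.det_transpose, hg,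
    one_mul, mul_one]

/-- The action `γ (A, B) = (γ A γᵗ, γ B γᵗ)` of `SL_n(ℤ)`. -/
instance (f : BinaryForm n) : MulAction (Matrix.SpecialLinearGroup (Fin n) ℤ) f.FormPair where
  smul g v :=
    { A := g.1 * v.A * g.1.transpose
      B := g.1 * v.B * g.1.transpose
      symmA := by
        rw [Matrix.IsSymm, Matrix.transpose_mul, Matrix.transpose_mul, Matrix.transpose_transpose,
          v.symmA.eq, Matrix.mul_assoc]
      symmB := by
        rw [Matrix.IsSymm, Matrix.transpose_mul, Matrix.transpose_mul, Matrix.transpose_transpose,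
          v.symmB.eq, Matrix.mul_assoc]
      invariant_eq := by rw [pairInvariant_conj, v.invariant_eq] }
  one_smul v := by
    apply FormPair.ext
    · change (1 : Matrix (Fin n) (Fin n) ℤ) * v.A * (1 : Matrix (Fin n) (Fin n) ℤ).transpose = v.A
      simp
    · change (1 : Matrix (Fin n) (Fin n) ℤ) * v.B * (1 : Matrix (Fin n) (Fin n) ℤ).transpose = v.B
      simp
  mul_smul g h v := by
    apply FormPair.ext
    · change (g.1 * h.1) * v.A * (g.1 * h.1).transpose =
        g.1 * (h.1 * v.A * h.1.transpose) * g.1.transpose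
      simp [Matrix.mul_assoc, Matrix.transpose_mul]
    · change (g.1 * h.1) * v.B * (g.1 * h.1).transpose =
        g.1 * (h.1 * v.B * h.1.transpose) * g.1.transpose
      simp [Matrix.mul_assoc, Matrix.transpose_mul]

/-- The set of `SL_n(ℤ)`-orbits of pairs `(A, B)` with invariant `f`. -/
abbrev Orbit (f : BinaryForm n) : Type :=
  MulAction.orbitRel.Quotient (Matrix.SpecialLinearGroup (Fin n) ℤ) f.FormPair

namespace FormPair

variable {f : BinaryForm n}

/-- The `SL_n(ℤ)`-orbit of a pair. -/
def orbit (v : f.FormPair) : f.Orbit := Quotient.mk _ v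

/-- `(A, B)` is reducible: the quadrics defined by `A` and `B` in `ℙⁿ⁻¹(ℚ)` contain a common
rational linear subspace of projective dimension `(n - 3) / 2`. -/
def IsReducible (v : f.FormPair) : Prop :=
  ∃ W : Submodule ℚ (Fin n → ℚ), Module.finrank ℚ W = (n - 3) / 2 + 1 ∧
    ∀ w ∈ W, w ⬝ᵥ (v.A.map (Int.cast : ℤ → ℚ)).mulVec w = 0 ∧
      w ⬝ᵥ (v.B.map (Int.cast : ℤ → ℚ)).mulVec w = 0

end FormPair

namespace Root

variable {f : BinaryForm n} {K : Type*} [Field K] [NumberField K] (θ : f.Root K)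
  [IsFractionRing θ.ring K]

/-- The correspondence between pairs `v = (A, B)` and pairs `(I, δ)`: `I² ⊆ δ I_f^{n-3}`,
`N(I)² = N(δ) N(I_f^{n-3})`, and `I` has a `ℤ`-basis `α₁, …, α_n`, oriented like
`ζ₀, …, ζ_{n-1}`, such that
`α_i α_j / δ = c_{ij}^{(0)} + ⋯ + c_{ij}^{(n-3)} θⁿ⁻³ + ε (b_{ij} ζ_{n-2} + a_{ij} ζ_{n-1})`
with integers `c_{ij}^{(k)}`. The sign `ε = (-1)^{(n-1)/2}` is the one for which the matrices on
the right satisfy `det (A x - B y) = f(x, y)` (without it this determinant would be `ε f`). -/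
def Corresponds (v : f.FormPair) (I : FractionalIdeal θ.ring⁰ K) (δ : Kˣ) : Prop :=
  I ^ 2 ≤ FractionalIdeal.spanSingleton θ.ring⁰ (δ : K) * θ.ideal ^ (n - 3) ∧
  latticeNorm I ^ 2 = Algebra.norm ℚ (δ : K) * latticeNorm (θ.ideal ^ (n - 3)) ∧
  ∃ (α : Fin n → K) (M : Matrix (Fin n) (Fin n) ℚ),
    LinearIndependent ℤ α ∧
    Submodule.span ℤ (Set.range α) = (I : Submodule θ.ring K).restrictScalars ℤ ∧
    (∀ i, α i = ∑ j, M i j • θ.zeta j) ∧ 0 < M.det ∧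
    ∀ i j, ∃ c : Fin (n - 2) → ℤ,
      α i * α j = (δ : K) * (∑ k, (c k : K) * θ.val ^ (k : ℕ) +
        (-1) ^ ((n - 1) / 2) * ((v.B i j : K) * θ.zeta (n - 2) + (v.A i j : K) * θ.zeta (n - 1)))

/-- `(A, B)` is projective: it corresponds to a pair `(I, δ)` with `I` invertible. -/
def IsProjective (v : f.FormPair) : Prop :=
  ∃ (I : FractionalIdeal θ.ring⁰ K) (δ : Kˣ), θ.Corresponds v I δ ∧ IsUnit I

/-- The set of projective `SL_n(ℤ)`-orbits with invariant `f`. -/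
def ProjectiveOrbit : Type := {o : f.Orbit // ∃ v : f.FormPair, v.orbit = o ∧ θ.IsProjective v}

/-- The set of reducible projective `SL_n(ℤ)`-orbits with invariant `f`. -/
def ReducibleProjectiveOrbit : Type :=
  {o : θ.ProjectiveOrbit // ∃ v : f.FormPair, v.orbit = o.1 ∧ v.IsReducible}

end Root

end BinaryForm

end Forms

end BinaryFormOrder

/-!
Let `λ : K → ℚ` take the coefficient of `ζ_{n-1}`. Since `x ↦ λ(θ x)` reads off the coefficient of
`ζ_{n-2}`, a pair corresponding to `(I, δ)` consists, up to a common sign, of the Gram matrices on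
`I` of the forms `λ(x y / δ)` and `λ(θ x y / δ)`. The two forms differ by multiplication by `θ`, so
an isometry between two such pairs of forms commutes with `θ` and is multiplication by some
`κ ∈ K`: the orbit determines `(I, δ)` up to `(κ I, κ² δ)`. Conversely `I² ⊆ δ I_f^{n-3}` makes the
matrices integral, and `N(I)² = N(δ) N(I_f^{n-3})` makes their invariant equal to `f`, because the
forms attached to `1` have a triangular Gram matrix in the powers of `θ`. As `I_f` is invertible,
multiplication by `I_f^{(n-3)/2}` identifies `H(O)` with the projective orbits.

Every class in `Cl₂(O)` comes from a pair `(I, δ)`: in odd degree `δ` can be chosen with the right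
sign. The kernel of `H(O) → Cl₂(O)` is the group of units of norm one modulo squares, whose order
`2^{r₁+r₂-1}` is given by Dirichlet's unit theorem: these units have no torsion, as `N(-1) = -1`.

A common isotropic subspace of dimension `(n-1)/2` contains, by a dimension count, some `w ≠ 0`
together with `θ w, …, θ^{(n-3)/2} w`. Then `λ` kills `θ^k w² / δ` for `k < n - 1`, so `w² / δ` is
rational, and as `N(δ)` is a square and `n` is odd, `δ` is a square. The reducible projective orbits
are thus those of the pairs `(J, 1)` with `J² = O`.
-/

namespace BinaryFormOrder

/-! ### Rational bases and lattices -/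

section RationalBases

variable {ι V : Type*} [AddCommGroup V]

theorem closure_range_le_of_eq_or_eq_neg {v w : ι → V} (h : ∀ i, v i = w i ∨ v i = -w i) :
    AddSubgroup.closure (Set.range v) ≤ AddSubgroup.closure (Set.range w) := by
  refine (AddSubgroup.closure_le _).2 (Set.range_subset_iff.2 fun i => ?_)
  have hi := AddSubgroup.subset_closure (Set.mem_range_self (f := w) i)
  rcases h i with h | h <;> rw [h]
  exacts [hi, neg_mem hi]

theorem exists_intMatrix_of_closure_range_le [Fintype ι] {v w : ι → V}
    (h : AddSubgroup.closure (Set.range v) ≤ AddSubgroup.closure (Set.range w)) :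
    ∃ g : Matrix ι ι ℤ, ∀ i, v i = ∑ j, g i j • w j := by
  have hmem (i : ι) : ∃ c : ι → ℤ, v i = ∑ j, c j • w j :=
    AddSubgroup.mem_closure_range_iff_of_fintype.1 (h (AddSubgroup.subset_closure ⟨i, rfl⟩))
  choose g hg using hmem
  exact ⟨Matrix.of g, hg⟩

variable [Module ℚ V]

theorem exists_int_smul_mem_closure_range [Finite ι] (b : Module.Basis ι ℚ V) (v : ι → V) :
    ∃ d : ℤ, d ≠ 0 ∧ ∀ i, d • v i ∈ AddSubgroup.closure (Set.range b) := by
  classical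
  have := Fintype.ofFinite ι
  obtain ⟨⟨d, hd⟩, h⟩ := IsLocalization.exist_integer_multiples_of_finset ℤ⁰
    (Finset.univ.image fun p : ι × ι => b.repr (v p.1) p.2)
  have hcoord (i j : ι) : ∃ m : ℤ, (m : ℚ) = d * b.repr (v i) j := by
    obtain ⟨m, hm⟩ := h _ (Finset.mem_image_of_mem _ (Finset.mem_univ (i, j)))
    exact ⟨m, by simpa [zsmul_eq_mul] using hm⟩
  choose m hm using hcoord
  refine ⟨d, nonZeroDivisors.ne_zero hd, fun i => ?_⟩
  refine AddSubgroup.mem_closure_range_iff_of_fintype.2 ⟨m i, ?_⟩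
  rw [← b.sum_repr (v i), Finset.smul_sum]
  simp only [← Int.cast_smul_eq_zsmul ℚ, hm, mul_smul]

variable [Fintype ι]

theorem toMatrix_eq_transpose_of_eq_sum (α : Module.Basis ι ℚ V) {v : ι → V} {g : Matrix ι ι ℤ}
    (hg : ∀ i, v i = ∑ j, g i j • α j) :
    α.toMatrix v = (g.map (Int.cast : ℤ → ℚ)).transpose := by
  ext i j
  simp only [Module.Basis.toMatrix_apply, hg, ← Int.cast_smul_eq_zsmul ℚ,
    Module.Basis.repr_sum_self, Matrix.transpose_apply, Matrix.map_apply]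

theorem eq_sum_transpose_toMatrix (b : Module.Basis ι ℚ V) (v : ι → V) (i : ι) :
    v i = ∑ j, (b.toMatrix v).transpose i j • b j := by
  simp only [Matrix.transpose_apply, Module.Basis.toMatrix_apply, Module.Basis.sum_repr]

variable [DecidableEq ι]

theorem det_eq_det_of_eq_sum (b : Module.Basis ι ℚ V) {v : ι → V} {M : Matrix ι ι ℚ}
    (hM : ∀ i, v i = ∑ j, M i j • b j) : b.det v = M.det := by
  rw [Module.Basis.det_apply, ← Matrix.det_transpose M]
  congr 1
  ext i j
  simp only [Module.Basis.toMatrix_apply, hM, Module.Basis.repr_sum_self, Matrix.transpose_apply]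

theorem bilinForm_equiv_apply_of_toMatrix_eq {B B' : LinearMap.BilinForm ℚ V}
    {α α' : Module.Basis ι ℚ V}
    (h : LinearMap.BilinForm.toMatrix α B = LinearMap.BilinForm.toMatrix α' B') (x y : V) :
    B' (α.equiv α' (Equiv.refl ι) x) (α.equiv α' (Equiv.refl ι) y) = B x y := by
  let g : V →ₗ[ℚ] V := α.equiv α' (Equiv.refl ι)
  suffices B'.comp g g = B from LinearMap.congr_fun₂ this x y
  refine LinearMap.BilinForm.ext_basis α fun i j => ?_
  simpa [g, LinearMap.BilinForm.toMatrix_apply] using (Matrix.ext_iff.2 h i j).symm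

theorem map_mul_mul_transpose_eq_smul_toMatrix {B : LinearMap.BilinForm ℚ V}
    {α α' : Module.Basis ι ℚ V} {g A : Matrix ι ι ℤ} {c : ℚ}
    (hg : ∀ i, α' i = ∑ j, g i j • α j)
    (hA : A.map (Int.cast : ℤ → ℚ) = c • LinearMap.BilinForm.toMatrix α B) :
    (g * A * g.transpose).map (Int.cast : ℤ → ℚ) = c • LinearMap.BilinForm.toMatrix α' B := by
  rw [← LinearMap.BilinForm.toMatrix_mul_basis_toMatrix α α' B,
    toMatrix_eq_transpose_of_eq_sum α hg, Matrix.transpose_transpose, Matrix.map_mul_intCast,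
    Matrix.map_mul_intCast, hA, Matrix.transpose_map, Matrix.mul_smul, Matrix.smul_mul]

theorem commens_closure_range_of_le (b b' : Module.Basis ι ℚ V)
    (h : AddSubgroup.closure (Set.range b') ≤ AddSubgroup.closure (Set.range b)) :
    Commens (AddSubgroup.closure (Set.range b)) (AddSubgroup.closure (Set.range b')) ∧
    latticeIndex (AddSubgroup.closure (Set.range b)) (AddSubgroup.closure (Set.range b')) =
      |b.det b'| := by
  have hindex := AddSubgroup.relIndex_eq_abs_det _ _ h b' b rfl rfl
  have hone := AddSubgroup.relIndex_eq_one.2 h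
  refine ⟨⟨fun h0 => ?_, by simp [hone]⟩, by simp [latticeIndex, hindex, hone]⟩
  rw [h0, Nat.cast_zero, eq_comm, abs_eq_zero] at hindex
  exact (b.isUnit_det b').ne_zero hindex

theorem latticeIndex_closure_range (b b' : Module.Basis ι ℚ V) :
    latticeIndex (AddSubgroup.closure (Set.range b)) (AddSubgroup.closure (Set.range b')) =
      |b.det b'| := by
  obtain ⟨d, hd, hdb⟩ := exists_int_smul_mem_closure_range b b'
  let c : Module.Basis ι ℚ V :=
    b'.unitsSMul fun _ => Units.mk0 (d : ℚ) (Int.cast_ne_zero.2 hd)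
  have hc (i : ι) : c i = d • b' i := by
    simp [c, Module.Basis.unitsSMul_apply, Int.cast_smul_eq_zsmul]
  have hcb : AddSubgroup.closure (Set.range c) ≤ AddSubgroup.closure (Set.range b) :=
    (AddSubgroup.closure_le _).2 (Set.range_subset_iff.2 fun i => hc i ▸ hdb i)
  have hcb' : AddSubgroup.closure (Set.range c) ≤ AddSubgroup.closure (Set.range b') :=
    (AddSubgroup.closure_le _).2 (Set.range_subset_iff.2 fun i => hc i ▸
      zsmul_mem (AddSubgroup.subset_closure (Set.mem_range_self i)) d)
  obtain ⟨commens, index⟩ := commens_closure_range_of_le b c hcb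
  obtain ⟨commens', index'⟩ := commens_closure_range_of_le b' c hcb'
  have hmul := latticeIndex_mul (commens.trans commens'.symm) commens'
  rw [index, index', ← b.det_mul_det b' c, abs_mul] at hmul
  exact mul_right_cancel₀ (abs_ne_zero.2 (b'.isUnit_det c).ne_zero) hmul

theorem det_eq_intCast_of_eq_sum (α : Module.Basis ι ℚ V) {v : ι → V} {g : Matrix ι ι ℤ}
    (hg : ∀ i, v i = ∑ j, g i j • α j) : α.det v = g.det := by
  rw [Module.Basis.det_apply, toMatrix_eq_transpose_of_eq_sum α hg, Matrix.det_transpose]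
  exact ((Int.castRingHom ℚ).map_det g).symm

theorem exists_specialLinearGroup_of_closure_range_eq (α α' : Module.Basis ι ℚ V)
    (h : AddSubgroup.closure (Set.range α) = AddSubgroup.closure (Set.range α'))
    (hdet : 0 < α.det α') :
    ∃ g : Matrix.SpecialLinearGroup ι ℤ, ∀ i, α' i = ∑ j, g.1 i j • α j := by
  obtain ⟨g, hg⟩ := exists_intMatrix_of_closure_range_le h.ge
  obtain ⟨g', hg'⟩ := exists_intMatrix_of_closure_range_le h.le
  have hpos : 0 < g.det := by
    rw [det_eq_intCast_of_eq_sum α hg] at hdet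
    exact_mod_cast hdet
  have hmul : g.det * g'.det = 1 := by
    have hcast := α.det_mul_det α' α
    rw [det_eq_intCast_of_eq_sum α hg, det_eq_intCast_of_eq_sum α' hg', α.det_self] at hcast
    exact_mod_cast hcast
  have hone : g.det = 1 := by
    rcases Int.eq_one_or_neg_one_of_mul_eq_one hmul with h | h <;> omega
  exact ⟨⟨g, hone⟩, hg⟩

/-- The rational basis given by a family `v` whose determinant with respect to some basis is
nonzero. -/
noncomputable def basisOfDetNeZero (b : Module.Basis ι ℚ V) (v : ι → V) (hv : b.det v ≠ 0) :
    Module.Basis ι ℚ V :=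
  Module.Basis.mk (b.is_basis_iff_det.2 hv.isUnit).1 (b.is_basis_iff_det.2 hv.isUnit).2.ge

theorem coe_basisOfDetNeZero (b : Module.Basis ι ℚ V) (v : ι → V) (hv : b.det v ≠ 0) :
    (basisOfDetNeZero b v hv : ι → V) = v := Module.Basis.coe_mk _ _

theorem exists_basis_eq_sum (α : Module.Basis ι ℚ V) (g : Matrix.SpecialLinearGroup ι ℤ) :
    ∃ α' : Module.Basis ι ℚ V, ∀ i, α' i = ∑ j, g.1 i j • α j := by
  have hdet : α.det (fun i => ∑ j, g.1 i j • α j) ≠ 0 := by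
    rw [det_eq_intCast_of_eq_sum α fun i => rfl, g.2, Int.cast_one]
    exact one_ne_zero
  exact ⟨basisOfDetNeZero α _ hdet, fun i => congrFun (coe_basisOfDetNeZero α _ hdet) i⟩

theorem closure_range_eq_of_eq_sum (α α' : Module.Basis ι ℚ V)
    (g : Matrix.SpecialLinearGroup ι ℤ) (hg : ∀ i, α' i = ∑ j, g.1 i j • α j) :
    AddSubgroup.closure (Set.range α') = AddSubgroup.closure (Set.range α) := by
  have hle : AddSubgroup.closure (Set.range α') ≤ AddSubgroup.closure (Set.range α) :=
    (AddSubgroup.closure_le _).2 (Set.range_subset_iff.2 fun i =>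
      AddSubgroup.mem_closure_range_iff_of_fintype.2 ⟨g.1 i, hg i⟩)
  refine hle.antisymm (AddSubgroup.relIndex_eq_one.1 ?_)
  have hindex := AddSubgroup.relIndex_eq_abs_det _ _ hle α' α rfl rfl
  rw [det_eq_intCast_of_eq_sum α hg, g.2] at hindex
  simpa using hindex

theorem exists_basis_closure_range_eq_of_det_pos [Nonempty ι] (b α : Module.Basis ι ℚ V) :
    ∃ α' : Module.Basis ι ℚ V,
      AddSubgroup.closure (Set.range α') = AddSubgroup.closure (Set.range α) ∧
        0 < b.det α' := by
  let α' := α.adjustToOrientation b.orientation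
  have h := α.adjustToOrientation_apply_eq_or_eq_neg b.orientation
  have h' (i : ι) : α i = α' i ∨ α i = -α' i :=
    (h i).imp Eq.symm fun hi => by rw [hi, neg_neg]
  exact ⟨α', (closure_range_le_of_eq_or_eq_neg h).antisymm (closure_range_le_of_eq_or_eq_neg h'),
    (b.orientation_eq_iff_det_pos _).1 (α.orientation_adjustToOrientation _).symm⟩

end RationalBases

section FractionalIdealLattices

variable {O K : Type*} [CommRing O] [Field K] [Algebra O K]

theorem toLattice_injective :
    Function.Injective (toLattice : FractionalIdeal O⁰ K → AddSubgroup K) := fun _ _ h =>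
  FractionalIdeal.coeToSubmodule_injective (Submodule.toAddSubgroup_injective h)

theorem toLattice_spanSingleton_mul [IsLocalization O⁰ K] (κ : K) (I : FractionalIdeal O⁰ K) :
    toLattice (FractionalIdeal.spanSingleton O⁰ κ * I) =
      (toLattice I).map (AddMonoidHom.mulLeft κ) := by
  ext x
  refine FractionalIdeal.mem_singleton_mul.trans ?_
  exact exists_congr fun y => and_congr_right fun _ => eq_comm

theorem mul_mem_sq_of_toLattice_eq {ι : Type*} {I : FractionalIdeal O⁰ K} {α : ι → K}
    (h : toLattice I = AddSubgroup.closure (Set.range α)) (i j : ι) : α i * α j ∈ I ^ 2 := by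
  have hmem (k : ι) : α k ∈ I := by
    suffices α k ∈ toLattice I from this
    exact h ▸ AddSubgroup.subset_closure (Set.mem_range_self k)
  exact pow_two I ▸ FractionalIdeal.mul_mem_mul (hmem i) (hmem j)

theorem span_eq_restrictScalars_iff {ι : Type*} {I : FractionalIdeal O⁰ K} {α : ι → K} :
    Submodule.span ℤ (Set.range α) = (I : Submodule O K).restrictScalars ℤ ↔
      toLattice I = AddSubgroup.closure (Set.range α) := by
  rw [← Submodule.toAddSubgroup_injective.eq_iff, Submodule.span_int_eq_addSubgroupClosure,
    eq_comm]
  rfl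

theorem latticeNorm_nonneg (I : FractionalIdeal O⁰ K) : 0 ≤ latticeNorm I := by
  rw [latticeNorm, latticeIndex]; positivity

theorem eq_one_of_le_one_of_latticeNorm_eq_one {I : FractionalIdeal O⁰ K} (hI : I ≤ 1)
    (h : latticeNorm I = 1) : I = 1 := by
  have hle : toLattice I ≤ toLattice (1 : FractionalIdeal O⁰ K) := hI
  rw [latticeNorm, latticeIndex, AddSubgroup.relIndex_eq_one.2 hle, Nat.cast_one, div_one,
    Nat.cast_eq_one, AddSubgroup.relIndex_eq_one] at h
  exact le_antisymm hI h

theorem latticeNorm_eq_abs_det [Algebra ℚ K] {ι : Type*} [Fintype ι] [DecidableEq ι]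
    {I : FractionalIdeal O⁰ K} {b α : Module.Basis ι ℚ K}
    (hb : toLattice (1 : FractionalIdeal O⁰ K) = AddSubgroup.closure (Set.range b))
    (hα : toLattice I = AddSubgroup.closure (Set.range α)) : latticeNorm I = |b.det α| := by
  rw [latticeNorm, hb, hα, latticeIndex_closure_range]

theorem latticeNorm_ne_zero [IsDomain O] [Module.Finite ℤ O] [CharZero O] [IsFractionRing O K]
    (I : (FractionalIdeal O⁰ K)ˣ) : latticeNorm (I : FractionalIdeal O⁰ K) ≠ 0 := by
  intro h
  have hmul := latticeNorm_mul I I⁻¹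
  rw [← Units.val_mul, mul_inv_cancel, Units.val_one, latticeNorm_one, h, zero_mul] at hmul
  exact one_ne_zero hmul

theorem eq_of_le_of_latticeNorm_eq [IsDomain O] [Module.Finite ℤ O] [CharZero O]
    [IsFractionRing O K] {I J : (FractionalIdeal O⁰ K)ˣ} (hle : (I : FractionalIdeal O⁰ K) ≤ J)
    (h : latticeNorm (I : FractionalIdeal O⁰ K) = latticeNorm (J : FractionalIdeal O⁰ K)) :
    I = J := by
  have hJ := latticeNorm_mul J J⁻¹
  rw [← Units.val_mul, mul_inv_cancel, Units.val_one, latticeNorm_one] at hJ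
  rw [← mul_inv_eq_one, ← Units.val_eq_one, Units.val_mul]
  refine eq_one_of_le_one_of_latticeNorm_eq_one ?_ (by rw [latticeNorm_mul, h, ← hJ])
  exact (mul_le_mul_left hle _).trans_eq J.mul_inv

end FractionalIdealLattices

section ScaledBasis

variable {ι K : Type*} [Field K] [Algebra ℚ K]

/-- The rational basis `κ α` of `K`. -/
noncomputable def scaledBasis (κ : Kˣ) (α : Module.Basis ι ℚ K) : Module.Basis ι ℚ K :=
  α.map ((LinearEquiv.smulOfUnit κ : K ≃ₗ[K] K).restrictScalars ℚ)

theorem scaledBasis_apply (κ : Kˣ) (α : Module.Basis ι ℚ K) (i : ι) :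
    scaledBasis κ α i = κ * α i := rfl

theorem det_scaledBasis [Fintype ι] [DecidableEq ι] (b : Module.Basis ι ℚ K) (κ : Kˣ)
    (α : Module.Basis ι ℚ K) :
    b.det (scaledBasis κ α) = Algebra.norm ℚ (κ : K) * b.det α :=
  b.det_comp (Algebra.lmul ℚ K (κ : K)) α

theorem closure_range_scaledBasis (κ : Kˣ) (α : Module.Basis ι ℚ K) :
    AddSubgroup.closure (Set.range (scaledBasis κ α)) =
      (AddSubgroup.closure (Set.range α)).map (AddMonoidHom.mulLeft (κ : K)) := by
  rw [AddMonoidHom.map_closure, ← Set.range_comp]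
  rfl

theorem toLattice_spanSingleton_mul_eq_closure {O : Type*} [CommRing O] [Algebra O K]
    [IsLocalization O⁰ K] {I : FractionalIdeal O⁰ K} {α : Module.Basis ι ℚ K}
    (h : toLattice I = AddSubgroup.closure (Set.range α)) (κ : Kˣ) :
    toLattice (FractionalIdeal.spanSingleton O⁰ (κ : K) * I) =
      AddSubgroup.closure (Set.range (scaledBasis κ α)) := by
  rw [toLattice_spanSingleton_mul, h, closure_range_scaledBasis]

end ScaledBasis

section Orders

variable {O K : Type*} [CommRing O] [Module.Finite ℤ O] [CharZero O] [Field K] [Algebra O K]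
  [IsFractionRing O K]

theorem exists_int_mul_eq_algebraMap (x : K) :
    ∃ (d : ℤ) (a : O), d ≠ 0 ∧ (d : K) * x = algebraMap O K a := by
  obtain ⟨a, s, hs, rfl⟩ := IsFractionRing.div_surjective (A := O) x
  obtain ⟨d, hd, t, ht⟩ := (Algebra.IsAlgebraic.isAlgebraic (R := ℤ) s).exists_nonzero_dvd hs
  have hs0 : algebraMap O K s ≠ 0 := IsFractionRing.to_map_ne_zero_of_mem_nonZeroDivisors hs
  have hd' : (d : K) = algebraMap O K s * algebraMap O K t := by
    rw [← map_mul, ← ht]; simp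
  exact ⟨d, t * a, hd, by rw [hd', map_mul]; field_simp⟩

variable [IsDomain O] [NumberField K]

theorem isLattice_restrictScalars {I : FractionalIdeal O⁰ K} (hI : I ≠ 0) :
    Submodule.IsLattice ℚ ((I : Submodule O K).restrictScalars ℤ) where
  fg := by
    have : IsNoetherianRing O := IsNoetherianRing.of_finite ℤ O
    exact (FractionalIdeal.fg_of_isNoetherianRing le_rfl I).restrictScalars
  span_eq_top := by
    obtain ⟨x, hx, hx0⟩ : ∃ x ∈ I, x ≠ 0 := by
      by_contra! h
      exact hI (FractionalIdeal.eq_zero_iff.2 h)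
    refine eq_top_iff.2 fun y _ => ?_
    obtain ⟨d, a, hd, hda⟩ := exists_int_mul_eq_algebraMap (O := O) (y / x)
    have hy : y = (d : ℚ)⁻¹ • (a • x) := by
      rw [Algebra.smul_def a, ← hda, mul_assoc, div_mul_cancel₀ _ hx0, Algebra.smul_def]
      simp [hd]
    rw [hy]
    exact Submodule.smul_mem _ _ (Submodule.subset_span ((I : Submodule O K).smul_mem a hx))

theorem exists_basis_toLattice_eq {I : FractionalIdeal O⁰ K} (hI : I ≠ 0) :
    ∃ α : Module.Basis (Fin (Module.finrank ℚ K)) ℚ K,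
      toLattice I = AddSubgroup.closure (Set.range α) := by
  have := isLattice_restrictScalars hI
  let c := Module.Free.chooseBasis ℤ ((I : Submodule O K).restrictScalars ℤ)
  let β := c.extendOfIsLattice ℚ
  have hβ : Submodule.span ℤ (Set.range β) = (I : Submodule O K).restrictScalars ℤ := by
    have hrange : Set.range β = Submodule.subtype _ '' Set.range c := by
      rw [← Set.range_comp]
      exact congrArg Set.range (funext (c.extendOfIsLattice_apply ℚ))
    rw [hrange, ← Submodule.map_span, c.span_eq, Submodule.map_top, Submodule.range_subtype]
  have hcard := (Module.finrank_eq_card_basis β).symm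
  refine ⟨β.reindex (Fintype.equivFinOfCardEq hcard), ?_⟩
  rw [Module.Basis.range_reindex, ← Submodule.span_int_eq_addSubgroupClosure, hβ]
  rfl

theorem latticeNorm_spanSingleton (δ : Kˣ) :
    latticeNorm (FractionalIdeal.spanSingleton O⁰ (δ : K)) = |Algebra.norm ℚ (δ : K)| := by
  obtain ⟨b, hb⟩ := exists_basis_toLattice_eq (O := O) (K := K) one_ne_zero
  have hδ := toLattice_spanSingleton_mul_eq_closure hb δ
  rw [mul_one] at hδ
  rw [latticeNorm_eq_abs_det hb hδ, det_scaledBasis, b.det_self, mul_one]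

end Orders

/-! ### Finiteness of the class group and units of norm one -/

section ClassGroupFinite

variable {O : Type*} [CommRing O] [IsDomain O]

theorem exists_mk_eq_and_le_one {M : O} (hM : M ≠ 0)
    (hdvd : ∀ A : Ideal O, A ≠ 0 → ∃ b ∈ A, b ≠ 0 ∧ ∀ a ∈ A, b ∣ M * a)
    {K : Type*} [Field K] [Algebra O K] [IsFractionRing O K] (x : ClassGroup O) :
    ∃ U : (FractionalIdeal O⁰ K)ˣ, ClassGroup.mk K U = x ∧
      FractionalIdeal.spanSingleton O⁰ (algebraMap O K M) ≤ U ∧ (U : FractionalIdeal O⁰ K) ≤ 1 := by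
  refine ClassGroup.induction (K := K) (fun I => ?_) x
  obtain ⟨d, A, hd, hI⟩ := FractionalIdeal.exists_eq_spanSingleton_mul (I : FractionalIdeal O⁰ K)
  have hA : A ≠ 0 := by
    rintro rfl
    exact I.ne_zero (by rw [hI]; simp)
  obtain ⟨b, hbA, hb, hbdvd⟩ := hdvd A hA
  have hne {z : O} (hz : z ≠ 0) : algebraMap O K z ≠ 0 := by simpa using hz
  let κ : Kˣ := Units.mk0 (algebraMap O K M / algebraMap O K b * algebraMap O K d)
    (mul_ne_zero (div_ne_zero (hne hM) (hne hb)) (hne hd))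
  have hU : (toPrincipalIdeal O K κ * I : (FractionalIdeal O⁰ K)ˣ) =
      FractionalIdeal.spanSingleton O⁰ (algebraMap O K M / algebraMap O K b) * A := by
    rw [Units.val_mul, coe_toPrincipalIdeal, hI, ← mul_assoc,
      FractionalIdeal.spanSingleton_mul_spanSingleton, Units.val_mk0,
      mul_inv_cancel_right₀ (hne hd)]
  refine ⟨toPrincipalIdeal O K κ * I, ?_, ?_, ?_⟩
  · rw [map_mul, (ClassGroup.mk_eq_one_iff (K := K)).2, one_mul]
    exact ⟨κ, by rw [coe_toPrincipalIdeal, FractionalIdeal.coe_spanSingleton]⟩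
  · rw [hU, FractionalIdeal.spanSingleton_le_iff_mem, FractionalIdeal.mem_singleton_mul]
    exact ⟨algebraMap O K b, FractionalIdeal.mem_coeIdeal_of_mem _ hbA,
      (div_mul_cancel₀ _ (hne hb)).symm⟩
  · rw [hU, FractionalIdeal.spanSingleton_mul_le_iff]
    intro z hz
    obtain ⟨a, ha, rfl⟩ := (FractionalIdeal.mem_coeIdeal _).1 hz
    obtain ⟨c, hc⟩ := hbdvd a ha
    refine (FractionalIdeal.mem_one_iff _).2 ⟨c, ?_⟩
    rw [div_mul_eq_mul_div, ← map_mul, hc, map_mul, mul_div_cancel_left₀ _ (hne hb)]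

variable [Module.Finite ℤ O] [CharZero O]

theorem exists_ne_zero_forall_ideal_dvd_mul :
    ∃ M : O, M ≠ 0 ∧ ∀ A : Ideal O, A ≠ 0 → ∃ b ∈ A, b ≠ 0 ∧ ∀ a ∈ A, b ∣ M * a := by
  classical
  let bS := Module.Free.chooseBasis ℤ O
  let adm := AbsoluteValue.absIsAdmissible
  refine ⟨algebraMap ℤ O (∏ m ∈ ClassGroup.finsetApprox bS adm, m),
    ClassGroup.prod_finsetApprox_ne_zero bS adm, fun A hA => ?_⟩
  obtain ⟨b, hbA, hb, hmin⟩ := ClassGroup.exists_min (R := ℤ) AbsoluteValue.abs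
    ⟨A, mem_nonZeroDivisors_iff_ne_zero.2 hA⟩
  refine ⟨b, hbA, hb, fun a ha => ?_⟩
  obtain ⟨q, r, hr, hlt⟩ := ClassGroup.exists_mem_finset_approx' bS adm a hb
  have hrq : (algebraMap ℤ O r) * a = q * b := by
    rw [← Algebra.smul_def]
    exact sub_eq_zero.1
      (hmin _ (A.sub_mem (A.smul_of_tower_mem r ha) (A.mul_mem_left q hbA)) hlt)
  exact (Dvd.intro_left q hrq.symm).trans
    (mul_dvd_mul_right (map_dvd (algebraMap ℤ O) (Finset.dvd_prod_of_mem _ hr)) a)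

theorem finite_setOf_spanSingleton_le_le_one {K : Type*} [Field K] [Algebra O K]
    [IsFractionRing O K] {M : O} (hM : M ≠ 0) :
    {I : FractionalIdeal O⁰ K |
      FractionalIdeal.spanSingleton O⁰ (algebraMap O K M) ≤ I ∧ I ≤ 1}.Finite := by
  have : Finite (O ⧸ Ideal.span {M}) :=
    Ideal.finiteQuotientOfFreeOfNeBot _ (by rwa [Ne, Ideal.span_singleton_eq_bot])
  have hfin : (Set.Ici (Ideal.span {M})).Finite :=
    Finite.of_equiv _ (Submodule.comapMkQRelIso (Ideal.span {M})).toEquiv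
  refine (hfin.image fun J : Ideal O => (J : FractionalIdeal O⁰ K)).subset ?_
  rintro I ⟨hMI, hI⟩
  obtain ⟨J, rfl⟩ := FractionalIdeal.le_one_iff_exists_coeIdeal.1 hI
  rw [← FractionalIdeal.coeIdeal_span_singleton, FractionalIdeal.coeIdeal_le_coeIdeal] at hMI
  exact ⟨J, hMI, rfl⟩

variable (O) in
theorem finite_classGroup : Finite (ClassGroup O) := by
  obtain ⟨M, hM, hdvd⟩ := exists_ne_zero_forall_ideal_dvd_mul (O := O)
  have hfin := ((finite_setOf_spanSingleton_le_le_one (K := FractionRing O) hM).preimage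
    Units.val_injective.injOn).image (ClassGroup.mk (FractionRing O))
  refine Set.finite_univ_iff.1 (hfin.subset fun x _ => ?_)
  obtain ⟨U, hUx, hU⟩ := exists_mk_eq_and_le_one (K := FractionRing O) hM hdvd x
  exact ⟨U, hU, hUx⟩

end ClassGroupFinite

section Units

open NumberField

theorem finrank_eq_of_injective_of_forall_smul_mem_range {M N : Type*} [AddCommGroup M]
    [AddCommGroup N] [Module.Finite ℤ N] {L : M →ₗ[ℤ] N} (hL : Function.Injective L)
    (h : ∀ y, ∃ k : ℤ, k ≠ 0 ∧ k • y ∈ LinearMap.range L) :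
    Module.finrank ℤ M = Module.finrank ℤ N := by
  have hquot : Module.finrank ℤ (N ⧸ LinearMap.range L) = 0 := by
    refine Module.finrank_eq_zero_iff.2 fun x => ?_
    obtain ⟨y, rfl⟩ := Submodule.mkQ_surjective _ x
    obtain ⟨k, hk, hy⟩ := h y
    refine ⟨k, hk, ?_⟩
    rwa [← map_smul, Submodule.mkQ_apply, Submodule.Quotient.mk_eq_zero]
  rw [(LinearEquiv.ofInjective L hL).finrank_eq,
    ← Submodule.finrank_quotient_add_finrank (LinearMap.range L), hquot, zero_add]

theorem norm_neg_of_odd_finrank {F K : Type*} [Field F] [Field K] [Algebra F K]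
    (hodd : Odd (Module.finrank F K)) (x : K) : Algebra.norm F (-x) = -Algebra.norm F x := by
  have hneg : -x = algebraMap F K (-1) * x := by simp
  rw [hneg, map_mul, Algebra.norm_algebraMap, hodd.neg_one_pow, neg_one_mul]

section

variable (O K : Type*) [CommRing O] [Field K] [Algebra ℚ K] [Algebra O K]

/-- The group of units of an order `O` that have norm one in the number field `K`. -/
noncomputable def normOneUnits : Subgroup Oˣ :=
  (((Algebra.norm ℚ : K →* ℚ).comp (algebraMap O K : O →* K)).comp (Units.coeHom O)).ker

variable {O K} in
theorem mem_normOneUnits {u : Oˣ} :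
    u ∈ normOneUnits O K ↔ Algebra.norm ℚ (algebraMap O K u) = 1 := Iff.rfl

end

section

variable (O K : Type*) [CommRing O] [Module.Finite ℤ O] [Field K] [Algebra O K]

/-- The inclusion of an order in the maximal order. -/
noncomputable def toRingOfIntegers : O →ₐ[ℤ] 𝓞 K := IsIntegralClosure.lift ℤ (𝓞 K) K

variable {O K}

theorem algebraMap_toRingOfIntegers (x : O) :
    algebraMap (𝓞 K) K (toRingOfIntegers O K x) = algebraMap O K x :=
  IsIntegralClosure.algebraMap_lift _ _ _ _

theorem norm_unit_eq_one_or_neg_one [NumberField K] (u : Oˣ) :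
    Algebra.norm ℚ (algebraMap O K u) = 1 ∨ Algebra.norm ℚ (algebraMap O K u) = -1 := by
  have h := NumberField.isUnit_iff_norm.1
    (Units.map (toRingOfIntegers O K : O →* 𝓞 K) u).isUnit
  rw [← algebraMap_toRingOfIntegers, ← RingOfIntegers.coe_norm]
  exact eq_or_eq_neg_of_abs_eq h

variable (O K) in
/-- The inclusion of the units of norm one of an order in the units of the maximal order. -/
noncomputable def normOneUnitsMap [Algebra ℚ K] : normOneUnits O K →* (𝓞 K)ˣ :=
  (Units.map (toRingOfIntegers O K : O →* 𝓞 K)).comp (normOneUnits O K).subtype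

variable [IsFractionRing O K]

theorem toRingOfIntegers_injective : Function.Injective (toRingOfIntegers O K) := by
  intro x y h
  apply IsFractionRing.injective O K
  rw [← algebraMap_toRingOfIntegers, h, algebraMap_toRingOfIntegers]

theorem normOneUnitsMap_injective [Algebra ℚ K] : Function.Injective (normOneUnitsMap O K) :=
  fun _ _ h => Subtype.ext (Units.ext (toRingOfIntegers_injective (congrArg Units.val h)))

variable [NumberField K]

theorem exists_conductor :
    ∃ c : O, c ≠ 0 ∧ ∀ y : 𝓞 K, ∃ x : O, toRingOfIntegers O K x = toRingOfIntegers O K c * y := by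
  obtain ⟨c, hc⟩ := IsLocalization.exist_integer_multiples_of_finite O⁰
    (fun i => algebraMap (𝓞 K) K (RingOfIntegers.basis K i))
  have : IsDomain O := (IsFractionRing.injective O K).isDomain
  refine ⟨c, nonZeroDivisors.ne_zero c.2, fun y => ?_⟩
  have hy : algebraMap O K c * algebraMap (𝓞 K) K y ∈ (algebraMap O K).range := by
    rw [← (RingOfIntegers.basis K).sum_repr y, map_sum, Finset.mul_sum]
    refine sum_mem fun i _ => ?_
    rw [map_zsmul, mul_smul_comm]
    refine zsmul_mem ?_ _
    obtain ⟨x, hx⟩ := hc i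
    exact ⟨x, by rw [hx, Algebra.smul_def]⟩
  obtain ⟨x, hx⟩ := hy
  refine ⟨x, RingOfIntegers.coe_injective ?_⟩
  rw [map_mul, algebraMap_toRingOfIntegers, algebraMap_toRingOfIntegers, hx]

theorem exists_pow_unit_sub_one_mem {I : Ideal (𝓞 K)} (hI : I ≠ ⊥) :
    ∃ k : ℕ, 0 < k ∧ ∀ u : (𝓞 K)ˣ, ((u ^ k : (𝓞 K)ˣ) : 𝓞 K) - 1 ∈ I := by
  have : Finite (𝓞 K ⧸ I) := Ideal.finiteQuotientOfFreeOfNeBot I hI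
  refine ⟨Nat.card (𝓞 K ⧸ I)ˣ, Nat.card_pos, fun u => ?_⟩
  have h : Units.map (Ideal.Quotient.mk I : 𝓞 K →* 𝓞 K ⧸ I) u ^ Nat.card (𝓞 K ⧸ I)ˣ = 1 :=
    pow_card_eq_one'
  rw [← map_pow] at h
  exact Ideal.Quotient.eq.1 ((congrArg Units.val h).trans (map_one (Ideal.Quotient.mk I)).symm)

variable (O) in
theorem exists_map_toRingOfIntegers_eq_pow (u : (𝓞 K)ˣ) :
    ∃ k : ℕ, 0 < k ∧ ∃ w : Oˣ, Units.map (toRingOfIntegers O K : O →* 𝓞 K) w = u ^ k := by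
  obtain ⟨c, hc, hmul⟩ := exists_conductor (O := O) (K := K)
  have hI : Ideal.span {toRingOfIntegers O K c} ≠ ⊥ := by
    rwa [Ne, Ideal.span_singleton_eq_bot, map_eq_zero_iff _ toRingOfIntegers_injective]
  obtain ⟨k, hk, hpow⟩ := exists_pow_unit_sub_one_mem hI
  have hlift (v : (𝓞 K)ˣ) : ∃ x : O, toRingOfIntegers O K x = (v ^ k : (𝓞 K)ˣ) := by
    obtain ⟨y, hy⟩ := Ideal.mem_span_singleton.1 (hpow v)
    obtain ⟨x, hx⟩ := hmul y
    exact ⟨x + 1, by rw [map_add, map_one, hx, ← hy, sub_add_cancel]⟩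
  obtain ⟨x, hx⟩ := hlift u
  obtain ⟨y, hy⟩ := hlift u⁻¹
  have hxy : x * y = 1 := by
    apply toRingOfIntegers_injective (K := K)
    rw [map_mul, hx, hy, ← Units.val_mul, ← mul_pow, mul_inv_cancel, one_pow, Units.val_one,
      map_one]
  exact ⟨k, hk, ⟨x, y, hxy, by rwa [mul_comm]⟩, Units.ext hx⟩

theorem isMulTorsionFree_normOneUnits (hodd : Odd (Module.finrank ℚ K)) :
    IsMulTorsionFree (normOneUnits O K) := by
  rw [CommGroup.isMulTorsionFree_iff_torsion_eq_bot, eq_bot_iff]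
  intro u hu
  have htors : normOneUnitsMap O K u ∈ Units.torsion K :=
    (normOneUnitsMap O K).isOfFinOrder hu
  apply normOneUnitsMap_injective
  rw [map_one]
  refine (Units.torsion_eq_one_or_neg_one_of_odd_finrank hodd ⟨_, htors⟩).resolve_right fun h => ?_
  have hval : toRingOfIntegers O K u.1 = -1 := congrArg Units.val h
  have hnorm := u.2
  rw [mem_normOneUnits, ← algebraMap_toRingOfIntegers, hval, map_neg,
    norm_neg_of_odd_finrank hodd, map_one, map_one] at hnorm
  norm_num at hnorm

theorem finrank_normOneUnits :
    Module.finrank ℤ (Additive (normOneUnits O K)) = Units.rank K := by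
  let L : Additive (normOneUnits O K) →ₗ[ℤ] Additive (𝓞 K)ˣ :=
    (MonoidHom.toAdditive (normOneUnitsMap O K)).toIntLinearMap
  rw [← Units.finrank_eq K]
  refine finrank_eq_of_injective_of_forall_smul_mem_range (L := L)
    (normOneUnitsMap_injective (O := O) (K := K)) fun y => ?_
  obtain ⟨u, rfl⟩ := Additive.ofMul.surjective y
  obtain ⟨k, hk, w, hw⟩ := exists_map_toRingOfIntegers_eq_pow O u
  refine ⟨(k * 2 : ℕ), by exact_mod_cast (by omega), ?_⟩
  have hw2 : w ^ 2 ∈ normOneUnits O K := by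
    rw [mem_normOneUnits, Units.val_pow_eq_pow_val, map_pow, map_pow]
    rcases norm_unit_eq_one_or_neg_one (K := K) w with h | h <;> rw [h] <;> norm_num
  refine ⟨Additive.ofMul ⟨w ^ 2, hw2⟩, ?_⟩
  change Additive.ofMul (Units.map (toRingOfIntegers O K : O →* 𝓞 K) (w ^ 2)) = _
  rw [map_pow, hw, ← pow_mul, ofMul_pow, natCast_zsmul]

variable (O K) in
theorem index_range_sq_normOneUnits (hodd : Odd (Module.finrank ℚ K)) :
    (powMonoidHom 2 : normOneUnits O K →* normOneUnits O K).range.index = 2 ^ Units.rank K := by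
  have := isMulTorsionFree_normOneUnits (O := O) hodd
  have : Module.Finite ℤ (Additive (normOneUnits O K)) := Module.Finite.of_injective
    (MonoidHom.toAdditive (normOneUnitsMap O K)).toIntLinearMap
    (normOneUnitsMap_injective (O := O) (K := K))
  rw [← finrank_normOneUnits (O := O),
    ← AddSubgroup.index_range_nsmul (Additive (normOneUnits O K)) 2, ← Subgroup.index_toAddSubgroup]
  rfl

end

end Units

/-! ### The order of `H(O)` -/

section PrincipalIdeals

variable {O K : Type*} [CommRing O] [Field K] [Algebra O K] [IsFractionRing O K]

theorem classGroupMk_eq_one_iff_mem_range [IsDomain O] {I : (FractionalIdeal O⁰ K)ˣ} :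
    ClassGroup.mk K I = 1 ↔ I ∈ (toPrincipalIdeal O K).range := by
  rw [← (ClassGroup.equiv K).map_eq_one_iff, ClassGroup.equiv_mk, QuotientGroup.mk'_apply,
    QuotientGroup.eq_one_iff, FractionalIdeal.canonicalEquiv_self]
  rfl

theorem toPrincipalIdeal_eq_one_iff {κ : Kˣ} :
    toPrincipalIdeal O K κ = 1 ↔ ∃ u : Oˣ, Units.map (algebraMap O K : O →* K) u = κ := by
  have hint (κ : Kˣ) (h : toPrincipalIdeal O K κ = 1) : ∃ x : O, algebraMap O K x = κ := by
    rw [toPrincipalIdeal_eq_iff, Units.val_one] at h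
    rw [← FractionalIdeal.mem_one_iff O⁰, ← h]
    exact FractionalIdeal.mem_spanSingleton_self _ _
  constructor
  · intro h
    obtain ⟨x, hx⟩ := hint κ h
    obtain ⟨y, hy⟩ := hint κ⁻¹ (by rw [map_inv, h, inv_one])
    have hxy : x * y = 1 := by
      apply IsFractionRing.injective O K
      rw [map_mul, hx, hy, map_one, Units.mul_inv]
    exact ⟨⟨x, y, hxy, by rwa [mul_comm]⟩, Units.ext hx⟩
  · rintro ⟨u, rfl⟩
    rw [toPrincipalIdeal_eq_iff, Units.val_one]
    change FractionalIdeal.spanSingleton O⁰ (algebraMap O K u) = 1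
    rw [← FractionalIdeal.coeIdeal_span_singleton, Ideal.span_singleton_eq_top.2 u.isUnit,
      FractionalIdeal.coeIdeal_top]

theorem toPrincipalIdeal_neg (κ : Kˣ) : toPrincipalIdeal O K (-κ) = toPrincipalIdeal O K κ := by
  have h : toPrincipalIdeal O K (-1) = 1 :=
    toPrincipalIdeal_eq_one_iff.2 ⟨-1, by ext; simp⟩
  rw [← neg_one_mul, map_mul, h, one_mul]

end PrincipalIdeals

section Count

variable {O K : Type*} [CommRing O] [IsDomain O] [Module.Finite ℤ O] [CharZero O]
  [Field K] [NumberField K] [Algebra O K] [IsFractionRing O K]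

theorem mem_projectivePairs_iff {p : (FractionalIdeal O⁰ K)ˣ × Kˣ} :
    p ∈ projectivePairs O K ↔ toPrincipalIdeal O K p.2 = p.1 ^ 2 ∧
      latticeNorm (p.1 : FractionalIdeal O⁰ K) ^ 2 = Algebra.norm ℚ (p.2 : K) :=
  and_congr_left fun _ => by rw [toPrincipalIdeal_eq_iff, eq_comm, Units.val_pow_eq_pow_val]

theorem mem_projectivePairs_iff_norm_nonneg {p : (FractionalIdeal O⁰ K)ˣ × Kˣ} :
    p ∈ projectivePairs O K ↔
      toPrincipalIdeal O K p.2 = p.1 ^ 2 ∧ 0 ≤ Algebra.norm ℚ (p.2 : K) := by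
  refine mem_projectivePairs_iff.trans (and_congr_right fun h => ?_)
  rw [toPrincipalIdeal_eq_iff, Units.val_pow_eq_pow_val] at h
  rw [sq, ← latticeNorm_mul, ← sq, ← h, latticeNorm_spanSingleton, abs_eq_self]

theorem mk_eq_mk_iff {p q : projectivePairs O K} :
    (QuotientGroup.mk p : HGroup O K) = QuotientGroup.mk q ↔
      ∃ κ : Kˣ, q.1.1 = toPrincipalIdeal O K κ * p.1.1 ∧ q.1.2 = κ ^ 2 * p.1.2 := by
  rw [QuotientGroup.eq, Subgroup.mem_subgroupOf]
  refine exists_congr fun κ => Prod.ext_iff.trans (and_congr ?_ ?_)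
  · exact eq_inv_mul_iff_mul_eq.trans (by rw [mul_comm, eq_comm]; rfl)
  · exact eq_inv_mul_iff_mul_eq.trans (by rw [mul_comm, eq_comm]; rfl)

theorem mem_projectivePairs_iff_mul_pow_le (U : (FractionalIdeal O⁰ K)ˣ) (k : ℕ)
    {p : (FractionalIdeal O⁰ K)ˣ × Kˣ} :
    p ∈ projectivePairs O K ↔
      ((p.1 * U ^ k : (FractionalIdeal O⁰ K)ˣ) : FractionalIdeal O⁰ K) ^ 2 ≤
        FractionalIdeal.spanSingleton O⁰ (p.2 : K) * (U : FractionalIdeal O⁰ K) ^ (2 * k) ∧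
      latticeNorm ((p.1 * U ^ k : (FractionalIdeal O⁰ K)ˣ) : FractionalIdeal O⁰ K) ^ 2 =
        Algebra.norm ℚ (p.2 : K) * latticeNorm ((U : FractionalIdeal O⁰ K) ^ (2 * k)) := by
  have latticeNorm_sq (I : (FractionalIdeal O⁰ K)ˣ) :
      latticeNorm ((I ^ 2 : (FractionalIdeal O⁰ K)ˣ) : FractionalIdeal O⁰ K) =
        latticeNorm (I : FractionalIdeal O⁰ K) ^ 2 := by
    rw [sq, Units.val_mul, latticeNorm_mul, sq]
  have hideal : (p.1 * U ^ k) ^ 2 = p.1 ^ 2 * U ^ (2 * k) := by rw [mul_pow, ← pow_mul']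
  rw [mem_projectivePairs_iff, ← latticeNorm_sq p.1, ← latticeNorm_sq (p.1 * U ^ k),
    ← Units.val_pow_eq_pow_val, ← Units.val_pow_eq_pow_val, hideal, ← coe_toPrincipalIdeal,
    Units.val_mul, latticeNorm_mul, mul_left_inj' (latticeNorm_ne_zero _)]
  refine and_congr_left fun hnorm => ⟨fun h => by rw [h], fun hle => ?_⟩
  have hpos : 0 ≤ Algebra.norm ℚ (p.2 : K) := hnorm ▸ latticeNorm_nonneg _
  refine (mul_right_cancel (eq_of_le_of_latticeNorm_eq (J := _ * U ^ (2 * k)) hle ?_)).symm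
  rw [Units.val_mul, latticeNorm_mul, Units.val_mul, latticeNorm_mul, hnorm, coe_toPrincipalIdeal,
    latticeNorm_spanSingleton, abs_of_nonneg hpos]

variable (O K)

/-- The homomorphism sending a pair `(I, δ)` to the ideal class of `I`. -/
noncomputable def pairClass : projectivePairs O K →* ClassGroup O :=
  (ClassGroup.mk K).comp ((MonoidHom.fst _ _).comp (projectivePairs O K).subtype)

/-- The homomorphism sending a unit `u` of norm one to the pair `((1), u)`. -/
noncomputable def unitPair : normOneUnits O K →* projectivePairs O K :=
  ((MonoidHom.inr _ _).comp ((Units.map (algebraMap O K : O →* K)).comp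
    (normOneUnits O K).subtype)).codRestrict _ fun u => mem_projectivePairs_iff_norm_nonneg.2 <| by
      refine ⟨(toPrincipalIdeal_eq_one_iff.2 ⟨u.1, rfl⟩).trans (one_pow 2).symm, ?_⟩
      exact zero_le_one.trans_eq (mem_normOneUnits.1 u.2).symm

variable {O K}

theorem mem_ker_pairClass {p : projectivePairs O K} :
    p ∈ (pairClass O K).ker ↔ p.1.1 ∈ (toPrincipalIdeal O K).range :=
  classGroupMk_eq_one_iff_mem_range

theorem comap_unitPair_trivialPairs (hodd : Odd (Module.finrank ℚ K)) :
    ((trivialPairs O K).subgroupOf (projectivePairs O K)).comap (unitPair O K) =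
      (powMonoidHom 2 : normOneUnits O K →* normOneUnits O K).range := by
  ext u
  rw [Subgroup.mem_comap, Subgroup.mem_subgroupOf]
  constructor
  · rintro ⟨κ, hκ⟩
    obtain ⟨w, rfl⟩ := toPrincipalIdeal_eq_one_iff.1 (congrArg Prod.fst hκ)
    have hw : w ^ 2 = u.1 := by
      apply Units.map_injective (f := (algebraMap O K : O →* K)) (IsFractionRing.injective O K)
      rw [map_pow]
      exact congrArg Prod.snd hκ
    rcases norm_unit_eq_one_or_neg_one (K := K) w with h | h
    · exact ⟨⟨w, h⟩, Subtype.ext hw⟩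
    · refine ⟨⟨-w, ?_⟩, Subtype.ext ((neg_sq w).trans hw)⟩
      rw [mem_normOneUnits, Units.val_neg, map_neg, norm_neg_of_odd_finrank hodd, h, neg_neg]
  · rintro ⟨w, rfl⟩
    exact ⟨Units.map (algebraMap O K : O →* K) w.1,
      Prod.ext (toPrincipalIdeal_eq_one_iff.2 ⟨w.1, rfl⟩)
        (map_pow (Units.map (algebraMap O K : O →* K)) w.1 2).symm⟩

theorem trivialPairs_le_ker_pairClass :
    (trivialPairs O K).subgroupOf (projectivePairs O K) ≤ (pairClass O K).ker := by
  intro p hp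
  obtain ⟨κ, hκ⟩ := Subgroup.mem_subgroupOf.1 hp
  exact mem_ker_pairClass.2 ⟨κ, congrArg Prod.fst hκ⟩

theorem ker_pairClass : (pairClass O K).ker =
    (trivialPairs O K).subgroupOf (projectivePairs O K) ⊔ (unitPair O K).range := by
  refine le_antisymm (fun p hp => ?_) (sup_le trivialPairs_le_ker_pairClass ?_)
  · obtain ⟨κ, hκ⟩ := mem_ker_pairClass.1 hp
    obtain ⟨hsq, hnorm⟩ := mem_projectivePairs_iff.1 p.2
    obtain ⟨u, hu⟩ : ∃ u : Oˣ, Units.map (algebraMap O K : O →* K) u = p.1.2 * (κ ^ 2)⁻¹ := by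
      rw [← toPrincipalIdeal_eq_one_iff, map_mul, map_inv, mul_inv_eq_one, map_pow, hκ, hsq]
    have hu1 : u ∈ normOneUnits O K := by
      have hval : algebraMap O K u = (p.1.2 : K) * ((κ : K) ^ 2)⁻¹ := by
        simpa only [Units.val_mul, Units.val_inv_eq_inv_val, Units.val_pow_eq_pow_val] using!
          congrArg Units.val hu
      have hκ0 : Algebra.norm ℚ (κ : K) ≠ 0 := Algebra.norm_ne_zero_iff.2 κ.ne_zero
      rw [mem_normOneUnits, hval, map_mul, ← hnorm, ← hκ, coe_toPrincipalIdeal,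
        latticeNorm_spanSingleton, sq_abs, Algebra.norm_inv, map_pow,
        mul_inv_cancel₀ (pow_ne_zero 2 hκ0)]
    rw [← inv_mul_cancel_right p (unitPair O K ⟨u, hu1⟩)]
    refine Subgroup.mul_mem_sup (Subgroup.mem_subgroupOf.2 ⟨κ, Prod.ext ?_ ?_⟩) ⟨_, rfl⟩
    · change toPrincipalIdeal O K κ = p.1.1 * (1 : (FractionalIdeal O⁰ K)ˣ)⁻¹
      rw [inv_one, mul_one, hκ]
    · change κ ^ 2 = p.1.2 * (Units.map (algebraMap O K : O →* K) u)⁻¹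
      rw [hu, mul_inv, inv_inv, mul_inv_cancel_left]
  · rintro _ ⟨u, rfl⟩
    exact mem_ker_pairClass.2 (one_mem _)

theorem range_pairClass (hodd : Odd (Module.finrank ℚ K)) :
    (pairClass O K).range = twoTorsionClasses O := by
  ext x
  constructor
  · rintro ⟨p, rfl⟩
    change ClassGroup.mk K p.1.1 ^ 2 = 1
    rw [← map_pow, classGroupMk_eq_one_iff_mem_range]
    exact ⟨p.1.2, (mem_projectivePairs_iff.1 p.2).1⟩
  · refine ClassGroup.induction (K := K) (fun I h => ?_) x
    change ClassGroup.mk K I ^ 2 = 1 at h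
    rw [← map_pow, classGroupMk_eq_one_iff_mem_range] at h
    obtain ⟨δ, hδ⟩ := h
    rcases le_total 0 (Algebra.norm ℚ (δ : K)) with h | h
    · exact ⟨⟨(I, δ), mem_projectivePairs_iff_norm_nonneg.2 ⟨hδ, h⟩⟩, rfl⟩
    · refine ⟨⟨(I, -δ), mem_projectivePairs_iff_norm_nonneg.2 ⟨?_, ?_⟩⟩, rfl⟩
      · rw [toPrincipalIdeal_neg, hδ]
      · rw [Units.val_neg, norm_neg_of_odd_finrank hodd]
        exact neg_nonneg.2 h

theorem card_HGroup (hodd : Odd (Module.finrank ℚ K)) :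
    Nat.card (HGroup O K) =
      2 ^ NumberField.Units.rank K * Nat.card (twoTorsionClasses O) := by
  have h := Subgroup.relIndex_mul_index (trivialPairs_le_ker_pairClass (O := O) (K := K))
  rw [Subgroup.index_ker, range_pairClass hodd, ker_pairClass, Subgroup.relIndex_sup_left,
    ← Subgroup.index_comap, comap_unitPair_trivialPairs hodd,
    index_range_sq_normOneUnits O K hodd] at h
  exact h.symm

theorem finite_HGroup (hodd : Odd (Module.finrank ℚ K)) : Finite (HGroup O K) := by
  have := finite_classGroup O
  apply Nat.finite_of_card_ne_zero
  rw [card_HGroup hodd]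
  exact mul_ne_zero (pow_ne_zero _ two_ne_zero) Nat.card_pos.ne'

end Count

/-! ### The root of a binary form -/

section Homogenize

theorem not_isUnit_of_isHomogeneous {σ R : Type*} [CommSemiring R] [Nontrivial R]
    {φ : MvPolynomial σ R} {m : ℕ} (hφ : φ.IsHomogeneous m) (hm : m ≠ 0) : ¬ IsUnit φ := by
  intro h
  have hzero : MvPolynomial.constantCoeff φ = 0 :=
    hφ.coeff_eq_zero (by simpa using hm.symm)
  exact (h.map MvPolynomial.constantCoeff).ne_zero hzero

variable {F : Type*} [Field F] {p : Polynomial F} {n : ℕ}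

theorem natDegree_eq_of_irreducible_homogenize (hn : 2 ≤ n) (hp : p.natDegree ≤ n)
    (h : Irreducible (p.homogenize n)) : p.natDegree = n := by
  by_contra hne
  have factor : p.homogenize n = p.homogenize (n - 1) * MvPolynomial.X 1 := by
    have := Polynomial.homogenize_mul p 1 (m := n - 1) (n := 1) (by omega) (by simp)
    rwa [mul_one, Nat.sub_add_cancel (by omega), Polynomial.homogenize_one, pow_one] at this
  rcases h.isUnit_or_isUnit factor with hu | hu
  · exact not_isUnit_of_isHomogeneous p.isHomogeneous_homogenize (by omega) hu
  · exact not_isUnit_of_isHomogeneous (MvPolynomial.isHomogeneous_X F 1) one_ne_zero hu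

theorem isUnit_of_isUnit_homogenize {m : ℕ} (hp : p.natDegree ≤ m)
    (h : IsUnit (p.homogenize m)) : IsUnit p := by
  have := h.map (MvPolynomial.aeval ![Polynomial.X, 1] :
    MvPolynomial (Fin 2) F →ₐ[F] Polynomial F)
  rwa [Polynomial.aeval_homogenize_X_one _ hp] at this

theorem irreducible_of_irreducible_homogenize (h : Irreducible (p.homogenize p.natDegree)) :
    Irreducible p := by
  refine ⟨fun hu => h.not_isUnit ?_, fun q r hqr => ?_⟩
  · obtain ⟨c, hc, rfl⟩ := Polynomial.isUnit_iff.1 hu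
    simpa using hc.map (MvPolynomial.C (σ := Fin 2))
  · subst hqr
    have hne : q * r ≠ 0 := fun h0 => h.ne_zero (by simp [h0])
    rw [Polynomial.natDegree_mul (left_ne_zero_of_mul hne) (right_ne_zero_of_mul hne),
      Polynomial.homogenize_mul q r le_rfl le_rfl] at h
    exact (h.isUnit_or_isUnit rfl).imp (isUnit_of_isUnit_homogenize le_rfl)
      (isUnit_of_isUnit_homogenize le_rfl)

end Homogenize

namespace BinaryForm

variable {n : ℕ} (f : BinaryForm n)

/-- The dehomogenisation `f(x, 1)` with rational coefficients. -/
noncomputable def dehomogenize : Polynomial ℚ :=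
  ∑ i : Fin (n + 1), Polynomial.C (f i : ℚ) * Polynomial.X ^ (n - (i : ℕ))

theorem natDegree_dehomogenize_le : f.dehomogenize.natDegree ≤ n :=
  Polynomial.natDegree_sum_le_of_forall_le _ _ fun _ _ =>
    (Polynomial.natDegree_C_mul_X_pow_le _ _).trans (Nat.sub_le _ _)

theorem map_poly_eq_homogenize :
    MvPolynomial.map (Int.castRingHom ℚ) f.poly = f.dehomogenize.homogenize n := by
  rw [poly, dehomogenize, Polynomial.homogenize_finsetSum, map_sum]
  refine Finset.sum_congr rfl fun i _ => ?_
  rw [Polynomial.homogenize_C_mul, Polynomial.homogenize_X_pow (Nat.sub_le _ _),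
    Nat.sub_sub_self (Nat.lt_succ_iff.1 i.2)]
  simp [mul_assoc]

theorem coeff_dehomogenize : f.dehomogenize.coeff n = f.coef 0 := by
  rw [dehomogenize, Polynomial.finsetSum_coeff, Finset.sum_eq_single 0]
  · simp [coef]
  · intro i _ hi
    have hpos : (i : ℕ) ≠ 0 := fun h => hi (Fin.ext h)
    rw [Polynomial.coeff_C_mul_X_pow, if_neg (by omega)]
  · simp

theorem eval_poly (x y : ℤ) : MvPolynomial.eval ![x, y] f.poly =
    ∑ i : Fin (n + 1), f i * x ^ (n - (i : ℕ)) * y ^ (i : ℕ) := by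
  simp [poly]

variable {f}

theorem IsIrreducible.natDegree_dehomogenize (h : f.IsIrreducible) (hn : 2 ≤ n) :
    f.dehomogenize.natDegree = n := by
  rw [IsIrreducible, map_poly_eq_homogenize] at h
  exact natDegree_eq_of_irreducible_homogenize hn f.natDegree_dehomogenize_le h

theorem IsIrreducible.irreducible_dehomogenize (h : f.IsIrreducible) (hn : 2 ≤ n) :
    Irreducible f.dehomogenize := by
  have hdeg := h.natDegree_dehomogenize hn
  rw [IsIrreducible, map_poly_eq_homogenize] at h
  exact irreducible_of_irreducible_homogenize (by rwa [hdeg])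

theorem IsIrreducible.coef_zero_ne_zero (h : f.IsIrreducible) (hn : 2 ≤ n) : f.coef 0 ≠ 0 := by
  intro h0
  refine (h.irreducible_dehomogenize hn).ne_zero (Polynomial.leadingCoeff_eq_zero.1 ?_)
  rw [Polynomial.leadingCoeff, h.natDegree_dehomogenize hn, coeff_dehomogenize, h0, Int.cast_zero]

end BinaryForm

namespace BinaryForm.Root

variable {n : ℕ} {f : BinaryForm n} {K : Type*} [Field K] (θ : f.Root K)

/-- The element `∑ cₖ θᵏ + (-1)^((n-1)/2) (u ζ_{n-2} + w ζ_{n-1})` of `K`, with `k` running over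
`0, …, n - 3`: the shape of `αᵢ αⱼ / δ` in the definition of the correspondence. -/
noncomputable def expansion (c : Fin (n - 2) → ℤ) (u w : ℤ) : K :=
  ∑ k, (c k : K) * θ.val ^ (k : ℕ) +
    (-1) ^ ((n - 1) / 2) * ((u : K) * θ.zeta (n - 2) + (w : K) * θ.zeta (n - 1))

theorem expansion_eq (c : Fin (n - 2) → ℤ) (u w : ℤ) :
    θ.expansion c u w = ∑ k, (c k : K) * θ.val ^ (k : ℕ) +
      (((-1) ^ ((n - 1) / 2) : ℤ) : K) *
        ((u : K) * θ.zeta (n - 2) + (w : K) * θ.zeta (n - 1)) := by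
  rw [expansion]; push_cast; rfl

variable [NumberField K]

theorem aeval_dehomogenize : Polynomial.aeval θ.val f.dehomogenize = 0 := by
  rw [← θ.isRoot, BinaryForm.dehomogenize, BinaryForm.poly, map_sum, map_sum]
  exact Finset.sum_congr rfl fun i _ => by simp

theorem natDegree_minpoly (hirr : f.IsIrreducible) (hn : 2 ≤ n) :
    (minpoly ℚ θ.val).natDegree = n := by
  have hp := hirr.irreducible_dehomogenize hn
  rw [← minpoly.eq_of_irreducible hp θ.aeval_dehomogenize, Polynomial.natDegree_mul_C
    (inv_ne_zero (Polynomial.leadingCoeff_ne_zero.2 hp.ne_zero)), hirr.natDegree_dehomogenize hn]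

theorem zeta_mem_adjoin (k : ℕ) : θ.zeta k ∈ IntermediateField.adjoin ℚ {θ.val} := by
  rw [zeta]
  split_ifs
  · exact one_mem _
  · exact sum_mem fun i _ => mul_mem (intCast_mem _ _)
      (pow_mem (IntermediateField.mem_adjoin_simple_self _ _) _)

theorem mem_adjoin_of_mem_ring {x : K} (hx : x ∈ θ.ring) :
    x ∈ IntermediateField.adjoin ℚ {θ.val} := by
  suffices θ.ringModule ≤
      ((IntermediateField.adjoin ℚ {θ.val}).toSubalgebra.toSubmodule.restrictScalars ℤ) from this hx
  rw [ringModule, Submodule.span_le]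
  rintro z (rfl | ⟨k, -, rfl⟩)
  · exact one_mem (IntermediateField.adjoin ℚ {θ.val})
  · exact θ.zeta_mem_adjoin k

theorem adjoin_eq_top [IsFractionRing θ.ring K] :
    IntermediateField.adjoin ℚ {θ.val} = ⊤ := by
  refine eq_top_iff.2 fun x _ => ?_
  obtain ⟨a, b, _, rfl⟩ := IsFractionRing.div_surjective (A := θ.ring) x
  exact div_mem (θ.mem_adjoin_of_mem_ring a.2) (θ.mem_adjoin_of_mem_ring b.2)

/-- A rational basis of `K` consisting of the powers `1, θ, …, θⁿ⁻¹`, for a form with `f₀ ≠ 0`.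
All the computations with `R_f` and the powers of `I_f` are made in these coordinates. -/
structure Frame where
  basis : Module.Basis (Fin n) ℚ K
  basis_apply : ∀ i, basis i = θ.val ^ (i : ℕ)
  coef_zero_ne_zero : f.coef 0 ≠ 0

theorem nonempty_frame [IsFractionRing θ.ring K] (hirr : f.IsIrreducible) (hn : 2 ≤ n) :
    Nonempty θ.Frame := by
  have hdeg := θ.natDegree_minpoly hirr hn
  have hli : LinearIndependent ℚ fun i : Fin n => θ.val ^ (i : ℕ) := by
    have := linearIndependent_pow (K := ℚ) θ.val
    rwa [hdeg] at this
  have hrank : Module.finrank ℚ K = n := by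
    rw [← hdeg, ← IntermediateField.adjoin.finrank (.of_finite ℚ θ.val), θ.adjoin_eq_top,
      IntermediateField.finrank_top']
  have : Nonempty (Fin n) := ⟨⟨0, by omega⟩⟩
  exact ⟨⟨basisOfLinearIndependentOfCardEqFinrank hli (by simp [hrank]), fun i => by simp,
    hirr.coef_zero_ne_zero hn⟩⟩

namespace Frame

variable {θ} (b : θ.Frame)

include b in
theorem intCast_coef_zero_ne_zero : (f.coef 0 : ℚ) ≠ 0 := mod_cast b.coef_zero_ne_zero

include b in
theorem finrank_eq : Module.finrank ℚ K = n := by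
  rw [Module.finrank_eq_card_basis b.basis, Fintype.card_fin]

include b in
theorem degree_pos : 0 < n := b.finrank_eq ▸ Module.finrank_pos

/-- The frame as a power basis with generator `θ`. -/
noncomputable def powerBasis : PowerBasis ℚ K where
  gen := θ.val
  dim := n
  basis := b.basis
  basis_eq_pow := b.basis_apply

include b in
theorem C_mul_minpoly : Polynomial.C (f.coef 0 : ℚ) * minpoly ℚ θ.val = f.dehomogenize := by
  have hdvd : minpoly ℚ θ.val ∣ f.dehomogenize := minpoly.dvd _ _ θ.aeval_dehomogenize
  have hdeg : (minpoly ℚ θ.val).natDegree = n := b.powerBasis.natDegree_minpoly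
  have hle := f.natDegree_dehomogenize_le
  have hcoeff := f.coeff_dehomogenize
  have hn : f.dehomogenize.natDegree = n := le_antisymm hle
    (Polynomial.le_natDegree_of_ne_zero (hcoeff ▸ b.intCast_coef_zero_ne_zero))
  rw [Polynomial.eq_leadingCoeff_mul_of_monic_of_dvd_of_natDegree_le
    (minpoly.monic (.of_finite ℚ θ.val)) hdvd (by omega), Polynomial.leadingCoeff, hn, hcoeff]

/-- The functional taking the coefficient of `ζ_{n-1}` in the basis `ζ₀, …, ζ_{n-1}`. -/
noncomputable def lead : K →ₗ[ℚ] ℚ :=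
  b.basis.constr ℚ fun i => if (i : ℕ) + 1 = n then (f.coef 0 : ℚ)⁻¹ else 0

theorem lead_pow {k : ℕ} (hk : k < n) :
    b.lead (θ.val ^ k) = if k + 1 = n then (f.coef 0 : ℚ)⁻¹ else 0 := by
  rw [← b.basis_apply ⟨k, hk⟩, lead, b.basis.constr_basis]

theorem lead_pow_of_succ_lt {k : ℕ} (hk : k + 1 < n) : b.lead (θ.val ^ k) = 0 := by
  rw [b.lead_pow (by omega), if_neg (by omega)]

theorem lead_intCast_mul (c : ℤ) (x : K) : b.lead (c * x) = c * b.lead x := by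
  rw [← zsmul_eq_mul, map_zsmul, zsmul_eq_mul]

theorem lead_zeta {k : ℕ} (hk : 0 < k) (hkn : k < n) :
    b.lead (θ.zeta k) = if k + 1 = n then 1 else 0 := by
  have hlower : ∀ i ≠ 0, b.lead (f.coef i * θ.val ^ (k - i)) = 0 := fun i hi => by
    rw [lead_intCast_mul, b.lead_pow_of_succ_lt (by omega), mul_zero]
  rw [θ.zeta_of_pos hk, map_sum, Finset.sum_eq_single_of_mem 0 (Finset.mem_range.2 hk)
    fun i _ => hlower i, lead_intCast_mul, Nat.sub_zero, b.lead_pow hkn, mul_ite, mul_zero,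
    mul_inv_cancel₀ b.intCast_coef_zero_ne_zero]

theorem lead_mul_zeta {k : ℕ} (hk : 0 < k) (hkn : k < n) (hn : 3 ≤ n) :
    b.lead (θ.val * θ.zeta k) = if k + 2 = n then 1 else 0 := by
  have hmul : θ.val * θ.zeta k = θ.zeta (k + 1) - f.coef k * θ.val ^ 1 := by
    rw [zeta_succ _ hk]; ring
  rw [hmul, map_sub, lead_intCast_mul, b.lead_pow_of_succ_lt (by omega), mul_zero, sub_zero]
  rcases Nat.lt_or_ge (k + 1) n with h | h
  · rw [b.lead_zeta (by omega) h]
  · have hconst : θ.zeta (k + 1) = ((-f.coef n : ℤ) : K) * θ.val ^ 0 := by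
      rw [show k + 1 = n by omega, zeta_n _ (by omega)]; simp
    rw [if_neg (by omega), hconst, lead_intCast_mul, b.lead_pow_of_succ_lt (by omega), mul_zero]

theorem eq_zero_of_forall_lead_mul {z : K} (h : ∀ y, b.lead (z * y) = 0) : z = 0 := by
  by_contra hz
  have hn := b.degree_pos
  have := h (z⁻¹ * θ.val ^ (n - 1))
  rw [mul_inv_cancel_left₀ hz, b.lead_pow (by omega), if_pos (by omega)] at this
  exact inv_ne_zero b.intCast_coef_zero_ne_zero this

theorem lead_sum_intCast_mul_pow (c : Fin (n - 2) → ℤ) :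
    b.lead (∑ k, (c k : K) * θ.val ^ (k : ℕ)) = 0 := by
  rw [map_sum]
  refine Finset.sum_eq_zero fun i _ => ?_
  rw [lead_intCast_mul, b.lead_pow_of_succ_lt (by omega), mul_zero]

theorem lead_val_mul_sum_intCast_mul_pow (c : Fin (n - 2) → ℤ) :
    b.lead (θ.val * ∑ k, (c k : K) * θ.val ^ (k : ℕ)) = 0 := by
  rw [Finset.mul_sum, map_sum]
  refine Finset.sum_eq_zero fun i _ => ?_
  rw [mul_left_comm, ← pow_succ', lead_intCast_mul, b.lead_pow_of_succ_lt (by omega), mul_zero]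

theorem lead_expansion (hn : 3 ≤ n) (c : Fin (n - 2) → ℤ) (u w : ℤ) :
    b.lead (θ.expansion c u w) = (-1) ^ ((n - 1) / 2) * w := by
  rw [expansion_eq, map_add, lead_sum_intCast_mul_pow, lead_intCast_mul, map_add,
    lead_intCast_mul, lead_intCast_mul, b.lead_zeta (by omega) (by omega),
    b.lead_zeta (by omega) (by omega), if_neg (by omega), if_pos (by omega)]
  push_cast
  ring

theorem lead_val_mul_expansion (hn : 3 ≤ n) (c : Fin (n - 2) → ℤ) (u w : ℤ) :
    b.lead (θ.val * θ.expansion c u w) = (-1) ^ ((n - 1) / 2) * u := by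
  rw [expansion_eq, mul_add, map_add, lead_val_mul_sum_intCast_mul_pow, mul_left_comm,
    lead_intCast_mul, mul_add, map_add, mul_left_comm, lead_intCast_mul, mul_left_comm,
    lead_intCast_mul, b.lead_mul_zeta (by omega) (by omega) hn,
    b.lead_mul_zeta (by omega) (by omega) hn, if_pos (by omega), if_neg (by omega)]
  push_cast
  ring

end Frame

end BinaryForm.Root

/-! ### The powers of `I_f` -/

theorem mul_mem_of_mem_span {R A : Type*} [CommSemiring R] [Semiring A] [Algebra R A] {s : Set A}
    {N : Submodule R A} {a x : A} (h : ∀ y ∈ s, a * y ∈ N) (hx : x ∈ Submodule.span R s) :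
    a * x ∈ N :=
  (Submodule.span_le (p := N.comap (LinearMap.mulLeft R a))).2 h hx

theorem intCast_mul_mem {A : Type*} [Ring A] (N : Submodule ℤ A) (c : ℤ) {x : A} (hx : x ∈ N) :
    (c : A) * x ∈ N :=
  zsmul_eq_mul x c ▸ N.smul_mem c hx

namespace BinaryForm.Root

variable {n : ℕ} {f : BinaryForm n} {K : Type*} [Field K]

section PowModule

variable (θ : f.Root K)

/-- The `i`-th element of the `ℤ`-basis `1, θ, …, θᵏ, ζ_{k+1}, …, ζ_{n-1}` of `I_fᵏ`, which for
`k = 0` is the basis `ζ₀, …, ζ_{n-1}` of `R_f`. -/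
def powZeta (k i : ℕ) : K := if i ≤ k then θ.val ^ i else θ.zeta i

theorem powZeta_of_le {k i : ℕ} (h : i ≤ k) : θ.powZeta k i = θ.val ^ i := if_pos h

theorem powZeta_of_lt {k i : ℕ} (h : k < i) : θ.powZeta k i = θ.zeta i := if_neg h.not_ge

theorem powZeta_zero (i : ℕ) : θ.powZeta 0 i = θ.zeta i := by
  rcases Nat.eq_zero_or_pos i with rfl | hi
  · rw [powZeta_of_le _ le_rfl, pow_zero, zeta_zero]
  · exact θ.powZeta_of_lt hi

/-- The lattice `⟨1, θ, …, θᵏ, ζ_{k+1}, …, ζ_{n-1}⟩` underlying `I_fᵏ`. -/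
def powModule (k : ℕ) : Submodule ℤ K :=
  Submodule.span ℤ (Set.range fun i : Fin n => θ.powZeta k i)

theorem powZeta_mem_powModule (k : ℕ) {i : ℕ} (hi : i < n) : θ.powZeta k i ∈ θ.powModule k :=
  Submodule.subset_span ⟨⟨i, hi⟩, rfl⟩

theorem powModule_le {k : ℕ} {N : Submodule ℤ K} (hpow : ∀ i ≤ k, i < n → θ.val ^ i ∈ N)
    (hzeta : ∀ i < n, k < i → θ.zeta i ∈ N) : θ.powModule k ≤ N := by
  rw [powModule, Submodule.span_le]
  rintro _ ⟨i, rfl⟩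
  rcases Nat.lt_or_ge k i with hi | hi
  · simpa only [powZeta_of_lt θ hi, SetLike.mem_coe] using hzeta i i.2 hi
  · simpa only [powZeta_of_le θ hi, SetLike.mem_coe] using hpow i hi i.2

theorem pow_mem_powModule {k i : ℕ} (hi : i ≤ k) (hin : i < n) : θ.val ^ i ∈ θ.powModule k :=
  θ.powZeta_of_le hi ▸ θ.powZeta_mem_powModule k hin

theorem one_mem_powModule (hn : 0 < n) (k : ℕ) : 1 ∈ θ.powModule k :=
  pow_zero θ.val ▸ θ.pow_mem_powModule k.zero_le hn

theorem zeta_mem_powModule (hn : 0 < n) (k i : ℕ) : θ.zeta i ∈ θ.powModule k := by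
  rcases lt_trichotomy i n with hi | rfl | hi
  · rcases Nat.lt_or_ge k i with hk | hk
    · exact θ.powZeta_of_lt hk ▸ θ.powZeta_mem_powModule k hi
    rcases Nat.eq_zero_or_pos i with rfl | hpos
    · exact θ.zeta_zero ▸ θ.one_mem_powModule hn k
    · rw [zeta_of_pos _ hpos]
      exact sum_mem fun j _ => intCast_mul_mem _ _ (θ.pow_mem_powModule (by omega) (by omega))
  · rw [zeta_n _ hn, ← Int.cast_neg, ← mul_one (Int.cast _)]
    exact intCast_mul_mem _ _ (θ.one_mem_powModule hn k)
  · exact zeta_gt θ hn hi ▸ zero_mem _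

theorem powModule_le_succ (hn : 0 < n) (k : ℕ) : θ.powModule k ≤ θ.powModule (k + 1) :=
  θ.powModule_le (fun _ hi hin => θ.pow_mem_powModule (by omega) hin)
    fun i _ _ => θ.zeta_mem_powModule hn _ i

theorem powModule_mono (hn : 0 < n) : Monotone θ.powModule :=
  monotone_nat_of_le_succ (θ.powModule_le_succ hn)

theorem val_mul_mem_powModule {k : ℕ} (hk : k + 1 < n) {x : K} (hx : x ∈ θ.powModule k) :
    θ.val * x ∈ θ.powModule (k + 1) := by
  refine θ.powModule_le (N := (θ.powModule (k + 1)).comap (LinearMap.mulLeft ℤ θ.val))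
    (fun i hi _ => ?_) (fun i _ hi => ?_) hx
  · rw [Submodule.mem_comap, LinearMap.mulLeft_apply, ← pow_succ']
    exact θ.pow_mem_powModule (by omega) (by omega)
  · have hmul : θ.val * θ.zeta i = θ.zeta (i + 1) - f.coef i * θ.val ^ 1 := by
      rw [zeta_succ _ (by omega)]; ring
    rw [Submodule.mem_comap, LinearMap.mulLeft_apply, hmul]
    exact sub_mem (θ.zeta_mem_powModule (by omega) _ _)
      (intCast_mul_mem _ _ (θ.pow_mem_powModule (by omega) (by omega)))

theorem ringModule_eq_powModule (hn : 0 < n) : θ.ringModule = θ.powModule 0 := by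
  apply le_antisymm
  · rw [ringModule, Submodule.span_le]
    rintro _ (rfl | ⟨k, _, rfl⟩)
    · exact θ.one_mem_powModule hn 0
    · exact θ.zeta_mem_powModule hn 0 k
  · refine θ.powModule_le (fun i hi _ => ?_) fun i _ _ => θ.zeta_mem_ringModule i
    rw [Nat.le_zero.1 hi, pow_zero]
    exact θ.one_mem_ringModule

theorem zeta_mul_pow_mem_powModule (i : ℕ) {j : ℕ} (hj : j < n) :
    θ.zeta i * θ.val ^ j ∈ θ.powModule j := by
  induction j with
  | zero => simpa using θ.zeta_mem_powModule hj 0 i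
  | succ j ih =>
    rw [pow_succ', mul_left_comm]
    exact θ.val_mul_mem_powModule hj (ih (by omega))

theorem zeta_mul_mem_powModule (hn : 0 < n) (i k : ℕ) {x : K} (hx : x ∈ θ.powModule k) :
    θ.zeta i * x ∈ θ.powModule k := by
  refine θ.powModule_le (N := (θ.powModule k).comap (LinearMap.mulLeft ℤ (θ.zeta i)))
    (fun j hj hjn => ?_) (fun j _ _ => ?_) hx
  · exact θ.powModule_mono hn hj (θ.zeta_mul_pow_mem_powModule i hjn)
  · exact θ.powModule_mono hn k.zero_le (θ.ringModule_eq_powModule hn ▸ θ.zeta_mul_zeta i j)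

theorem one_mem_idealModule : 1 ∈ θ.idealModule :=
  Submodule.subset_span (Set.mem_insert _ _)

theorem val_mem_idealModule : θ.val ∈ θ.idealModule :=
  Submodule.subset_span (Set.mem_insert_of_mem _ (Set.mem_insert _ _))

theorem powModule_succ {k : ℕ} (hk : k + 1 < n) :
    θ.powModule (k + 1) = θ.powModule k * θ.idealModule := by
  have hone := θ.one_mem_powModule (by omega) k
  apply le_antisymm
  · refine θ.powModule_le (fun i hi hin => ?_) fun i _ _ => ?_
    · cases i with
      | zero =>
        rw [pow_zero, ← mul_one (1 : K)]
        exact Submodule.mul_mem_mul hone θ.one_mem_idealModule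
      | succ i =>
        rw [pow_succ]
        exact Submodule.mul_mem_mul (θ.pow_mem_powModule (by omega) (by omega))
          θ.val_mem_idealModule
    · rw [← one_mul (θ.zeta i)]
      exact Submodule.mul_mem_mul hone (θ.zeta_mem_idealModule i)
  · refine Submodule.mul_le.2 fun x hx y hy => mul_mem_of_mem_span ?_ hy
    rintro _ (rfl | rfl | ⟨j, _, rfl⟩)
    · rw [mul_one]; exact θ.powModule_le_succ (by omega) k hx
    · rw [mul_comm]; exact θ.val_mul_mem_powModule hk hx
    · rw [mul_comm]
      exact θ.powModule_le_succ (by omega) k (θ.zeta_mul_mem_powModule (by omega) j k hx)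

end PowModule

section Ideal

variable (θ : f.Root K)

theorem restrictScalars_one :
    (1 : Submodule θ.ring K).restrictScalars ℤ = θ.ringModule := by
  ext x
  rw [Submodule.restrictScalars_mem, Submodule.mem_one]
  exact ⟨by rintro ⟨y, rfl⟩; exact y.2, fun h => ⟨⟨x, h⟩, rfl⟩⟩

variable [IsFractionRing θ.ring K]

theorem restrictScalars_ideal_pow {k : ℕ} (hk : k < n) :
    ((θ.ideal ^ k : FractionalIdeal θ.ring⁰ K) : Submodule θ.ring K).restrictScalars ℤ =
      θ.powModule k := by
  induction k with
  | zero =>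
    rw [pow_zero, FractionalIdeal.coe_one, restrictScalars_one, ringModule_eq_powModule _ hk]
  | succ k ih =>
    rw [pow_succ, FractionalIdeal.coe_mul, Submodule.restrictScalars_mul, ih (by omega),
      θ.powModule_succ hk]
    rfl

theorem mem_ideal_pow_iff {k : ℕ} (hk : k < n) {x : K} : x ∈ θ.ideal ^ k ↔ x ∈ θ.powModule k := by
  rw [← θ.restrictScalars_ideal_pow hk]
  rfl

end Ideal

section Inverse

variable (θ : f.Root K)

/-- The Horner expression `f₀ θᵏ + ⋯ + f_k`. The inverse of `I_f` is generated by those with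
`k < n`. -/
def horner (k : ℕ) : K := ∑ i ∈ Finset.range (k + 1), (f.coef i : K) * θ.val ^ (k - i)

theorem horner_zero : θ.horner 0 = f.coef 0 := by simp [horner]

theorem horner_of_pos {k : ℕ} (hk : 0 < k) : θ.horner k = θ.zeta k + f.coef k := by
  rw [horner, Finset.sum_range_succ, zeta_of_pos _ hk, Nat.sub_self, pow_zero, mul_one]

theorem val_mul_horner (k : ℕ) : θ.val * θ.horner k = θ.zeta (k + 1) := by
  rcases Nat.eq_zero_or_pos k with rfl | hk
  · rw [horner_zero, zeta_one, mul_comm]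
  · rw [horner_of_pos _ hk, zeta_succ _ hk]; ring

theorem intCast_mem_ringModule (c : ℤ) : (c : K) ∈ θ.ringModule :=
  mul_one (c : K) ▸ intCast_mul_mem _ c θ.one_mem_ringModule

theorem horner_mem_ringModule (k : ℕ) : θ.horner k ∈ θ.ringModule := by
  rcases Nat.eq_zero_or_pos k with rfl | hk
  · exact θ.horner_zero ▸ θ.intCast_mem_ringModule _
  · exact θ.horner_of_pos hk ▸ add_mem (θ.zeta_mem_ringModule k) (θ.intCast_mem_ringModule _)

theorem mul_horner_mem_ringModule (k : ℕ) {x : K} (hx : x ∈ θ.idealModule) :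
    x * θ.horner k ∈ θ.ringModule := by
  rw [mul_comm]
  refine mul_mem_of_mem_span ?_ hx
  rintro _ (rfl | rfl | ⟨j, _, rfl⟩)
  · rw [mul_one]; exact θ.horner_mem_ringModule k
  · rw [mul_comm, val_mul_horner]; exact θ.zeta_mem_ringModule _
  · exact θ.ring.mul_mem (θ.horner_mem_ringModule k) (θ.zeta_mem_ringModule j)

variable [IsFractionRing θ.ring K]

/-- The fractional ideal generated by the Horner expressions, which is the inverse of `I_f` when
`f` is primitive. -/
noncomputable def inverseIdeal : FractionalIdeal θ.ring⁰ K :=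
  FractionalIdeal.spanFinset θ.ring (Finset.range n) θ.horner

theorem horner_mem_inverseIdeal {k : ℕ} (hk : k < n) : θ.horner k ∈ θ.inverseIdeal :=
  Submodule.subset_span ⟨k, by simpa using hk, rfl⟩

theorem ideal_mul_inverseIdeal_le_one : θ.ideal * θ.inverseIdeal ≤ 1 := by
  rw [FractionalIdeal.mul_le]
  intro x hx y hy
  refine mul_mem_of_mem_span (N := ((1 : FractionalIdeal θ.ring⁰ K) : Submodule θ.ring K)) ?_ hy
  rintro _ ⟨k, _, rfl⟩
  rw [FractionalIdeal.coe_one]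
  exact θ.restrictScalars_one.ge (θ.mul_horner_mem_ringModule k hx)

theorem coef_mem_ideal_mul_inverseIdeal {k : ℕ} (hk : k ≤ n) (hn : 0 < n) :
    (f.coef k : K) ∈
      ((θ.ideal * θ.inverseIdeal : FractionalIdeal θ.ring⁰ K) : Submodule θ.ring K) := by
  set P := ((θ.ideal * θ.inverseIdeal : FractionalIdeal θ.ring⁰ K) : Submodule θ.ring K)
  have horner_mem : ∀ k < n, θ.horner k ∈ P := fun k hk =>
    one_mul (θ.horner k) ▸
      FractionalIdeal.mul_mem_mul θ.one_mem_idealModule (θ.horner_mem_inverseIdeal hk)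
  have zeta_mem : ∀ k < n, θ.zeta (k + 1) ∈ P := fun k hk =>
    θ.val_mul_horner k ▸
      FractionalIdeal.mul_mem_mul θ.val_mem_idealModule (θ.horner_mem_inverseIdeal hk)
  cases k with
  | zero => exact θ.horner_zero ▸ horner_mem 0 hn
  | succ k =>
    rcases hk.eq_or_lt with rfl | hk
    · exact neg_mem_iff.1 (θ.zeta_n hn ▸ zeta_mem k (by omega))
    · have := sub_mem (horner_mem _ hk) (zeta_mem k (by omega))
      rwa [θ.horner_of_pos k.succ_pos, add_sub_cancel_left] at this

theorem ideal_mul_inverseIdeal (hn : 0 < n) (hprim : f.IsPrimitive) :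
    θ.ideal * θ.inverseIdeal = 1 := by
  refine le_antisymm θ.ideal_mul_inverseIdeal_le_one (FractionalIdeal.one_le.2 ?_)
  obtain ⟨g, hg⟩ := Finset.gcd_eq_sum_mul (Finset.univ : Finset (Fin (n + 1))) f
  have hone : (1 : K) = ∑ i : Fin (n + 1), g i • (f.coef i : K) := by
    rw [← Int.cast_one, ← show Finset.univ.gcd f = 1 from hprim, hg, Int.cast_sum]
    refine Finset.sum_congr rfl fun i _ => ?_
    rw [BinaryForm.coef, dif_pos i.2, zsmul_eq_mul, Int.cast_mul, mul_comm]
  rw [hone]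
  exact Submodule.sum_mem _ fun i _ =>
    zsmul_mem (θ.coef_mem_ideal_mul_inverseIdeal (Nat.lt_succ_iff.1 i.2) hn) (g i)

theorem isUnit_ideal (hn : 0 < n) (hprim : f.IsPrimitive) : IsUnit θ.ideal :=
  .of_mul_eq_one _ (θ.ideal_mul_inverseIdeal hn hprim)

end Inverse

end BinaryForm.Root

namespace BinaryForm.Root.Frame

variable {n : ℕ} {f : BinaryForm n} {K : Type*} [Field K] [NumberField K] {θ : f.Root K}
  (b : θ.Frame)

theorem repr_pow {k : ℕ} (hk : k < n) (j : Fin n) :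
    b.basis.repr (θ.val ^ k) j = if (j : ℕ) = k then 1 else 0 := by
  rw [← b.basis_apply ⟨k, hk⟩, Module.Basis.repr_self, Finsupp.single_apply]
  simp only [Fin.ext_iff, eq_comm]

theorem repr_zeta {k : ℕ} (hk : 0 < k) (hkn : k < n) {j : Fin n} (hj : k ≤ j) :
    b.basis.repr (θ.zeta k) j = if (j : ℕ) = k then (f.coef 0 : ℚ) else 0 := by
  have repr_mul : ∀ (c : ℤ) (x : K), b.basis.repr (c * x) j = c * b.basis.repr x j := fun c x => by
    rw [← zsmul_eq_mul, map_zsmul, Finsupp.smul_apply, zsmul_eq_mul]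
  have hlower : ∀ i ≠ 0, b.basis.repr (f.coef i * θ.val ^ (k - i)) j = 0 := fun i hi => by
    rw [repr_mul, b.repr_pow (by omega), if_neg (by omega), mul_zero]
  rw [θ.zeta_of_pos hk, map_sum, Finsupp.finsetSum_apply, Finset.sum_eq_single_of_mem 0
    (Finset.mem_range.2 hk) fun i _ => hlower i, repr_mul, Nat.sub_zero, b.repr_pow hkn, mul_ite,
    mul_one, mul_zero]

theorem repr_powZeta {k i : ℕ} (hi : i < n) {j : Fin n} (hj : i ≤ j) :
    b.basis.repr (θ.powZeta k i) j =
      if (j : ℕ) = i then (if i < k + 1 then 1 else (f.coef 0 : ℚ)) else 0 := by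
  by_cases h : i < k + 1
  · rw [powZeta_of_le θ (by omega), b.repr_pow hi, if_pos h]
  · rw [powZeta_of_lt θ (by omega), b.repr_zeta (by omega) hi hj, if_neg h]

theorem det_powZeta (k : ℕ) :
    b.basis.det (fun i : Fin n => θ.powZeta k i) = (f.coef 0 : ℚ) ^ (n - (k + 1)) := by
  rw [Module.Basis.det_apply, Matrix.det_of_isUpperTriangular fun i j (hij : j < i) => by
    rw [Module.Basis.toMatrix_apply, b.repr_powZeta j.2 hij.le, if_neg (Fin.val_ne_of_ne hij.ne')]]
  simp only [Module.Basis.toMatrix_apply, b.repr_powZeta (Fin.is_lt _) le_rfl, if_true]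
  rw [Fin.prod_univ_eq_prod_range (fun i => if i < k + 1 then (1 : ℚ) else f.coef 0) n,
    Finset.prod_ite, Finset.prod_const_one, one_mul, Finset.prod_const]
  congr 1
  rw [show {i ∈ Finset.range n | ¬ i < k + 1} = Finset.Ico (k + 1) n by
    ext i; simp only [Finset.mem_filter, Finset.mem_range, Finset.mem_Ico]; omega, Nat.card_Ico]

/-- The rational basis `1, θ, …, θᵏ, ζ_{k+1}, …, ζ_{n-1}`. -/
noncomputable def powBasis (k : ℕ) : Module.Basis (Fin n) ℚ K :=
  basisOfDetNeZero b.basis (fun i => θ.powZeta k i)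
    (b.det_powZeta k ▸ pow_ne_zero _ b.intCast_coef_zero_ne_zero)

theorem coe_powBasis (k : ℕ) :
    (b.powBasis k : Fin n → K) = fun i : Fin n => θ.powZeta k i :=
  coe_basisOfDetNeZero _ _ _

/-- The rational basis `ζ₀, …, ζ_{n-1}`. -/
noncomputable def zetaBasis : Module.Basis (Fin n) ℚ K := b.powBasis 0

theorem zetaBasis_apply (i : Fin n) : b.zetaBasis i = θ.zeta i := by
  rw [zetaBasis, coe_powBasis]
  exact θ.powZeta_zero i

theorem det_basis_zetaBasis : b.basis.det b.zetaBasis = (f.coef 0 : ℚ) ^ (n - 1) := by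
  rw [zetaBasis, coe_powBasis, b.det_powZeta 0]

theorem det_zetaBasis_powBasis {k : ℕ} (hk : k < n) :
    b.zetaBasis.det (b.powBasis k) = ((f.coef 0 : ℚ) ^ k)⁻¹ := by
  have hdet := Module.Basis.det_mul_det b.basis b.zetaBasis (b.powBasis k)
  have hexp : n - 1 = n - (k + 1) + k := by omega
  rw [det_basis_zetaBasis, coe_powBasis, b.det_powZeta k, hexp, pow_add] at hdet
  rw [coe_powBasis, ← mul_eq_one_iff_eq_inv₀ (pow_ne_zero _ b.intCast_coef_zero_ne_zero)]
  apply mul_left_cancel₀ (pow_ne_zero (n - (k + 1)) b.intCast_coef_zero_ne_zero)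
  linear_combination hdet

variable [IsFractionRing θ.ring K]

theorem toLattice_ideal_pow {k : ℕ} (hk : k < n) :
    toLattice (θ.ideal ^ k) = AddSubgroup.closure (Set.range (b.powBasis k)) := by
  rw [← Submodule.span_int_eq_addSubgroupClosure, coe_powBasis]
  ext x
  exact θ.mem_ideal_pow_iff hk

theorem toLattice_one : toLattice (1 : FractionalIdeal θ.ring⁰ K) =
    AddSubgroup.closure (Set.range b.zetaBasis) :=
  pow_zero θ.ideal ▸ b.toLattice_ideal_pow b.degree_pos

include b in
theorem latticeNorm_ideal_pow {k : ℕ} (hk : k < n) (heven : Even k) :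
    latticeNorm (θ.ideal ^ k) = ((f.coef 0 : ℚ) ^ k)⁻¹ := by
  rw [latticeNorm_eq_abs_det b.toLattice_one (b.toLattice_ideal_pow hk),
    b.det_zetaBasis_powBasis hk, abs_of_nonneg (inv_nonneg.2 (heven.pow_nonneg _))]

end BinaryForm.Root.Frame

/-! ### Gram matrices and orbits -/

theorem sign_revPerm (n : ℕ) :
    Equiv.Perm.sign (Fin.revPerm : Equiv.Perm (Fin n)) = (-1) ^ (n * (n - 1) / 2) := by
  have inversions (j : Fin n) : ∏ i ∈ Finset.Iio j,
      (if (Fin.revPerm i : Fin n) < Fin.revPerm j then (1 : ℤˣ) else -1) = (-1) ^ (j : ℕ) := by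
    rw [Finset.prod_congr rfl fun i hi => if_neg ?_, Finset.prod_const, Fin.card_Iio]
    simpa using (Finset.mem_Iio.1 hi).le
  rw [Equiv.Perm.sign_eq_prod_prod_Iio, Finset.prod_congr rfl fun j _ => inversions j,
    Fin.prod_univ_eq_prod_range (fun j => (-1 : ℤˣ) ^ j), Finset.prod_pow_eq_pow_sum,
    Finset.sum_range_id]

namespace BinaryForm.Root.Frame

variable {n : ℕ} {f : BinaryForm n} {K : Type*} [Field K] [NumberField K] {θ : f.Root K}
  (b : θ.Frame)

/-- The bilinear form `(x, y) ↦ λ(z x y)` on `K`, where `λ` is the functional `lead`. -/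
noncomputable def form (z : K) : LinearMap.BilinForm ℚ K :=
  (LinearMap.mul ℚ K).compr₂ (b.lead ∘ₗ LinearMap.mulLeft ℚ z)

theorem form_apply (z x y : K) : b.form z x y = b.lead (z * (x * y)) := rfl

theorem form_mul (w z x y : K) : b.form (w * z) x y = b.form z (w * x) y := by
  rw [form_apply, form_apply]; congr 1; ring

theorem form_eq_compLeft_lmul (z : K) : b.form z = (b.form 1).compLeft (Algebra.lmul ℚ K z) :=
  LinearMap.ext₂ fun x y => by rw [← mul_one z, form_mul, mul_one]; rfl

theorem form_comm (z x y : K) : b.form z x y = b.form z y x := by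
  rw [form_apply, form_apply, mul_comm x y]

theorem eq_zero_of_forall_form {z x : K} (hz : z ≠ 0) (h : ∀ y, b.form z x y = 0) : x = 0 :=
  (mul_eq_zero.1 (b.eq_zero_of_forall_lead_mul fun y => by
    rw [mul_assoc]; exact h y)).resolve_left hz

theorem form_nondegenerate {z : K} (hz : z ≠ 0) : (b.form z).Nondegenerate :=
  ⟨fun _ h => b.eq_zero_of_forall_form hz h,
    fun y h => b.eq_zero_of_forall_form hz fun x => (b.form_comm z y x).trans (h x)⟩

theorem toMatrix_form_one_apply (i j : Fin n) :
    (b.form 1).toMatrix b.basis i j = b.lead (θ.val ^ (i + j : ℕ)) := by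
  rw [LinearMap.BilinForm.toMatrix_apply, form_apply, b.basis_apply, b.basis_apply, one_mul,
    pow_add]

/-- Reversing the order of the columns makes this Gram matrix triangular. -/
theorem det_toMatrix_form_one : ((b.form 1).toMatrix b.basis).det =
    (-1) ^ (n * (n - 1) / 2) * ((f.coef 0 : ℚ) ^ n)⁻¹ := by
  set H : Matrix (Fin n) (Fin n) ℚ := (b.form 1).toMatrix b.basis with hH
  have entry (i j : Fin n) : H.submatrix id (Fin.revPerm : Equiv.Perm (Fin n)) i j =
      b.lead (θ.val ^ (i + (n - (j + 1)) : ℕ)) := by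
    rw [Matrix.submatrix_apply, hH, toMatrix_form_one_apply, Fin.revPerm_apply, Fin.val_rev, id]
  have hdet : (H.submatrix id (Fin.revPerm : Equiv.Perm (Fin n))).det = (f.coef 0 : ℚ)⁻¹ ^ n := by
    rw [Matrix.det_of_isLowerTriangular _ fun i j hij => ?_, Finset.prod_congr rfl fun i _ => ?_,
      Finset.prod_const, Finset.card_univ, Fintype.card_fin]
    · rw [entry, b.lead_pow (by omega), if_pos (by omega)]
    · have hij : (i : ℕ) < j := hij
      rw [entry, b.lead_pow_of_succ_lt (by omega)]
  rw [Matrix.det_permute', sign_revPerm] at hdet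
  push_cast at hdet
  rw [← inv_pow, ← hdet, ← mul_assoc, ← mul_pow, neg_one_mul, neg_neg, one_pow, one_mul]

theorem det_toMatrix_form (hn : 2 ≤ n) (z : K) (v : Module.Basis (Fin n) ℚ K) :
    ((b.form z).toMatrix v).det = (-1) ^ (n * (n - 1) / 2) * (f.coef 0 : ℚ) ^ (n - 2) *
      Algebra.norm ℚ z * b.zetaBasis.det v ^ 2 := by
  have hbasis : b.basis.det v = (f.coef 0 : ℚ) ^ (n - 2 + 1) * b.zetaBasis.det v := by
    rw [← Module.Basis.det_mul_det b.basis b.zetaBasis v, det_basis_zetaBasis,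
      show n - 1 = n - 2 + 1 by omega]
  have hpow : (f.coef 0 : ℚ) ^ n = (f.coef 0 : ℚ) ^ (n - 2 + 2) := by
    rw [Nat.sub_add_cancel hn]
  have hne := b.intCast_coef_zero_ne_zero
  rw [← LinearMap.BilinForm.toMatrix_mul_basis_toMatrix b.basis v, Matrix.det_mul, Matrix.det_mul,
    Matrix.det_transpose, ← Module.Basis.det_apply, hbasis, form_eq_compLeft_lmul,
    LinearMap.BilinForm.toMatrix_compLeft, Matrix.det_mul, Matrix.det_transpose,
    LinearMap.det_toMatrix, ← Algebra.norm_apply, b.det_toMatrix_form_one, hpow]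
  field_simp
  ring

include b in
theorem norm_algebraMap_sub (r : ℚ) :
    Algebra.norm ℚ (algebraMap ℚ K r - θ.val) = (minpoly ℚ θ.val).eval r := by
  have hchar := charpoly_leftMulMatrix b.powerBasis
  rw [show θ.val = b.powerBasis.gen from rfl, ← hchar, Matrix.eval_charpoly,
    Algebra.norm_eq_matrix_det b.powerBasis.basis, map_sub, AlgHom.commutes]
  rfl

include b in
theorem coef_zero_mul_norm_intCast_sub (x y : ℤ) :
    (f.coef 0 : ℚ) * Algebra.norm ℚ ((x : K) - y * θ.val) =
      (MvPolynomial.eval ![x, y] f.poly : ℤ) := by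
  rw [BinaryForm.eval_poly]
  rcases eq_or_ne y 0 with rfl | hy
  · have hx : (x : K) - ((0 : ℤ) : K) * θ.val = algebraMap ℚ K x := by simp
    rw [hx, Algebra.norm_algebraMap, b.finrank_eq, Fin.sum_univ_succ]
    simp [BinaryForm.coef]
  · have hy : (y : ℚ) ≠ 0 := mod_cast hy
    have hxy : (x : K) - y * θ.val = algebraMap ℚ K y * (algebraMap ℚ K (x / y) - θ.val) := by
      rw [mul_sub, ← map_mul, mul_div_cancel₀ _ hy, map_intCast, map_intCast]
    have heval := congrArg (Polynomial.eval ((x : ℚ) / y)) b.C_mul_minpoly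
    rw [Polynomial.eval_mul, Polynomial.eval_C] at heval
    rw [hxy, map_mul, b.norm_algebraMap_sub, Algebra.norm_algebraMap, b.finrank_eq, mul_left_comm,
      heval, BinaryForm.dehomogenize, Polynomial.eval_finsetSum, Finset.mul_sum, Int.cast_sum]
    refine Finset.sum_congr rfl fun i _ => ?_
    have hpow : (y : ℚ) ^ n = y ^ (n - (i : ℕ)) * y ^ (i : ℕ) := by
      rw [← pow_add]; congr 1; omega
    simp only [Polynomial.eval_mul, Polynomial.eval_C, Polynomial.eval_pow, Polynomial.eval_X]
    push_cast
    rw [hpow, div_pow]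
    field_simp

end BinaryForm.Root.Frame

namespace BinaryForm.Root

section Expansion

variable {n : ℕ} {f : BinaryForm n} {K : Type*} [Field K] {θ : f.Root K}

theorem exists_eq_expansion_of_mem_powModule (hn : 3 ≤ n) {x : K} (hx : x ∈ θ.powModule (n - 3)) :
    ∃ c u w, x = θ.expansion c u w := by
  obtain ⟨m, rfl⟩ := Nat.exists_eq_add_of_le' hn
  obtain ⟨c, rfl⟩ := (Submodule.mem_span_range_iff_exists_fun ℤ).1 hx
  have hsign : (-1 : K) ^ ((m + 2) / 2) * (-1) ^ ((m + 2) / 2) = 1 := by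
    rw [← mul_pow]; simp
  refine ⟨fun k => c (Fin.castSucc (Fin.castSucc k)),
    (-1) ^ ((m + 2) / 2) * c (Fin.castSucc (Fin.last (m + 1))),
    (-1) ^ ((m + 2) / 2) * c (Fin.last (m + 2)), ?_⟩
  have hpow (k : Fin (m + 1)) : θ.powZeta m k = θ.val ^ (k : ℕ) := θ.powZeta_of_le (by omega)
  rw [expansion, Fin.sum_univ_castSucc, Fin.sum_univ_castSucc]
  change _ = ∑ k : Fin (m + 1), ((c k.castSucc.castSucc : ℤ) : K) * θ.val ^ (k : ℕ) + _
  simp only [Nat.add_sub_cancel, Fin.val_castSucc,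
    Fin.val_last, hpow, zsmul_eq_mul, show m + 3 - 2 = m + 1 from rfl,
    show m + 3 - 1 = m + 2 from rfl,
    θ.powZeta_of_lt (show m < m + 1 by omega), θ.powZeta_of_lt (show m < m + 2 by omega),
    Int.cast_mul, Int.cast_pow, Int.cast_neg, Int.cast_one]
  linear_combination (-(c (Fin.castSucc (Fin.last (m + 1))) * θ.zeta (m + 1)) -
    c (Fin.last (m + 2)) * θ.zeta (m + 2)) * hsign

theorem exists_eq_mul_expansion [IsFractionRing θ.ring K] (hn : 3 ≤ n) {δ x : K}
    (hx : x ∈ FractionalIdeal.spanSingleton θ.ring⁰ δ * θ.ideal ^ (n - 3)) :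
    ∃ c u w, x = δ * θ.expansion c u w := by
  obtain ⟨y, hy, rfl⟩ := FractionalIdeal.mem_singleton_mul.1 hx
  obtain ⟨c, u, w, rfl⟩ :=
    exists_eq_expansion_of_mem_powModule hn ((θ.mem_ideal_pow_iff (by omega)).1 hy)
  exact ⟨c, u, w, rfl⟩

end Expansion

namespace Frame

variable {n : ℕ} {f : BinaryForm n} {K : Type*} [Field K] [NumberField K] {θ : f.Root K}
  (b : θ.Frame)

theorem intCast_eq_of_eq_mul_expansion (hn : 3 ≤ n) {δ : Kˣ} {x : K} {c : Fin (n - 2) → ℤ}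
    {u w : ℤ} (hx : x = δ * θ.expansion c u w) :
    (w : ℚ) = (-1) ^ ((n - 1) / 2) * b.lead ((δ : K)⁻¹ * x) ∧
      (u : ℚ) = (-1) ^ ((n - 1) / 2) * b.lead (θ.val * (δ : K)⁻¹ * x) := by
  rw [hx, mul_assoc, inv_mul_cancel_left₀ δ.ne_zero, b.lead_expansion hn,
    b.lead_val_mul_expansion hn, ← mul_assoc, ← mul_assoc, ← mul_pow, neg_one_mul, neg_neg,
    one_pow, one_mul, one_mul]
  exact ⟨rfl, rfl⟩

theorem map_intCast_eq_smul_toMatrix_form {A : Matrix (Fin n) (Fin n) ℤ} {c : ℚ} {z : K}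
    {α : Module.Basis (Fin n) ℚ K} :
    A.map (Int.cast : ℤ → ℚ) = c • LinearMap.BilinForm.toMatrix α (b.form z) ↔
      ∀ i j, (A i j : ℚ) = c * b.lead (z * (α i * α j)) := by
  simp only [← Matrix.ext_iff, Matrix.map_apply, Matrix.smul_apply, smul_eq_mul,
    LinearMap.BilinForm.toMatrix_apply, form_apply]

theorem toMatrix_form_scaledBasis (z : K) (δ κ : Kˣ) (α : Module.Basis (Fin n) ℚ K) :
    LinearMap.BilinForm.toMatrix (scaledBasis κ α) (b.form (z * ((κ ^ 2 * δ : Kˣ) : K)⁻¹)) =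
      LinearMap.BilinForm.toMatrix α (b.form (z * (δ : K)⁻¹)) := by
  ext i j
  rw [LinearMap.BilinForm.toMatrix_apply, LinearMap.BilinForm.toMatrix_apply, form_apply,
    form_apply, scaledBasis_apply, scaledBasis_apply]
  congr 1
  have hκ := κ.ne_zero
  have hδ := δ.ne_zero
  push_cast
  field_simp

theorem equiv_val_mul_of_toMatrix_form_eq
    {α α' : Module.Basis (Fin n) ℚ K} {z z' : K} (hz' : z' ≠ 0)
    (h : LinearMap.BilinForm.toMatrix α (b.form z) = LinearMap.BilinForm.toMatrix α' (b.form z'))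
    (hθ : LinearMap.BilinForm.toMatrix α (b.form (θ.val * z)) =
      LinearMap.BilinForm.toMatrix α' (b.form (θ.val * z'))) (x : K) :
    α.equiv α' (Equiv.refl _) (θ.val * x) = θ.val * α.equiv α' (Equiv.refl _) x := by
  set g := α.equiv α' (Equiv.refl _)
  refine sub_eq_zero.1 (b.eq_zero_of_forall_form hz' fun y => ?_)
  obtain ⟨y, rfl⟩ := g.surjective y
  rw [map_sub, LinearMap.sub_apply, bilinForm_equiv_apply_of_toMatrix_eq h, ← form_mul, ← form_mul,
    bilinForm_equiv_apply_of_toMatrix_eq hθ, sub_self]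

include b in
theorem eq_map_one_mul_of_map_val_mul {g : K →ₗ[ℚ] K} (h : ∀ x, g (θ.val * x) = θ.val * g x)
    (x : K) : g x = g 1 * x := by
  suffices g = LinearMap.mulLeft ℚ (g 1) from LinearMap.congr_fun this x
  refine b.basis.ext fun i => ?_
  rw [b.basis_apply, LinearMap.mulLeft_apply]
  induction (i : ℕ) with
  | zero => rw [pow_zero, mul_one]
  | succ k ih => rw [pow_succ', h, ih, mul_left_comm]

theorem exists_scaledBasis_eq_of_toMatrix_form_eq {α α' : Module.Basis (Fin n) ℚ K} {δ δ' : Kˣ}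
    (h : LinearMap.BilinForm.toMatrix α (b.form (δ : K)⁻¹) =
      LinearMap.BilinForm.toMatrix α' (b.form (δ' : K)⁻¹))
    (hθ : LinearMap.BilinForm.toMatrix α (b.form (θ.val * (δ : K)⁻¹)) =
      LinearMap.BilinForm.toMatrix α' (b.form (θ.val * (δ' : K)⁻¹))) :
    ∃ κ : Kˣ, α' = scaledBasis κ α ∧ δ' = κ ^ 2 * δ := by
  let g := α.equiv α' (Equiv.refl _)
  have hg (x : K) : g x = g 1 * x := b.eq_map_one_mul_of_map_val_mul (g := g)
    (b.equiv_val_mul_of_toMatrix_form_eq (inv_ne_zero δ'.ne_zero) h hθ) x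
  have hκ : g 1 ≠ 0 := g.map_ne_zero_iff.2 one_ne_zero
  refine ⟨Units.mk0 (g 1) hκ, Module.Basis.eq_of_apply_eq fun i => ?_, Units.ext ?_⟩
  · rw [scaledBasis_apply, Units.val_mk0, ← hg, α.equiv_apply, Equiv.refl_apply]
  have hforms : (δ' : K)⁻¹ * (g 1 * g 1) - (δ : K)⁻¹ = 0 := by
    refine b.eq_zero_of_forall_lead_mul fun y => ?_
    have hy := bilinForm_equiv_apply_of_toMatrix_eq h 1 y
    rw [form_apply, form_apply, one_mul, show α.equiv α' (Equiv.refl _) y = g 1 * y from hg y,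
      ← mul_assoc (α.equiv α' (Equiv.refl _) 1)] at hy
    rw [sub_mul, map_sub, mul_assoc, sub_eq_zero]
    exact hy
  have hδ := δ.ne_zero
  have hδ' := δ'.ne_zero
  rw [Units.val_mul, Units.val_pow_eq_pow_val, Units.val_mk0]
  field_simp at hforms
  linear_combination -hforms

/-- `(A, B)` consists of the Gram matrices, with respect to the oriented basis `α` of `I`, of the
forms `λ(x y / δ)` and `λ(θ x y / δ)` up to the sign `(-1)^((n-1)/2)`. -/
structure IsGram (v : f.FormPair) (I : FractionalIdeal θ.ring⁰ K) (δ : Kˣ)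
    (α : Module.Basis (Fin n) ℚ K) : Prop where
  toLattice_eq : toLattice I = AddSubgroup.closure (Set.range α)
  det_pos : 0 < b.zetaBasis.det α
  map_A : v.A.map (Int.cast : ℤ → ℚ) =
    ((-1) ^ ((n - 1) / 2) : ℚ) • LinearMap.BilinForm.toMatrix α (b.form (δ : K)⁻¹)
  map_B : v.B.map (Int.cast : ℤ → ℚ) =
    ((-1) ^ ((n - 1) / 2) : ℚ) • LinearMap.BilinForm.toMatrix α (b.form (θ.val * (δ : K)⁻¹))

section IsGram

variable {b} {v v' : f.FormPair} {I I' : FractionalIdeal θ.ring⁰ K} {δ δ' : Kˣ}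
  {α α' : Module.Basis (Fin n) ℚ K}

theorem IsGram.orbit_eq (h : b.IsGram v I δ α) (h' : b.IsGram v' I δ α') :
    v.orbit = v'.orbit := by
  have hdet : 0 < α.det α' := by
    have hmul := b.zetaBasis.det_mul_det α α'
    exact pos_of_mul_pos_right (hmul ▸ h'.det_pos) h.det_pos.le
  obtain ⟨g, hg⟩ := exists_specialLinearGroup_of_closure_range_eq α α'
    (h.toLattice_eq.symm.trans h'.toLattice_eq) hdet
  refine (Quotient.sound ⟨g, FormPair.ext ?_ ?_⟩ : v'.orbit = v.orbit).symm
  · exact Matrix.map_injective Int.cast_injective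
      ((map_mul_mul_transpose_eq_smul_toMatrix hg h.map_A).trans h'.map_A.symm)
  · exact Matrix.map_injective Int.cast_injective
      ((map_mul_mul_transpose_eq_smul_toMatrix hg h.map_B).trans h'.map_B.symm)

theorem IsGram.smul (h : b.IsGram v I δ α) (g : Matrix.SpecialLinearGroup (Fin n) ℤ) :
    ∃ α', b.IsGram (g • v) I δ α' := by
  obtain ⟨α', hg⟩ := exists_basis_eq_sum α g
  refine ⟨α', by rw [h.toLattice_eq, closure_range_eq_of_eq_sum α α' g hg], ?_,
    map_mul_mul_transpose_eq_smul_toMatrix hg h.map_A,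
    map_mul_mul_transpose_eq_smul_toMatrix hg h.map_B⟩
  rw [← b.zetaBasis.det_mul_det α α', det_eq_intCast_of_eq_sum α hg, g.2, Int.cast_one, mul_one]
  exact h.det_pos

variable [IsFractionRing θ.ring K]

theorem IsGram.scale_of_norm_pos (h : b.IsGram v I δ α) {κ : Kˣ} (hκ : 0 < Algebra.norm ℚ (κ : K)) :
    b.IsGram v (FractionalIdeal.spanSingleton θ.ring⁰ (κ : K) * I) (κ ^ 2 * δ)
      (scaledBasis κ α) where
  toLattice_eq := toLattice_spanSingleton_mul_eq_closure h.toLattice_eq κ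
  det_pos := by rw [det_scaledBasis]; exact mul_pos hκ h.det_pos
  map_A := by
    rw [h.map_A, ← one_mul (δ : K)⁻¹, ← b.toMatrix_form_scaledBasis 1 δ κ, one_mul]
  map_B := by rw [h.map_B, toMatrix_form_scaledBasis]

/-- One of `κ` and `-κ` has positive norm, and both scale `(I, δ)` in the same way. -/
theorem IsGram.scale (hodd : Odd n) (h : b.IsGram v I δ α) (κ : Kˣ) :
    ∃ α', b.IsGram v (FractionalIdeal.spanSingleton θ.ring⁰ (κ : K) * I) (κ ^ 2 * δ) α' := by
  rcases (Algebra.norm_ne_zero_iff.2 κ.ne_zero).lt_or_gt (a := Algebra.norm ℚ (κ : K)) with hκ | hκ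
  · have hneg : 0 < Algebra.norm ℚ ((-κ : Kˣ) : K) := by
      rw [Units.val_neg, norm_neg_of_odd_finrank (by rwa [b.finrank_eq])]
      exact neg_pos.2 hκ
    refine ⟨scaledBasis (-κ) α, ?_⟩
    rw [← neg_sq κ, ← coe_toPrincipalIdeal, ← toPrincipalIdeal_neg, coe_toPrincipalIdeal]
    exact h.scale_of_norm_pos hneg
  · exact ⟨scaledBasis κ α, h.scale_of_norm_pos hκ⟩

theorem IsGram.unique (h : b.IsGram v I δ α) (h' : b.IsGram v I' δ' α') :
    ∃ κ : Kˣ, I' = FractionalIdeal.spanSingleton θ.ring⁰ (κ : K) * I ∧ δ' = κ ^ 2 * δ := by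
  have cancel {M M' : Matrix (Fin n) (Fin n) ℚ}
      (hM : ((-1) ^ ((n - 1) / 2) : ℚ) • M = ((-1) ^ ((n - 1) / 2) : ℚ) • M') : M = M' :=
    smul_right_injective _ (pow_ne_zero _ (neg_ne_zero.2 one_ne_zero)) hM
  obtain ⟨κ, rfl, hδ⟩ := b.exists_scaledBasis_eq_of_toMatrix_form_eq
    (cancel (h.map_A.symm.trans h'.map_A)) (cancel (h.map_B.symm.trans h'.map_B))
  refine ⟨κ, toLattice_injective ?_, hδ⟩
  rw [h'.toLattice_eq, toLattice_spanSingleton_mul_eq_closure h.toLattice_eq]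

end IsGram

variable [IsFractionRing θ.ring K]

include b in
theorem exists_basis_toLattice_eq_of_det_pos {I : FractionalIdeal θ.ring⁰ K} (hI : I ≠ 0) :
    ∃ α : Module.Basis (Fin n) ℚ K,
      toLattice I = AddSubgroup.closure (Set.range α) ∧ 0 < b.zetaBasis.det α := by
  obtain ⟨α, hα⟩ := exists_basis_toLattice_eq hI
  have : Nonempty (Fin n) := ⟨⟨0, b.degree_pos⟩⟩
  obtain ⟨α', hα', hdet⟩ := exists_basis_closure_range_eq_of_det_pos b.zetaBasis
    (α.reindex (finCongr b.finrank_eq))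
  exact ⟨α', by rw [hα', hα, Module.Basis.range_reindex], hdet⟩

theorem exists_eq_mul_expansion_iff (hn : 3 ≤ n) {δ : Kˣ} {x : K}
    (hx : x ∈ FractionalIdeal.spanSingleton θ.ring⁰ (δ : K) * θ.ideal ^ (n - 3)) (u w : ℤ) :
    (∃ c, x = δ * θ.expansion c u w) ↔
      (w : ℚ) = (-1) ^ ((n - 1) / 2) * b.lead ((δ : K)⁻¹ * x) ∧
      (u : ℚ) = (-1) ^ ((n - 1) / 2) * b.lead (θ.val * (δ : K)⁻¹ * x) := by
  refine ⟨fun ⟨c, hc⟩ => b.intCast_eq_of_eq_mul_expansion hn hc, fun ⟨hw, hu⟩ => ?_⟩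
  obtain ⟨c, u', w', hx'⟩ := exists_eq_mul_expansion hn hx
  obtain ⟨hw', hu'⟩ := b.intCast_eq_of_eq_mul_expansion hn hx'
  obtain rfl : u = u' := Int.cast_injective (hu.trans hu'.symm)
  obtain rfl : w = w' := Int.cast_injective (hw.trans hw'.symm)
  exact ⟨c, hx'⟩

theorem isGram_iff (hn : 3 ≤ n) {v : f.FormPair} {I : FractionalIdeal θ.ring⁰ K} {δ : Kˣ}
    {α : Module.Basis (Fin n) ℚ K}
    (hI : I ^ 2 ≤ FractionalIdeal.spanSingleton θ.ring⁰ (δ : K) * θ.ideal ^ (n - 3)) :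
    b.IsGram v I δ α ↔
      toLattice I = AddSubgroup.closure (Set.range α) ∧ 0 < b.zetaBasis.det α ∧
      ∀ i j, ∃ c, α i * α j = δ * θ.expansion c (v.B i j) (v.A i j) := by
  have entry (hα : toLattice I = AddSubgroup.closure (Set.range α)) (i j : Fin n) :=
    b.exists_eq_mul_expansion_iff hn (hI (mul_mem_sq_of_toLattice_eq hα i j)) (v.B i j) (v.A i j)
  constructor
  · rintro ⟨hα, hdet, hA, hB⟩
    rw [map_intCast_eq_smul_toMatrix_form] at hA hB
    exact ⟨hα, hdet, fun i j => (entry hα i j).2 ⟨hA i j, hB i j⟩⟩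
  · rintro ⟨hα, hdet, hc⟩
    refine ⟨hα, hdet, ?_, ?_⟩ <;> rw [map_intCast_eq_smul_toMatrix_form] <;> intro i j
    exacts [((entry hα i j).1 (hc i j)).1, ((entry hα i j).1 (hc i j)).2]

omit b in
theorem corresponds_iff_expansion {v : f.FormPair} {I : FractionalIdeal θ.ring⁰ K} {δ : Kˣ} :
    θ.Corresponds v I δ ↔
      I ^ 2 ≤ FractionalIdeal.spanSingleton θ.ring⁰ (δ : K) * θ.ideal ^ (n - 3) ∧
      latticeNorm I ^ 2 = Algebra.norm ℚ (δ : K) * latticeNorm (θ.ideal ^ (n - 3)) ∧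
      ∃ (α : Fin n → K) (M : Matrix (Fin n) (Fin n) ℚ), LinearIndependent ℤ α ∧
        Submodule.span ℤ (Set.range α) = (I : Submodule θ.ring K).restrictScalars ℤ ∧
        (∀ i, α i = ∑ j, M i j • θ.zeta j) ∧ 0 < M.det ∧
        ∀ i j, ∃ c, α i * α j = δ * θ.expansion c (v.B i j) (v.A i j) := Iff.rfl

theorem corresponds_iff (hn : 3 ≤ n) {v : f.FormPair} {I : FractionalIdeal θ.ring⁰ K} {δ : Kˣ} :
    θ.Corresponds v I δ ↔
      I ^ 2 ≤ FractionalIdeal.spanSingleton θ.ring⁰ (δ : K) * θ.ideal ^ (n - 3) ∧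
      latticeNorm I ^ 2 = Algebra.norm ℚ (δ : K) * latticeNorm (θ.ideal ^ (n - 3)) ∧
      ∃ α, b.IsGram v I δ α := by
  rw [corresponds_iff_expansion]
  refine and_congr_right fun hI => and_congr_right fun _ => ?_
  simp only [b.isGram_iff hn hI, span_eq_restrictScalars_iff]
  constructor
  · rintro ⟨α, M, -, hα, hM, hdet, hc⟩
    simp only [← b.zetaBasis_apply] at hM
    rw [← det_eq_det_of_eq_sum b.zetaBasis hM] at hdet
    refine ⟨basisOfDetNeZero b.zetaBasis α hdet.ne', ?_⟩
    rw [coe_basisOfDetNeZero]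
    exact ⟨hα, hdet, hc⟩
  · rintro ⟨α, hα, hdet, hc⟩
    refine ⟨α, (b.zetaBasis.toMatrix α).transpose, α.linearIndependent.restrict_scalars' ℤ, hα,
      ?_, ?_, hc⟩
    · simpa only [b.zetaBasis_apply] using eq_sum_transpose_toMatrix b.zetaBasis α
    · rwa [Matrix.det_transpose, ← Module.Basis.det_apply]

end Frame

end BinaryForm.Root

theorem BinaryForm.eval_pairInvariant {n : ℕ} (A B : Matrix (Fin n) (Fin n) ℤ) (x y : ℤ) :
    MvPolynomial.eval ![x, y] (BinaryForm.pairInvariant A B) = (x • A - y • B).det := by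
  rw [BinaryForm.pairInvariant, RingHom.map_det]
  congr 1
  ext i j
  simp [-zsmul_eq_mul]

theorem neg_one_pow_half_mul_of_odd {n : ℕ} (hodd : Odd n) :
    ((-1 : ℚ) ^ ((n - 1) / 2)) ^ n * (-1) ^ (n * (n - 1) / 2) = 1 := by
  obtain ⟨m, rfl⟩ := hodd
  rw [Nat.add_sub_cancel, Nat.mul_div_cancel_left m two_pos, Nat.mul_div_assoc _ ⟨m, rfl⟩,
    Nat.mul_div_cancel_left m two_pos, ← pow_mul, mul_comm m, ← mul_pow, neg_one_mul, neg_neg,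
    one_pow]

namespace BinaryForm.Root.Frame

variable {n : ℕ} {f : BinaryForm n} {K : Type*} [Field K] [NumberField K] {θ : f.Root K}
  (b : θ.Frame) {A B : Matrix (Fin n) (Fin n) ℤ} {δ : Kˣ} {α : Module.Basis (Fin n) ℚ K}

theorem isSymm_of_map_eq_smul_toMatrix_form {c : ℚ} {z : K}
    (hA : A.map (Int.cast : ℤ → ℚ) = c • LinearMap.BilinForm.toMatrix α (b.form z)) :
    A.IsSymm := by
  refine Matrix.map_injective (Int.cast_injective (α := ℚ)) ?_
  change A.transpose.map Int.cast = A.map Int.cast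
  rw [Matrix.transpose_map, hA, Matrix.transpose_smul]
  congr 1
  ext i j
  rw [Matrix.transpose_apply, LinearMap.BilinForm.toMatrix_apply, form_comm,
    LinearMap.BilinForm.toMatrix_apply]

theorem map_smul_sub_smul_eq_smul_toMatrix_form {c : ℚ}
    (hA : A.map (Int.cast : ℤ → ℚ) = c • LinearMap.BilinForm.toMatrix α (b.form (δ : K)⁻¹))
    (hB : B.map (Int.cast : ℤ → ℚ) =
      c • LinearMap.BilinForm.toMatrix α (b.form (θ.val * (δ : K)⁻¹))) (x y : ℤ) :
    (x • A - y • B).map (Int.cast : ℤ → ℚ) =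
      c • LinearMap.BilinForm.toMatrix α (b.form ((x - y * θ.val) * (δ : K)⁻¹)) := by
  ext i j
  have hAij := congrFun₂ hA i j
  have hBij := congrFun₂ hB i j
  simp only [Matrix.map_apply, Matrix.smul_apply, Matrix.sub_apply, smul_eq_mul, Int.cast_sub,
    Int.cast_mul, LinearMap.BilinForm.toMatrix_apply, form_apply] at hAij hBij ⊢
  have hsplit : (x - y * θ.val) * (δ : K)⁻¹ * (α i * α j) =
      (x : ℚ) • ((δ : K)⁻¹ * (α i * α j)) - (y : ℚ) • (θ.val * (δ : K)⁻¹ * (α i * α j)) := by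
    rw [Rat.smul_def, Rat.smul_def]
    push_cast
    ring
  rw [hsplit, map_sub, map_smul, map_smul, hAij, hBij, smul_eq_mul, smul_eq_mul]
  ring

theorem pairInvariant_eq_poly (hn : 3 ≤ n) (hodd : Odd n)
    (hdet : b.zetaBasis.det α ^ 2 = Algebra.norm ℚ (δ : K) * ((f.coef 0 : ℚ) ^ (n - 3))⁻¹)
    (hA : A.map (Int.cast : ℤ → ℚ) =
      ((-1) ^ ((n - 1) / 2) : ℚ) • LinearMap.BilinForm.toMatrix α (b.form (δ : K)⁻¹))
    (hB : B.map (Int.cast : ℤ → ℚ) =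
      ((-1) ^ ((n - 1) / 2) : ℚ) • LinearMap.BilinForm.toMatrix α (b.form (θ.val * (δ : K)⁻¹))) :
    pairInvariant A B = f.poly := by
  refine MvPolynomial.funext fun s => ?_
  rw [show s = ![s 0, s 1] from List.ofFn_inj.1 rfl]
  apply Int.cast_injective (α := ℚ)
  have hne := b.intCast_coef_zero_ne_zero
  have hnorm : Algebra.norm ℚ (δ : K)⁻¹ * Algebra.norm ℚ (δ : K) = 1 := by
    rw [← map_mul, inv_mul_cancel₀ δ.ne_zero, map_one]
  have hpow : (f.coef 0 : ℚ) ^ (n - 2) * ((f.coef 0 : ℚ) ^ (n - 3))⁻¹ = f.coef 0 := by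
    rw [show n - 2 = n - 3 + 1 by omega, pow_succ', mul_inv_cancel_right₀ (pow_ne_zero _ hne)]
  rw [eval_pairInvariant, Int.cast_det, b.map_smul_sub_smul_eq_smul_toMatrix_form hA hB,
    Matrix.det_smul, Fintype.card_fin, b.det_toMatrix_form (by omega), hdet, map_mul,
    ← b.coef_zero_mul_norm_intCast_sub]
  set ν := Algebra.norm ℚ ((s 0 : K) - s 1 * θ.val)
  calc _ = (((-1 : ℚ) ^ ((n - 1) / 2)) ^ n * (-1) ^ (n * (n - 1) / 2)) *
        ((f.coef 0 : ℚ) ^ (n - 2) * ((f.coef 0 : ℚ) ^ (n - 3))⁻¹) *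
        (Algebra.norm ℚ (δ : K)⁻¹ * Algebra.norm ℚ (δ : K)) * ν := by ring
    _ = f.coef 0 * ν := by
      rw [neg_one_pow_half_mul_of_odd hodd, hpow, hnorm, one_mul, mul_one]

variable [IsFractionRing θ.ring K]

theorem exists_isGram (hn : 3 ≤ n) (hodd : Odd n) {I : FractionalIdeal θ.ring⁰ K} (hI : I ≠ 0)
    (hsq : I ^ 2 ≤ FractionalIdeal.spanSingleton θ.ring⁰ (δ : K) * θ.ideal ^ (n - 3))
    (hnorm : latticeNorm I ^ 2 = Algebra.norm ℚ (δ : K) * latticeNorm (θ.ideal ^ (n - 3))) :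
    ∃ v α, b.IsGram v I δ α := by
  obtain ⟨α, hα, hpos⟩ := b.exists_basis_toLattice_eq_of_det_pos hI
  have hexpansion (i j : Fin n) :=
    exists_eq_mul_expansion hn (hsq (mul_mem_sq_of_toLattice_eq hα i j))
  choose c B A hBA using hexpansion
  have hA := b.map_intCast_eq_smul_toMatrix_form (A := Matrix.of A).2 fun i j =>
    (b.intCast_eq_of_eq_mul_expansion hn (hBA i j)).1
  have hB := b.map_intCast_eq_smul_toMatrix_form (A := Matrix.of B).2 fun i j =>
    (b.intCast_eq_of_eq_mul_expansion hn (hBA i j)).2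
  have heven : Even (n - 3) := Nat.Odd.sub_odd hodd (by decide)
  rw [latticeNorm_eq_abs_det b.toLattice_one hα, sq_abs, b.latticeNorm_ideal_pow (by omega) heven]
    at hnorm
  exact ⟨⟨Matrix.of A, Matrix.of B, b.isSymm_of_map_eq_smul_toMatrix_form hA,
    b.isSymm_of_map_eq_smul_toMatrix_form hB, b.pairInvariant_eq_poly hn hodd hnorm hA hB⟩, α,
    hα, hpos, hA, hB⟩

section Corresponds

include b

variable {v v' : f.FormPair}

theorem orbit_eq_of_corresponds (hn : 3 ≤ n) {I : FractionalIdeal θ.ring⁰ K}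
    (h : θ.Corresponds v I δ) (h' : θ.Corresponds v' I δ) : v.orbit = v'.orbit := by
  obtain ⟨-, -, α, hα⟩ := (b.corresponds_iff hn).1 h
  obtain ⟨-, -, α', hα'⟩ := (b.corresponds_iff hn).1 h'
  exact hα.orbit_eq hα'

theorem corresponds_of_orbit_eq (hn : 3 ≤ n) {I : FractionalIdeal θ.ring⁰ K}
    (h : θ.Corresponds v I δ) (hv : v.orbit = v'.orbit) : θ.Corresponds v' I δ := by
  obtain ⟨hsq, hnorm, α, hα⟩ := (b.corresponds_iff hn).1 h
  obtain ⟨g, rfl⟩ := Quotient.exact hv.symm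
  exact (b.corresponds_iff hn).2 ⟨hsq, hnorm, hα.smul g⟩

theorem corresponds_unique (hn : 3 ≤ n) {I I' : FractionalIdeal θ.ring⁰ K} {δ' : Kˣ}
    (h : θ.Corresponds v I δ) (h' : θ.Corresponds v I' δ') :
    ∃ κ : Kˣ, I' = FractionalIdeal.spanSingleton θ.ring⁰ (κ : K) * I ∧ δ' = κ ^ 2 * δ := by
  obtain ⟨-, -, α, hα⟩ := (b.corresponds_iff hn).1 h
  obtain ⟨-, -, α', hα'⟩ := (b.corresponds_iff hn).1 h'
  exact hα.unique hα'

variable {U : (FractionalIdeal θ.ring⁰ K)ˣ} (hU : (U : FractionalIdeal θ.ring⁰ K) = θ.ideal)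
  {p q : (FractionalIdeal θ.ring⁰ K)ˣ × Kˣ}

include hU

omit b in
theorem mem_projectivePairs_iff_mul_ideal_pow_le (hodd : Odd n) :
    p ∈ projectivePairs θ.ring K ↔
      (p.1 * θ.ideal ^ ((n - 3) / 2)) ^ 2 ≤
        FractionalIdeal.spanSingleton θ.ring⁰ (p.2 : K) * θ.ideal ^ (n - 3) ∧
      latticeNorm ((p.1 : FractionalIdeal θ.ring⁰ K) * θ.ideal ^ ((n - 3) / 2)) ^ 2 =
        Algebra.norm ℚ (p.2 : K) * latticeNorm (θ.ideal ^ (n - 3)) := by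
  have hhalf : 2 * ((n - 3) / 2) = n - 3 :=
    Nat.two_mul_div_two_of_even (Nat.Odd.sub_odd hodd (by decide))
  rw [mem_projectivePairs_iff_mul_pow_le U ((n - 3) / 2), hhalf, hU, Units.val_mul,
    Units.val_pow_eq_pow_val, hU]

theorem corresponds_mul_ideal_pow_iff (hn : 3 ≤ n) (hodd : Odd n) :
    θ.Corresponds v (p.1 * θ.ideal ^ ((n - 3) / 2)) p.2 ↔
      p ∈ projectivePairs θ.ring K ∧
        ∃ α, b.IsGram v (p.1 * θ.ideal ^ ((n - 3) / 2)) p.2 α := by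
  rw [b.corresponds_iff hn, mem_projectivePairs_iff_mul_ideal_pow_le hU hodd, and_assoc]

theorem exists_corresponds (hn : 3 ≤ n) (hodd : Odd n) (hp : p ∈ projectivePairs θ.ring K) :
    ∃ v : f.FormPair, θ.Corresponds v (p.1 * θ.ideal ^ ((n - 3) / 2)) p.2 := by
  have hne : (p.1 : FractionalIdeal θ.ring⁰ K) * θ.ideal ^ ((n - 3) / 2) ≠ 0 := by
    rw [← hU, ← Units.val_pow_eq_pow_val, ← Units.val_mul]
    exact Units.ne_zero _
  obtain ⟨hsq, hnorm⟩ := (mem_projectivePairs_iff_mul_ideal_pow_le hU hodd).1 hp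
  obtain ⟨v, hv⟩ := b.exists_isGram hn hodd hne hsq hnorm
  exact ⟨v, (b.corresponds_mul_ideal_pow_iff hU hn hodd).2 ⟨hp, hv⟩⟩

theorem exists_corresponds_of_isProjective (hn : 3 ≤ n) (hodd : Odd n) (hv : θ.IsProjective v) :
    ∃ p : projectivePairs θ.ring K,
      θ.Corresponds v (p.1.1 * θ.ideal ^ ((n - 3) / 2)) p.1.2 := by
  obtain ⟨_, δ, h, I, rfl⟩ := hv
  have hI : (I : FractionalIdeal θ.ring⁰ K) =
      ((I * (U ^ ((n - 3) / 2))⁻¹, δ) : (FractionalIdeal θ.ring⁰ K)ˣ × Kˣ).1 *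
        θ.ideal ^ ((n - 3) / 2) := by
    rw [← hU, ← Units.val_pow_eq_pow_val, ← Units.val_mul, inv_mul_cancel_right]
  rw [hI] at h
  exact ⟨⟨_, ((b.corresponds_mul_ideal_pow_iff hU hn hodd).1 h).1⟩, h⟩

theorem corresponds_iff_mk_eq_mk (hn : 3 ≤ n) (hodd : Odd n) {p q : projectivePairs θ.ring K}
    (hp : θ.Corresponds v (p.1.1 * θ.ideal ^ ((n - 3) / 2)) p.1.2) :
    θ.Corresponds v (q.1.1 * θ.ideal ^ ((n - 3) / 2)) q.1.2 ↔
      (QuotientGroup.mk p : HGroup θ.ring K) = QuotientGroup.mk q := by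
  rw [mk_eq_mk_iff]
  constructor
  · intro hq
    obtain ⟨κ, hI, hδ⟩ := b.corresponds_unique hn hp hq
    refine ⟨κ, mul_right_cancel (b := U ^ ((n - 3) / 2)) (Units.ext ?_), hδ⟩
    simp only [Units.val_mul, Units.val_pow_eq_pow_val, hU, coe_toPrincipalIdeal]
    rw [hI, mul_assoc]
  · rintro ⟨κ, hI, hδ⟩
    obtain ⟨-, α, hα⟩ := (b.corresponds_mul_ideal_pow_iff hU hn hodd).1 hp
    refine (b.corresponds_mul_ideal_pow_iff hU hn hodd).2 ⟨q.2, ?_⟩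
    rw [hI, hδ, Units.val_mul, coe_toPrincipalIdeal, mul_assoc]
    exact hα.scale hodd κ

theorem exists_equiv_projectiveOrbit (hn : 3 ≤ n) (hodd : Odd n) :
    ∃ Φ : HGroup θ.ring K ≃ θ.ProjectiveOrbit,
      ∀ (p : projectivePairs θ.ring K) (v : f.FormPair),
        (Φ (QuotientGroup.mk p)).1 = v.orbit ↔
          θ.Corresponds v (p.1.1 * θ.ideal ^ ((n - 3) / 2)) p.1.2 := by
  choose V hV using fun p : projectivePairs θ.ring K => b.exists_corresponds hU hn hodd p.2
  let F (x : HGroup θ.ring K) : θ.ProjectiveOrbit :=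
    ⟨(V x.out).orbit, V x.out, rfl, _, _, hV x.out, by
      rw [← hU, ← Units.val_pow_eq_pow_val, ← Units.val_mul]
      exact Units.isUnit _⟩
  have hF (p : projectivePairs θ.ring K) (v : f.FormPair) :
      (F (QuotientGroup.mk p)).1 = v.orbit ↔
        θ.Corresponds v (p.1.1 * θ.ideal ^ ((n - 3) / 2)) p.1.2 := by
    have hp := (b.corresponds_iff_mk_eq_mk hU hn hodd (hV _)).2
      (QuotientGroup.out_eq' (QuotientGroup.mk p : HGroup θ.ring K))
    exact ⟨b.corresponds_of_orbit_eq hn hp, b.orbit_eq_of_corresponds hn hp⟩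
  refine ⟨Equiv.ofBijective F ⟨fun x y hxy => ?_, fun ⟨o, v, hv, hproj⟩ => ?_⟩, hF⟩
  · obtain ⟨p, rfl⟩ := QuotientGroup.mk_surjective x
    obtain ⟨q, rfl⟩ := QuotientGroup.mk_surjective y
    refine (b.corresponds_iff_mk_eq_mk hU hn hodd (hV p)).1 ((hF q _).1 ?_)
    rw [← hxy]
    exact (hF p _).2 (hV p)
  · obtain ⟨p, hp⟩ := b.exists_corresponds_of_isProjective hU hn hodd hproj
    exact ⟨QuotientGroup.mk p, Subtype.ext (((hF p v).2 hp).trans hv)⟩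

end Corresponds

end BinaryForm.Root.Frame

/-! ### Reducible orbits -/

section StableCore

open Module

variable {F V : Type*} [Field F] [AddCommGroup V] [Module F V] (T : End F V) (W : Submodule F V)

/-- The subspace of the vectors `x` with `x, T x, …, T ^ k x ∈ W`. -/
def stableCore : ℕ → Submodule F V
  | 0 => W
  | k + 1 => stableCore k ⊓ (stableCore k).comap T

variable {T W}

theorem pow_apply_mem_of_mem_stableCore {k : ℕ} {x : V} (hx : x ∈ stableCore T W k) {j : ℕ}
    (hj : j ≤ k) : (T ^ j) x ∈ W := by
  induction k generalizing x j with
  | zero => obtain rfl := Nat.le_zero.1 hj; exact hx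
  | succ k ih =>
    cases j with
    | zero => exact ih hx.1 (Nat.zero_le k)
    | succ j => rw [pow_succ, End.mul_apply]; exact ih hx.2 (Nat.le_of_succ_le_succ hj)

variable [FiniteDimensional F V]

theorem two_mul_finrank_le_finrank_add_finrank_inf_comap (hT : Function.Injective T)
    {P Q : Submodule F V} (hQ : Q ≤ P) (hTQ : Q.map T ≤ P) :
    2 * finrank F Q ≤ finrank F P + finrank F (Q ⊓ Q.comap T : Submodule F V) := by
  have hmap (S : Submodule F V) : finrank F (S.map T) = finrank F S :=
    (Submodule.equivMapOfInjective T hT S).finrank_eq.symm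
  have hsum := Submodule.finrank_sup_add_finrank_inf_eq (Q.map T) Q
  have hsup := Submodule.finrank_mono (sup_le hTQ hQ)
  rw [Submodule.map_inf_eq_map_inf_comap, hmap, hmap] at hsum
  omega

theorem finrank_le_finrank_stableCore_add (hT : Function.Injective T) {P : Submodule F V}
    (hW : W ≤ P) (hTW : W.map T ≤ P) (hP : finrank F P ≤ finrank F W + 1) (k : ℕ) :
    finrank F W ≤ finrank F (stableCore T W k) + k := by
  have hstep (k : ℕ) : finrank F (stableCore T W k) ≤ finrank F (stableCore T W (k + 1)) + 1 := by
    induction k with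
    | zero =>
      have := two_mul_finrank_le_finrank_add_finrank_inf_comap hT hW hTW
      change finrank F W ≤ finrank F (W ⊓ W.comap T : Submodule F V) + 1
      omega
    | succ k ih =>
      have := two_mul_finrank_le_finrank_add_finrank_inf_comap hT
        (P := stableCore T W k) (Q := stableCore T W (k + 1)) inf_le_left
        (Submodule.map_le_iff_le_comap.2 inf_le_right)
      change _ ≤ finrank F (stableCore T W (k + 1) ⊓ (stableCore T W (k + 1)).comap T :
        Submodule F V) + 1
      omega
  induction k with
  | zero => exact le_rfl
  | succ k ih => have := hstep k; omega

theorem exists_ne_zero_forall_pow_apply_mem (hT : Function.Injective T)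
    {B : LinearMap.BilinForm F V} (hB : B.Nondegenerate) (hV : finrank F V = 2 * finrank F W + 1)
    (hW : ∀ x ∈ W, ∀ y ∈ W, B x y = 0) (hTW : ∀ x ∈ W, ∀ y ∈ W, B x (T y) = 0) {k : ℕ}
    (hk : k < finrank F W) : ∃ w ≠ 0, ∀ j ≤ k, (T ^ j) w ∈ W := by
  have horth : finrank F (B.orthogonal W) = finrank F W + 1 := by
    rw [LinearMap.BilinForm.finrank_orthogonal hB]
    omega
  have hcore := finrank_le_finrank_stableCore_add (P := B.orthogonal W) hT
    (fun y hy x hx => hW x hx y hy)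
    (Submodule.map_le_iff_le_comap.2 fun y hy x hx => hTW x hx y hy) horth.le k
  have hne : stableCore T W k ≠ ⊥ := by
    intro hbot
    rw [hbot, finrank_bot] at hcore
    omega
  obtain ⟨w, hw, hw0⟩ := Submodule.exists_mem_ne_zero_of_ne_bot hne
  exact ⟨w, hw0, fun _ => pow_apply_mem_of_mem_stableCore hw⟩

end StableCore

theorem apply_eq_zero_of_forall_apply_self_eq_zero {F V : Type*} [Field F] [NeZero (2 : F)]
    [AddCommGroup V] [Module F V] {B : LinearMap.BilinForm F V} (hB : B.IsSymm)
    {W : Submodule F V} (hW : ∀ x ∈ W, B x x = 0) {x y : V} (hx : x ∈ W) (hy : y ∈ W) :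
    B x y = 0 := by
  have hadd := hW (x + y) (add_mem hx hy)
  rw [map_add, map_add, LinearMap.add_apply, LinearMap.add_apply, hW x hx, hW y hy, zero_add,
    add_zero, hB.eq y x, ← two_mul] at hadd
  exact (mul_eq_zero.1 hadd).resolve_left two_ne_zero

theorem isSquare_of_sq_eq_algebraMap_mul {F K : Type*} [Field F] [Field K] [Algebra F K]
    (hodd : Odd (Module.finrank F K)) {δ w : K} {c : F} (hδ : IsSquare (Algebra.norm F δ))
    (hw : w ≠ 0) (h : w ^ 2 = algebraMap F K c * δ) : IsSquare δ := by
  have := FiniteDimensional.of_finrank_pos hodd.pos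
  obtain ⟨m, hm⟩ := hodd
  obtain ⟨q, hq⟩ := hδ
  have hN := congrArg (Algebra.norm F) h
  rw [map_pow, map_mul, Algebra.norm_algebraMap, hq, hm] at hN
  have hNw : Algebra.norm F w ≠ 0 := Algebra.norm_ne_zero_iff.2 hw
  have hc0 : c ≠ 0 := by
    rintro rfl
    exact hw (by simpa using h)
  have hq0 : q ≠ 0 := by
    rintro rfl
    exact pow_ne_zero 2 hNw (by simpa using hN)
  set r := Algebra.norm F w / (c ^ m * q) with hr
  have hc : c = r ^ 2 := by
    rw [hr, div_pow, hN]
    field_simp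
    ring
  have hr0 : algebraMap F K r ≠ 0 :=
    (map_ne_zero _).2 (div_ne_zero hNw (mul_ne_zero (pow_ne_zero m hc0) hq0))
  rw [isSquare_iff_exists_sq]
  refine ⟨w / algebraMap F K r, ?_⟩
  rw [div_pow, h, hc, map_pow, mul_div_cancel_left₀ _ (pow_ne_zero 2 hr0)]

namespace BinaryForm.Root.Frame

variable {n : ℕ} {f : BinaryForm n} {K : Type*} [Field K] [NumberField K] {θ : f.Root K}
  (b : θ.Frame)

theorem exists_eq_algebraMap_of_lead_mul_pow_eq_zero {z : K}
    (h : ∀ k, k + 1 < n → b.lead (z * θ.val ^ k) = 0) : ∃ c : ℚ, z = algebraMap ℚ K c := by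
  set c := (f.coef 0 : ℚ) * b.lead (z * θ.val ^ (n - 1)) with hc
  refine ⟨c, sub_eq_zero.1 (b.eq_zero_of_forall_lead_mul fun y => ?_)⟩
  have hzero : b.lead ∘ₗ LinearMap.mulLeft ℚ (z - algebraMap ℚ K c) = 0 := by
    refine b.basis.ext fun i => ?_
    rw [LinearMap.comp_apply, LinearMap.mulLeft_apply, b.basis_apply, sub_mul, map_sub,
      ← Algebra.smul_def, map_smul, smul_eq_mul, LinearMap.zero_apply, b.lead_pow i.2]
    split_ifs with hi
    · rw [hc, show (i : ℕ) = n - 1 by omega, mul_right_comm,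
        mul_inv_cancel₀ b.intCast_coef_zero_ne_zero, one_mul, sub_self]
    · rw [h i (by omega), mul_zero, sub_zero]
  exact LinearMap.congr_fun hzero y

include b in
theorem val_ne_zero (hn : 2 ≤ n) : θ.val ≠ 0 := by
  have := b.basis.ne_zero ⟨1, hn⟩
  rwa [b.basis_apply, pow_one] at this

theorem isSquare_of_isotropic (hn : 3 ≤ n) (hodd : Odd n) {V : Submodule ℚ K}
    (hV : Module.finrank ℚ V = (n - 3) / 2 + 1) {δ : K} (hδ0 : δ ≠ 0)
    (hδ : IsSquare (Algebra.norm ℚ δ)) (hiso : ∀ x ∈ V, ∀ y ∈ V, b.form δ⁻¹ x y = 0)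
    (hθiso : ∀ x ∈ V, ∀ y ∈ V, b.form (θ.val * δ⁻¹) x y = 0) : IsSquare δ := by
  obtain ⟨m, hm⟩ := hodd
  have hfinrank : Module.finrank ℚ K = 2 * Module.finrank ℚ V + 1 := by
    rw [b.finrank_eq, hV]; omega
  have hθ (x y : K) : b.form δ⁻¹ x (θ.val * y) = b.form (θ.val * δ⁻¹) x y := by
    rw [form_comm, ← form_mul, form_comm]
  obtain ⟨w, hw, hwV⟩ := exists_ne_zero_forall_pow_apply_mem
    (T := LinearMap.mulLeft ℚ θ.val) (mul_right_injective₀ (b.val_ne_zero (by omega)))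
    (b.form_nondegenerate (inv_ne_zero hδ0)) hfinrank hiso
    (fun x hx y hy => (hθ x y).trans (hθiso x hx y hy)) (k := m - 1) (by omega)
  simp only [LinearMap.pow_mulLeft, LinearMap.mulLeft_apply] at hwV
  -- Every `θ ^ k` with `k < 2 * m` is `θ ^ i * θ ^ j` or `θ * θ ^ i * θ ^ j` with `i, j < m`.
  obtain ⟨c, hc⟩ := b.exists_eq_algebraMap_of_lead_mul_pow_eq_zero (z := δ⁻¹ * w ^ 2) fun k hk => by
    rcases Nat.lt_or_ge k m with hkm | hkm
    · rw [← hiso _ (hwV k (by omega)) _ (hwV 0 (Nat.zero_le _)), form_apply]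
      congr 1
      ring
    · have hpow : θ.val ^ k = θ.val * θ.val ^ (m - 1) * θ.val ^ (k - m) := by
        rw [← pow_succ', ← pow_add]; congr 1; omega
      rw [← hθiso _ (hwV (m - 1) le_rfl) _ (hwV (k - m) (by omega)), form_apply, hpow]
      congr 1
      ring
  refine isSquare_of_sq_eq_algebraMap_mul (b.finrank_eq ▸ ⟨m, hm⟩) hδ hw (c := c) ?_
  rw [← hc, mul_right_comm, inv_mul_cancel₀ hδ0, one_mul]

section IsGram

variable {b} {v : f.FormPair} {I : FractionalIdeal θ.ring⁰ K} {δ : Kˣ}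
  {α : Module.Basis (Fin n) ℚ K}

theorem IsGram.isReducible_iff (h : b.IsGram v I δ α) :
    v.IsReducible ↔ ∃ V : Submodule ℚ K, Module.finrank ℚ V = (n - 3) / 2 + 1 ∧
      ∀ x ∈ V, b.form (δ : K)⁻¹ x x = 0 ∧ b.form (θ.val * (δ : K)⁻¹) x x = 0 := by
  have hiso (w : Fin n → ℚ) : (w ⬝ᵥ (v.A.map Int.cast).mulVec w = 0 ∧
      w ⬝ᵥ (v.B.map Int.cast).mulVec w = 0) ↔
      b.form (δ : K)⁻¹ (α.equivFun.symm w) (α.equivFun.symm w) = 0 ∧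
        b.form (θ.val * (δ : K)⁻¹) (α.equivFun.symm w) (α.equivFun.symm w) = 0 := by
    simp only [h.map_A, h.map_B, Matrix.smul_mulVec, dotProduct_smul, smul_eq_mul,
      LinearMap.BilinForm.dotProduct_toMatrix_mulVec, mul_eq_zero, pow_eq_zero_iff',
      neg_eq_zero, one_ne_zero, false_and, false_or]
  constructor
  · rintro ⟨W, hW, hWiso⟩
    refine ⟨W.map α.equivFun.symm.toLinearMap, by rw [LinearEquiv.finrank_map_eq, hW], ?_⟩
    rintro _ ⟨w, hw, rfl⟩
    exact (hiso w).1 (hWiso w hw)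
  · rintro ⟨V, hV, hViso⟩
    refine ⟨V.map α.equivFun.toLinearMap, by rw [LinearEquiv.finrank_map_eq, hV], ?_⟩
    rintro _ ⟨x, hx, rfl⟩
    refine (hiso _).2 ?_
    rw [LinearEquiv.coe_coe, LinearEquiv.symm_apply_apply]
    exact hViso x hx

theorem IsGram.isSquare (hn : 3 ≤ n) (hodd : Odd n) (h : b.IsGram v I δ α)
    (hδ : IsSquare (Algebra.norm ℚ (δ : K))) (hv : v.IsReducible) : IsSquare δ := by
  obtain ⟨V, hV, hiso⟩ := h.isReducible_iff.1 hv
  obtain ⟨κ, hκ⟩ := b.isSquare_of_isotropic hn hodd hV δ.ne_zero hδ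
    (fun _ hx _ hy => apply_eq_zero_of_forall_apply_self_eq_zero ⟨b.form_comm _⟩
      (fun x hx => (hiso x hx).1) hx hy)
    (fun _ hx _ hy => apply_eq_zero_of_forall_apply_self_eq_zero ⟨b.form_comm _⟩
      (fun x hx => (hiso x hx).2) hx hy)
  exact ⟨Units.mk0 κ (left_ne_zero_of_mul (hκ ▸ δ.ne_zero)), Units.ext hκ⟩

theorem IsGram.isReducible (hn : 3 ≤ n) (hodd : Odd n) {κ : Kˣ} (h : b.IsGram v I (κ ^ 2) α) :
    v.IsReducible := by
  obtain ⟨m, hm⟩ := hodd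
  let u (j : Fin m) : K := κ * θ.val ^ (j : ℕ)
  have hu : LinearIndependent ℚ u := by
    have hind := (b.basis.linearIndependent.comp (Fin.castLE (by omega : m ≤ n))
      (Fin.castLE_injective _)).map' (LinearMap.mulLeft ℚ (κ : K))
      (LinearMap.ker_eq_bot.2 (mul_right_injective₀ κ.ne_zero))
    have hcomp : u = LinearMap.mulLeft ℚ (κ : K) ∘ b.basis ∘ Fin.castLE (by omega : m ≤ n) :=
      funext fun j => by simp [u, b.basis_apply]
    rwa [hcomp]
  have hform (i j : Fin m) : b.form ((κ ^ 2 : Kˣ) : K)⁻¹ (u i) (u j) = 0 := by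
    rw [form_apply, ← b.lead_pow_of_succ_lt (k := i + j) (by omega)]
    congr 1
    simp only [u, Units.val_pow_eq_pow_val]
    field_simp [κ.ne_zero]
    ring
  have hθform (i j : Fin m) : b.form (θ.val * ((κ ^ 2 : Kˣ) : K)⁻¹) (u i) (u j) = 0 := by
    rw [form_apply, ← b.lead_pow_of_succ_lt (k := i + j + 1) (by omega)]
    congr 1
    simp only [u, Units.val_pow_eq_pow_val]
    field_simp [κ.ne_zero]
    ring
  have hspan {z : K} (hz : ∀ i j, b.form z (u i) (u j) = 0) {x : K}
      (hx : x ∈ Submodule.span ℚ (Set.range u)) : b.form z x x = 0 :=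
    LinearMap.BilinMap.apply_apply_mem_of_mem_span ⊥ _ _ (b.form z)
      (by rintro _ ⟨i, rfl⟩ _ ⟨j, rfl⟩; exact hz i j) x x hx hx
  refine h.isReducible_iff.2 ⟨Submodule.span ℚ (Set.range u), ?_, fun x hx =>
    ⟨hspan hform hx, hspan hθform hx⟩⟩
  rw [finrank_span_eq_card hu, Fintype.card_fin]
  omega

end IsGram

end BinaryForm.Root.Frame

section TorsionPair

variable {O K : Type*} [CommRing O] [IsDomain O] [Module.Finite ℤ O] [CharZero O] [Field K]
  [NumberField K] [Algebra O K] [IsFractionRing O K]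

/-- The pair `(J, 1)` attached to an invertible fractional ideal `J` with `J² = O`. -/
def torsionPair (J : twoTorsionIdeals O K) : projectivePairs O K :=
  ⟨(J.1, 1), mem_projectivePairs_iff_norm_nonneg.2
    ⟨(map_one _).trans (MonoidHom.mem_ker.1 J.2).symm, by simp⟩⟩

theorem mk_torsionPair_injective : Function.Injective
    fun J : twoTorsionIdeals O K => (QuotientGroup.mk (torsionPair J) : HGroup O K) := by
  intro J J' h
  obtain ⟨κ, hJ, hκ⟩ := mk_eq_mk_iff.1 h
  have hκ : (κ : K) ^ 2 = 1 ^ 2 := by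
    simpa [torsionPair, Units.ext_iff, eq_comm] using hκ
  have hprincipal : toPrincipalIdeal O K κ = 1 := by
    rcases eq_or_eq_neg_of_sq_eq_sq _ _ hκ with hκ | hκ
    · rw [show κ = 1 from Units.ext hκ, map_one]
    · rw [show κ = -1 from Units.ext hκ, toPrincipalIdeal_neg, map_one]
  rw [hprincipal, one_mul] at hJ
  exact Subtype.ext hJ.symm

theorem exists_mk_torsionPair_eq {p : projectivePairs O K} (hp : IsSquare p.1.2) :
    ∃ J : twoTorsionIdeals O K,
      (QuotientGroup.mk (torsionPair J) : HGroup O K) = QuotientGroup.mk p := by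
  obtain ⟨κ, hκ⟩ := (isSquare_iff_exists_sq _).1 hp
  have hsq := (mem_projectivePairs_iff.1 p.2).1
  refine ⟨⟨(toPrincipalIdeal O K κ)⁻¹ * p.1.1, MonoidHom.mem_ker.2 ?_⟩,
    mk_eq_mk_iff.2 ⟨κ, (mul_inv_cancel_left _ _).symm, by rw [hκ]; exact (mul_one _).symm⟩⟩
  rw [powMonoidHom_apply, mul_pow, ← hsq, hκ, map_pow, inv_pow, inv_mul_cancel]

end TorsionPair

namespace BinaryForm.Root.Frame

variable {n : ℕ} {f : BinaryForm n} {K : Type*} [Field K] [NumberField K] {θ : f.Root K}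
  [IsFractionRing θ.ring K] (b : θ.Frame) {U : (FractionalIdeal θ.ring⁰ K)ˣ}
  (hU : (U : FractionalIdeal θ.ring⁰ K) = θ.ideal) {v : f.FormPair}

include b

theorem isReducible_iff_isSquare (hn : 3 ≤ n) (hodd : Odd n) {I : FractionalIdeal θ.ring⁰ K}
    {δ : Kˣ} (h : θ.Corresponds v I δ) (hδ : IsSquare (Algebra.norm ℚ (δ : K))) :
    v.IsReducible ↔ IsSquare δ := by
  obtain ⟨-, -, α, hα⟩ := (b.corresponds_iff hn).1 h
  refine ⟨hα.isSquare hn hodd hδ, fun hsq => ?_⟩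
  obtain ⟨κ, rfl⟩ := (isSquare_iff_exists_sq δ).1 hsq
  exact hα.isReducible hn hodd

include hU

theorem corresponds_torsionPair_iff (hn : 3 ≤ n) (hodd : Odd n) (J : twoTorsionIdeals θ.ring K) :
    θ.Corresponds v ((torsionPair J).1.1 * θ.ideal ^ ((n - 3) / 2)) (torsionPair J).1.2 ↔
      ∃ κ : Kˣ, θ.Corresponds v (FractionalIdeal.spanSingleton θ.ring⁰ (κ : K) * J.1 *
        θ.ideal ^ ((n - 3) / 2)) (κ ^ 2) := by
  constructor
  · intro h
    refine ⟨1, ?_⟩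
    rwa [Units.val_one, FractionalIdeal.spanSingleton_one, one_mul, one_pow]
  · rintro ⟨κ, h⟩
    rw [← coe_toPrincipalIdeal, ← Units.val_mul] at h
    have hmem := ((b.corresponds_mul_ideal_pow_iff hU
      (p := (toPrincipalIdeal θ.ring K κ * J.1, κ ^ 2)) hn hodd).1 h).1
    refine (b.corresponds_iff_mk_eq_mk hU hn hodd (p := ⟨_, hmem⟩) h).2 (Eq.symm ?_)
    exact mk_eq_mk_iff.2 ⟨κ, rfl, (mul_one _).symm⟩

theorem exists_equiv_twoTorsionIdeals (hn : 3 ≤ n) (hodd : Odd n)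
    (Φ : HGroup θ.ring K ≃ θ.ProjectiveOrbit)
    (hΦ : ∀ (p : projectivePairs θ.ring K) (v : f.FormPair),
      (Φ (QuotientGroup.mk p)).1 = v.orbit ↔
        θ.Corresponds v (p.1.1 * θ.ideal ^ ((n - 3) / 2)) p.1.2) :
    ∃ Ψ : θ.ReducibleProjectiveOrbit ≃ twoTorsionIdeals θ.ring K,
      ∀ (o : θ.ReducibleProjectiveOrbit) (v : f.FormPair), v.orbit = o.1.1 →
        ∀ J : twoTorsionIdeals θ.ring K, Ψ o = J ↔
          ∃ κ : Kˣ, θ.Corresponds v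
            (FractionalIdeal.spanSingleton θ.ring⁰ (κ : K) * J.1 * θ.ideal ^ ((n - 3) / 2))
            (κ ^ 2) := by
  have hnorm (p : projectivePairs θ.ring K) : IsSquare (Algebra.norm ℚ (p.1.2 : K)) :=
    ⟨_, ((mem_projectivePairs_iff.1 p.2).2.symm.trans (sq _))⟩
  have hred (J : twoTorsionIdeals θ.ring K) : ∃ v : f.FormPair,
      v.orbit = (Φ (QuotientGroup.mk (torsionPair J))).1 ∧ v.IsReducible := by
    obtain ⟨v, hv⟩ := b.exists_corresponds hU hn hodd (torsionPair J).2
    exact ⟨v, ((hΦ _ v).2 hv).symm,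
      (b.isReducible_iff_isSquare hn hodd hv (hnorm _)).2 IsSquare.one⟩
  let Ω (J : twoTorsionIdeals θ.ring K) : θ.ReducibleProjectiveOrbit := ⟨_, hred J⟩
  have hΩ : Function.Bijective Ω := by
    refine ⟨fun J J' h => mk_torsionPair_injective (Φ.injective (congrArg Subtype.val h)), ?_⟩
    rintro ⟨o, v, hvo, hv⟩
    obtain ⟨x, rfl⟩ := Φ.surjective o
    obtain ⟨p, rfl⟩ := QuotientGroup.mk_surjective x
    obtain ⟨J, hJ⟩ := exists_mk_torsionPair_eq
      ((b.isReducible_iff_isSquare hn hodd ((hΦ p v).1 hvo.symm) (hnorm p)).1 hv)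
    exact ⟨J, Subtype.ext (congrArg Φ hJ)⟩
  refine ⟨(Equiv.ofBijective Ω hΩ).symm, fun o v hv J => ?_⟩
  rw [← b.corresponds_torsionPair_iff hU hn hodd, ← hΦ, Equiv.symm_apply_eq,
    Equiv.ofBijective_apply, hv, eq_comm]
  exact Subtype.ext_iff.trans Subtype.ext_iff

end BinaryForm.Root.Frame

end BinaryFormOrder

theorem mainTheorem8 (n : ℕ) (hn : Odd n) (hn3 : 3 ≤ n) (f : BinaryFormOrder.BinaryForm n)
    (hprim : f.IsPrimitive) (hirr : f.IsIrreducible) (hnd : f.IsNondegenerate)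
    (K : Type*) [Field K] [NumberField K] (θ : f.Root K) [IsFractionRing θ.ring K] :
    (∃ Φ : BinaryFormOrder.HGroup θ.ring K ≃ θ.ProjectiveOrbit,
      ∀ (p : BinaryFormOrder.projectivePairs θ.ring K) (v : f.FormPair),
        (Φ (QuotientGroup.mk p)).1 = v.orbit ↔
          θ.Corresponds v (p.1.1 * θ.ideal ^ ((n - 3) / 2)) p.1.2) ∧
    Finite θ.ProjectiveOrbit ∧
    Nat.card θ.ProjectiveOrbit =
      2 ^ (NumberField.InfinitePlace.nrRealPlaces K +
        NumberField.InfinitePlace.nrComplexPlaces K - 1) *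
      Nat.card (BinaryFormOrder.twoTorsionClasses θ.ring) ∧
    (∃ Ψ : θ.ReducibleProjectiveOrbit ≃ BinaryFormOrder.twoTorsionIdeals θ.ring K,
      ∀ (o : θ.ReducibleProjectiveOrbit) (v : f.FormPair), v.orbit = o.1.1 →
        ∀ J : BinaryFormOrder.twoTorsionIdeals θ.ring K, Ψ o = J ↔
          ∃ κ : Kˣ, θ.Corresponds v
            (FractionalIdeal.spanSingleton (nonZeroDivisors θ.ring) (κ : K) * J.1 *
              θ.ideal ^ ((n - 3) / 2)) (κ ^ 2)) := by
  obtain ⟨b⟩ := θ.nonempty_frame hirr (by omega)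
  have hunit := θ.isUnit_ideal (by omega) hprim
  have hodd : Odd (Module.finrank ℚ K) := by rwa [b.finrank_eq]
  have hrank : NumberField.Units.rank K = NumberField.InfinitePlace.nrRealPlaces K +
      NumberField.InfinitePlace.nrComplexPlaces K - 1 := by
    rw [NumberField.Units.rank, NumberField.InfinitePlace.card_eq_nrRealPlaces_add_nrComplexPlaces]
  obtain ⟨Φ, hΦ⟩ := b.exists_equiv_projectiveOrbit hunit.unit_spec hn3 hn
  have hfin : Finite (BinaryFormOrder.HGroup θ.ring K) := BinaryFormOrder.finite_HGroup hodd
  refine ⟨⟨Φ, hΦ⟩, Finite.of_equiv _ Φ, ?_,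
    b.exists_equiv_twoTorsionIdeals hunit.unit_spec hn3 hn Φ hΦ⟩
  rw [← Nat.card_congr Φ, BinaryFormOrder.card_HGroup hodd, hrank]
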